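/- Setting. Let $F=\frac1M\sum_{m=1}^M F_m$ on $\mathbb R^n$, where every $F_m$ has an $L$-Lipschitz gradient. Client $m$ has access to independent stochastic gradients $g_m(x;\xi)$ of its own function $F_m$, with $\mathbb E\,g_m(x;\xi)=\nabla F_m(x)$ and $\mathbb E\|g_m(x;\xi)-\nabla F_m(x)\|^2\le\sigma^2$. Catalyst. Put $y^0=y^1=x^0$. For $s=1,\dots,S$, iteration $s$ computes an $x^s$ with $\mathbb E[F^s(x^s)-\min F^s]\le\epsilon^s$, where $F^s(x)=F(x)+L\|x-y^s\|^2$, and sets $y^{s+1}=x^s+\beta_s(x^s-x^{s-1})$. Here $\beta_s=\frac{\alpha_{s-1}(1-\alpha_{s-1})}{\alpha_{s-1}^2+\alpha_s}$ with $\alpha_s>0$, $\alpha_s^2=(1-\alpha_s)\alpha_{s-1}^2+q\alpha_s$; in the strongly convex case $q=\frac{\mu}{\mu+2L}$ and $\alpha_0=\sqrt q$, in the convex case $q=0$ and $\alpha_0=1$; in the nonconvex case $\beta_s=0$. SCAFFOLD. Subproblem $s$ is solved by SCAFFOLD with all $M$ clients participating, with local functions $F_m+L\|\cdot-y^s\|^2$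 and stochastic gradients $\hat g_m(v)=g_m(v;\xi)+2L(v-y^s)$ (a fresh $\xi$ in each call), started at $x=x^{s-1}+\theta(y^s-y^{s-1})$, where $\theta=\frac{2L}{2L+\mu}$, $1$, $0$ in the strongly convex, convex and nonconvex case. Initially $c_m=\hat g_m(x)$ and $c=\frac1M\sum_m c_m$. In each of $T_s$ communication rounds, client $m$ sets $v_m\leftarrow x$, repeats $K_s$ times the local step $v_m\leftarrow v_m-\eta_l(\hat g_m(v_m)-c_m+c)$ and puts $c_m^+=c_m-c+\frac{1}{K_s\eta_l}(x-v_m)$; then $x\leftarrow x+\eta_g\frac1M\sum_m(v_m-x)$, $c\leftarrow c+\frac1M\sum_m(c_m^+-c_m)$ and $c_m\leftarrow c_m^+$. The output $x^s$ is a weighted average (nonnegative weights, to be chosen) of the $T_s+1$ server iterates $x$. The run on subproblem $s$ costs $T_s+1$ communication rounds and $T_sK_s+1$ samples per client; "comm" and "sample" below are the totals over $s=1,\dots,S$. Claim. In each case below, the number of iterations $S$ and the parameters of the SCAFFOLD runs ($T_s,K_s\ge1$, $\eta_l>0$, $\eta_g\ge1$ and the averaging weights) can be chosen as functions of the listed problem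 constants only (not of $n$, of the functions, of $x^0$ or of the distributions), such that the stated cost bounds hold and, for all problems in the class, Catalyst with SCAFFOLD meets the listed accuracies $\epsilon^s$, $1\le s\le S$, and reaches the stated target. All $F_m$ are as in the setting, $M\ge1$, $L>0$, $\sigma\ge0$, $\Delta>0$, $\epsilon>0$; $F^*=\inf F$. **(SC)** There are universal constants $C,p$ such that for all $M,L,\sigma,\Delta,\epsilon$ and $0<\mu\le L$, with $\kappa=L/\mu$ and $\Lambda=\log\!\big(2+\kappa+\frac{\Delta}{\epsilon}+\frac{\sigma^2}{L\epsilon}\big)$: if every $F_m$ is $\mu$-strongly convex and $F(x^0)-F^*\le\Delta$, then with $\epsilon^s=\frac29(1-0.9\sqrt q)^s\Delta$, $$\mathbb E F(x^S)-F^*\le\epsilon,\qquad \text{comm}\le C\sqrt\kappa\,\Lambda^p,\qquad \text{sample}\le C\Big(\sqrt\kappa+\frac{\sqrt\kappa\,\sigma^2}{\mu M\epsilon}\Big)\Lambda^p .$$ **(C)** There is a universal $p$ and, for all $L,\Delta,D>0$ and $\gamma\in(0,1]$, a constant $C=C(L,\Delta,D,\gamma)$, such that for all $M,\sigma$ and $\epsilon\in(0,1]$,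 with $\Lambda=\log(2+\sigma+\frac1\epsilon)$: if every $F_m$ is convex, $F$ has a minimizer $x^*$ with $\|x^0-x^*\|\le D$, and $F(x^0)-F^*\le\Delta$, then with $\epsilon^s=\frac{2\Delta}{9(s+1)^{4+\gamma}}$, $$\mathbb E F(x^S)-F^*\le\epsilon,\qquad \text{comm}\le \frac{C}{\sqrt\epsilon}\Lambda^p,\qquad \text{sample}\le C\Big(\frac1{\sqrt\epsilon}+\frac{\sigma^2}{M\epsilon^{2.5+\gamma/2}}\Big)\Lambda^p .$$ **(NC)** There is a universal $p$ and, for all $L,\Delta>0$, a constant $C=C(L,\Delta)$, such that for all $M,\sigma$ and $\epsilon\in(0,1]$, with $\Lambda=\log(2+\sigma+\frac1\epsilon)$: if $F(x^0)-F(x)\le\Delta$ for all $x$ (no convexity is assumed), then with $S\ge1$ and $\epsilon^s=\frac{\Delta}{S}$, $$\frac1S\sum_{s=1}^S\mathbb E\|\nabla F(x^s)\|^2\le\epsilon^2,\qquad \text{comm}\le \frac{C}{\epsilon^2}\Lambda^p,\qquad \text{sample}\le C\Big(\frac1{\epsilon^2}+\frac{\sigma^2}{M\epsilon^4}\Big)\Lambda^p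 ,$$ that is, an iterate chosen uniformly at random from $x^1,\dots,x^S$ satisfies $\mathbb E\|\nabla F(x)\|^2\le\epsilon^2$. -/

import Mathlib

open MeasureTheory ProbabilityTheory

universe u v

noncomputable section

/-! ### Objectives -/

/-- `f` is differentiable with `L`-Lipschitz gradient. -/
def IsLSmooth {V : Type*} [NormedAddCommGroup V] [InnerProductSpace ℝ V] [CompleteSpace V]
    (L : ℝ) (f : V → ℝ) : Prop :=
  Differentiable ℝ f ∧ ∀ x y, ‖gradient f x - gradient f y‖ ≤ L * ‖x - y‖

/-- The global objective `F = (1/M) ∑ₘ Fₘ`. -/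
def globalObjective {V : Type*} {M : ℕ} (F : Fin M → V → ℝ) (x : V) : ℝ :=
  (1 / (M : ℝ)) * ∑ m, F m x

/-- The Catalyst subproblem objective `f + L ‖· - y‖²` with prox centre `y`. -/
def proxObjective {V : Type*} [NormedAddCommGroup V] (f : V → ℝ) (L : ℝ) (y x : V) : ℝ :=
  f x + L * ‖x - y‖ ^ 2

/-! ### Stochastic first order oracles -/

/-- Client `m`, queried at `x`, returns `g m x ζ` with `ζ ∼ P m`; this is an unbiased estimate of
`∇ (F m) x` with variance at most `σ²`. -/
structure IsStochasticOracle {V Ξ : Type*} [NormedAddCommGroup V] [InnerProductSpace ℝ V]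
    [CompleteSpace V] [MeasurableSpace V] [MeasurableSpace Ξ] {M : ℕ}
    (F : Fin M → V → ℝ) (P : Fin M → Measure Ξ) (g : Fin M → V → Ξ → V) (σ : ℝ) : Prop where
  isProbabilityMeasure : ∀ m, IsProbabilityMeasure (P m)
  measurable : ∀ m, Measurable (Function.uncurry (g m))
  memLp : ∀ m x, MemLp (g m x) 2 (P m)
  unbiased : ∀ m x, ∫ ζ, g m x ζ ∂(P m) = gradient (F m) x
  variance_le : ∀ m x, ∫ ζ, ‖g m x ζ - gradient (F m) x‖ ^ 2 ∂(P m) ≤ σ ^ 2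

/-- `ξ s j m` is the `j`-th sample that client `m` draws while the `s`-th subproblem is solved.
All samples are independent, and those of client `m` have law `P m`. -/
structure AreFreshSamples {Ω Ξ : Type*} [MeasurableSpace Ω] [MeasurableSpace Ξ] {M : ℕ}
    (P : Fin M → Measure Ξ) (Pr : Measure Ω) (ξ : ℕ → ℕ → Fin M → Ω → Ξ) : Prop where
  measurable : ∀ s j m, Measurable (ξ s j m)
  law : ∀ s j m, Pr.map (ξ s j m) = P m
  indep : iIndepFun (fun i : ℕ × ℕ × Fin M => ξ i.1 i.2.1 i.2.2) Pr

/-! ### SCAFFOLD (all clients participate) -/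

/-- Parameters of one run of SCAFFOLD: number of communication rounds, number of local steps per
round, local and global step size, and the weights of the averaged output. -/
structure ScaffoldParams where
  rounds : ℕ
  localSteps : ℕ
  localStepSize : ℝ
  globalStepSize : ℝ
  weight : ℕ → ℝ

structure ScaffoldParams.Admissible (p : ScaffoldParams) : Prop where
  rounds_pos : 1 ≤ p.rounds
  localSteps_pos : 1 ≤ p.localSteps
  localStepSize_pos : 0 < p.localStepSize
  globalStepSize_ge : 1 ≤ p.globalStepSize
  weight_nonneg : ∀ t, 0 ≤ p.weight t
  weight_sum_pos : 0 < ∑ t ∈ Finset.range (p.rounds + 1), p.weight t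

/-- Communication rounds of one run of SCAFFOLD: one to set up the control variates, then `rounds`
rounds. -/
def ScaffoldParams.comm (p : ScaffoldParams) : ℕ := 1 + p.rounds

/-- Stochastic gradients (samples) used by each client in one run of SCAFFOLD: one for the initial
control variate, then one per local step. -/
def ScaffoldParams.samples (p : ScaffoldParams) : ℕ := 1 + p.rounds * p.localSteps

/-- Server model, server control variate and client control variates. -/
structure ScaffoldState (M : ℕ) (V : Type*) where
  server : V
  control : V
  clientControl : Fin M → V

section Scaffold

variable {V : Type*} [NormedAddCommGroup V] [InnerProductSpace ℝ V] {M : ℕ}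

/-- The local steps of one client: `v ← v - η (G k v - cₘ + c)`, started at the server model `x`.
Here `G k` is the stochastic gradient of the client in its `k`-th local step. -/
def scaffoldLocal (η : ℝ) (G : ℕ → V → V) (c cm x : V) : ℕ → V
  | 0 => x
  | k + 1 =>
    scaffoldLocal η G c cm x k - η • (G k (scaffoldLocal η G c cm x k) - cm + c)

/-- The model `yₘ` of client `m` at the end of the local steps of a round. -/
def scaffoldClient (p : ScaffoldParams) (G : ℕ → Fin M → V → V) (st : ScaffoldState M V)
    (m : Fin M) : V :=
  scaffoldLocal p.localStepSize (fun k => G k m) st.control (st.clientControl m) st.server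
    p.localSteps

/-- The new control variate `cₘ⁺ = cₘ - c + (x - yₘ) / (K η)` of client `m`. -/
def scaffoldClientControl (p : ScaffoldParams) (G : ℕ → Fin M → V → V) (st : ScaffoldState M V)
    (m : Fin M) : V :=
  st.clientControl m - st.control +
    (1 / ((p.localSteps : ℝ) * p.localStepSize)) • (st.server - scaffoldClient p G st m)

/-- One communication round of SCAFFOLD. -/
def scaffoldRound (p : ScaffoldParams) (G : ℕ → Fin M → V → V) (st : ScaffoldState M V) :
    ScaffoldState M V where
  server := st.server +
    p.globalStepSize • ((1 / (M : ℝ)) • ∑ m, (scaffoldClient p G st m - st.server))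
  control := st.control +
    (1 / (M : ℝ)) • ∑ m, (scaffoldClientControl p G st m - st.clientControl m)
  clientControl := scaffoldClientControl p G st

/-- The state of SCAFFOLD after `t` rounds, started at `x₀`. `G j m` is the stochastic gradient of
client `m` in its `j`-th oracle call: call `0` initializes its control variate, and call
`1 + t K + k` is the `k`-th local step of round `t`. -/
def scaffoldState (p : ScaffoldParams) (G : ℕ → Fin M → V → V) (x₀ : V) : ℕ → ScaffoldState M V
  | 0 => ⟨x₀, (1 / (M : ℝ)) • ∑ m, G 0 m x₀, fun m => G 0 m x₀⟩
  | t + 1 => scaffoldRound p (fun k => G (1 + t * p.localSteps + k)) (scaffoldState p G x₀ t)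

/-- The output of SCAFFOLD: a weighted average of its server models. -/
def scaffold (p : ScaffoldParams) (G : ℕ → Fin M → V → V) (x₀ : V) : V :=
  (∑ t ∈ Finset.range (p.rounds + 1), p.weight t)⁻¹ •
    ∑ t ∈ Finset.range (p.rounds + 1), p.weight t • (scaffoldState p G x₀ t).server

end Scaffold

/-! ### Catalyst -/

/-- The Catalyst parameters `α`: `α₀` is given, and `αₛ` is the positive solution of
`αₛ² = (1 - αₛ) αₛ₋₁² + q αₛ`; see `catalystAlpha_spec`. -/
def catalystAlpha (q α₀ : ℝ) : ℕ → ℝ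
  | 0 => α₀
  | s + 1 =>
    ((q - catalystAlpha q α₀ s ^ 2) +
      √((q - catalystAlpha q α₀ s ^ 2) ^ 2 + 4 * catalystAlpha q α₀ s ^ 2)) / 2

theorem catalystAlpha_spec (q α₀ : ℝ) (h₀ : 0 < α₀) (s : ℕ) :
    0 < catalystAlpha q α₀ s ∧
      catalystAlpha q α₀ (s + 1) ^ 2 =
        (1 - catalystAlpha q α₀ (s + 1)) * catalystAlpha q α₀ s ^ 2
          + q * catalystAlpha q α₀ (s + 1) := by
  constructor
  · induction s with
    | zero => exact h₀
    | succ s ih =>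
      have h : |q - catalystAlpha q α₀ s ^ 2| <
          √((q - catalystAlpha q α₀ s ^ 2) ^ 2 + 4 * catalystAlpha q α₀ s ^ 2) := by
        rw [← Real.sqrt_sq_eq_abs]
        exact Real.sqrt_lt_sqrt (sq_nonneg _) (by nlinarith [pow_pos ih 2])
      have h' := neg_abs_le (q - catalystAlpha q α₀ s ^ 2)
      simp only [catalystAlpha]
      linarith
  · have h := Real.sq_sqrt (show
        0 ≤ (q - catalystAlpha q α₀ s ^ 2) ^ 2 + 4 * catalystAlpha q α₀ s ^ 2 by positivity)
    simp only [catalystAlpha]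
    nlinarith

/-- The extrapolation weights `βₛ = αₛ₋₁ (1 - αₛ₋₁) / (αₛ₋₁² + αₛ)`, for `s ≥ 1`. -/
def catalystBeta (q α₀ : ℝ) (s : ℕ) : ℝ :=
  catalystAlpha q α₀ (s - 1) * (1 - catalystAlpha q α₀ (s - 1)) /
    (catalystAlpha q α₀ (s - 1) ^ 2 + catalystAlpha q α₀ s)

/-- After `s` Catalyst iterations: the iterate `xˢ`, the next prox centre `yˢ⁺¹` and the current
prox centre `yˢ`. -/
structure CatalystState (V : Type*) where
  iterate : V
  nextCenter : V
  center : V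

section Catalyst

variable {V : Type*} [NormedAddCommGroup V] [InnerProductSpace ℝ V]

/-- Catalyst with `y⁰ = y¹ = x⁰`. Iteration `s` calls `solve s y z` on the subproblem with prox
centre `y = yˢ` from the starting point `z = xˢ⁻¹ + θ (yˢ - yˢ⁻¹)` to get `xˢ`, and sets
`yˢ⁺¹ = xˢ + βₛ (xˢ - xˢ⁻¹)`. -/
def catalystState (solve : ℕ → V → V → V) (θ : ℝ) (β : ℕ → ℝ) (x₀ : V) : ℕ → CatalystState V
  | 0 => ⟨x₀, x₀, x₀⟩
  | s + 1 =>
    let st := catalystState solve θ β x₀ s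
    let x := solve (s + 1) st.nextCenter (st.iterate + θ • (st.nextCenter - st.center))
    ⟨x, x + β (s + 1) • (x - st.iterate), st.nextCenter⟩

/-- SCAFFOLD as the solver of the `s`-th Catalyst subproblem, on the outcome `ω`. Client `m` has the
local objective `Fₘ + L ‖· - y‖²` and the stochastic gradients `gₘ(v; ξ) + 2 L (v - y)`. -/
def scaffoldSolve {Ω Ξ : Type*} {M : ℕ} (L : ℝ) (g : Fin M → V → Ξ → V)
    (ξ : ℕ → ℕ → Fin M → Ω → Ξ) (prm : ℕ → ScaffoldParams) (ω : Ω) (s : ℕ) (y z : V) : V :=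
  scaffold (prm s) (fun j m v => g m v (ξ s j m ω) + (2 * L) • (v - y)) z

/-- Catalyst with SCAFFOLD, run with the parameters `prm s` on the `s`-th subproblem. -/
def catalystScaffold {Ω Ξ : Type*} {M : ℕ} (L : ℝ) (g : Fin M → V → Ξ → V)
    (ξ : ℕ → ℕ → Fin M → Ω → Ξ) (prm : ℕ → ScaffoldParams) (θ : ℝ) (β : ℕ → ℝ) (x₀ : V)
    (s : ℕ) (ω : Ω) : CatalystState V :=
  catalystState (scaffoldSolve L g ξ prm ω) θ β x₀ s

/-- The random process `run` (of Catalyst states) solves the first `S` subproblems of Catalyst to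
the accuracies `tol`: `𝔼[Fˢ(xˢ) - min Fˢ] ≤ tol s`. -/
def MeetsTolerances {Ω : Type*} [MeasurableSpace Ω] (Pr : Measure Ω) (f : V → ℝ) (L : ℝ) (S : ℕ)
    (run : ℕ → Ω → CatalystState V) (tol : ℕ → ℝ) : Prop :=
  ∀ s ∈ Finset.Icc 1 S,
    Integrable (fun ω => proxObjective f L (run s ω).center (run s ω).iterate
      - ⨅ x, proxObjective f L (run s ω).center x) Pr ∧
    ∫ ω, (proxObjective f L (run s ω).center (run s ω).iterate
      - ⨅ x, proxObjective f L (run s ω).center x) ∂Pr ≤ tol s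

end Catalyst

/-- Total number of communication rounds over `S` Catalyst iterations. -/
def totalComm (S : ℕ) (prm : ℕ → ScaffoldParams) : ℕ := ∑ s ∈ Finset.Icc 1 S, (prm s).comm

/-- Total number of samples per client over `S` Catalyst iterations. -/
def totalSamples (S : ℕ) (prm : ℕ → ScaffoldParams) : ℕ := ∑ s ∈ Finset.Icc 1 S, (prm s).samples

end

noncomputable section
set_option linter.unusedSectionVars false

/-! ### Quadratic bounds for smooth and strongly convex functions -/

section Smooth

variable {V : Type*} [NormedAddCommGroup V] [InnerProductSpace ℝ V] [CompleteSpace V]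
  {L μ : ℝ} {f : V → ℝ}

/-! Inner solver. The regularizer `L ‖· - y‖²` makes every subproblem well conditioned, whether or
not the objective is convex: the gradient of the regularized objective is `L`-strongly monotone and
`3L`-Lipschitz. It therefore vanishes at one point, `proxPoint f L y`, and a gradient step of length
`1/(9L)` contracts the squared distance to that point by `8/9`
(`IsLSmooth.norm_prox_gradient_step_sq_le`). The solver uses nothing else about the objective, so
one accuracy bound, `integral_norm_solverState_sq_le`, serves all three cases.

SCAFFOLD is run with a tiny local and a large global step size whose product with `K` is `1/(9L)`.
The clients hardly move during a round, so a round is a minibatch gradient step at the server model,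
up to a small drift. Since the control variates enter the drift, the potential of
`scaffoldRound_potential_le` is the squared distance plus a small multiple of their squared error.
The noises of the `M K` oracle calls are orthogonal in `L²`, so they average to variance `σ²/(M K)`.
Per round the potential contracts by `23/24` up to noise of order `σ²/(L² M K)`. Hence the number of
rounds is logarithmic, `K` is of order `1 + σ²/(L M tol)`, and the total sample cost is governed by
`S` and by the sum of `1 / tol s`.

Outer loop. In the nonconvex case an inexact proximal step decreases `F` by `L ‖x' - x‖²` up to its
tolerance, and the decreases telescope (`nonconvex_convergence`). In the accelerated cases there are
points `vˢ` with `xˢ⁺¹ = (1 - αₛ) xˢ + αₛ vˢ⁺¹`, the extrapolation rule makes each prox centre a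
combination of `xˢ` and `vˢ`, and a Lyapunov function combines the gap of `xˢ` with `‖vˢ - x*‖²`
(`convex_step`, `stronglyConvex_step`). Inexactness enters as a residual `e` of the proximal
optimality condition, through the term `⟨e, v' - x*⟩`. Young's inequality charges one part to the
tolerance and absorbs the other in the Lyapunov function. In the convex case the Young weights are
summable, so the losses multiply to a constant. In the strongly convex case they cost a fixed
fraction of the contraction `√q`, which leaves the rate `1 - 0.9 √q`.

The round counts are fixed in advance, while the error at the start of a subproblem depends on the
run. Induction breaks the circle: the accuracies met so far bound the quantity that controls this
error (mean values of `F`, or mean squared distances to a minimizer), and this gives the next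
accuracy. The bound on the starting error may be crude, because it enters the cost only through a
logarithm. Accordingly `integral_norm_start_sub_proxPoint_sq_le` asks only `0 ≤ θ ≤ 1` of the warm
start. -/

theorem hasDerivAt_comp_line (hf : Differentiable ℝ f) (x d : V) (t : ℝ) :
    HasDerivAt (fun t : ℝ => f (x + t • d)) (inner ℝ (gradient f (x + t • d)) d) t := by
  have h1 : HasDerivAt (fun t : ℝ => x + t • d) d t := by
    simpa using ((hasDerivAt_id t).smul_const d).const_add x
  have h2 := (hf (x + t • d)).hasGradientAt.hasFDerivAt.comp_hasDerivAt t h1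
  simpa [Function.comp_def] using h2

theorem IsLSmooth.le_quadratic (hf : IsLSmooth L f) (x z : V) :
    f z ≤ f x + inner ℝ (gradient f x) (z - x) + L / 2 * ‖z - x‖ ^ 2 := by
  set d := z - x with hd
  have hder : ∀ t : ℝ, HasDerivAt
      (fun t : ℝ => f (x + t • d) - t * inner ℝ (gradient f x) d - L / 2 * t ^ 2 * ‖d‖ ^ 2)
      (inner ℝ (gradient f (x + t • d)) d - inner ℝ (gradient f x) d - L * t * ‖d‖ ^ 2) t := by
    intro t
    have h := ((hasDerivAt_comp_line hf.1 x d t).sub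
      ((hasDerivAt_id t).mul_const (inner ℝ (gradient f x) d))).sub
      (((hasDerivAt_pow 2 t).const_mul (L / 2)).mul_const (‖d‖ ^ 2))
    refine HasDerivAt.congr_deriv h ?_
    push_cast
    ring
  -- Along the segment, `f` minus its quadratic upper model has nonpositive derivative, by
  -- Cauchy-Schwarz and the Lipschitz bound. Comparing the endpoints gives the claim.
  have hanti : AntitoneOn
      (fun t : ℝ => f (x + t • d) - t * inner ℝ (gradient f x) d - L / 2 * t ^ 2 * ‖d‖ ^ 2)
      (Set.Icc 0 1) := by
    refine antitoneOn_of_deriv_nonpos (convex_Icc 0 1)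
      (fun t _ => (hder t).continuousAt.continuousWithinAt)
      (fun t _ => (hder t).differentiableAt.differentiableWithinAt) fun t ht => ?_
    rw [interior_Icc] at ht
    rw [(hder t).deriv, ← inner_sub_left]
    have h1 := real_inner_le_norm (gradient f (x + t • d) - gradient f x) d
    have h2 := hf.2 (x + t • d) x
    rw [add_sub_cancel_left, norm_smul, Real.norm_of_nonneg ht.1.le] at h2
    nlinarith [norm_nonneg d, mul_le_mul_of_nonneg_right h2 (norm_nonneg d)]
  have h := hanti (Set.left_mem_Icc.2 zero_le_one) (Set.right_mem_Icc.2 zero_le_one) zero_le_one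
  simp only [one_smul, zero_smul, add_zero] at h
  rw [show x + d = z by rw [hd]; abel] at h
  linarith

theorem gradient_neg (x : V) : gradient (fun z => -f z) x = -gradient f x := by
  simp [gradient, fderiv_fun_neg]

theorem IsLSmooth.neg (hf : IsLSmooth L f) : IsLSmooth L (fun x => -f x) := by
  refine ⟨hf.1.neg, fun x y => ?_⟩
  rw [gradient_neg, gradient_neg, ← norm_neg]
  rw [neg_sub_neg, neg_sub]
  exact hf.2 x y

/-- The upper bound for `-f`. This weak convexity stands in for convexity wherever the subproblems
are analysed. -/
theorem IsLSmooth.quadratic_le (hf : IsLSmooth L f) (x z : V) :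
    f x + inner ℝ (gradient f x) (z - x) - L / 2 * ‖z - x‖ ^ 2 ≤ f z := by
  have h := hf.neg.le_quadratic x z
  rw [gradient_neg, inner_neg_left] at h
  linarith

theorem IsLSmooth.continuous_gradient (hf : IsLSmooth L f) : Continuous (gradient f) := by
  refine (LipschitzWith.of_dist_le_mul (K := L.toNNReal) fun x y => ?_).continuous
  rw [dist_eq_norm, dist_eq_norm]
  exact (hf.2 x y).trans (mul_le_mul_of_nonneg_right (Real.le_coe_toNNReal L) (norm_nonneg _))

theorem gradient_globalObjective {M : ℕ} {F : Fin M → V → ℝ} (hF : ∀ m, Differentiable ℝ (F m))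
    (x : V) : gradient (globalObjective F) x = (1 / (M : ℝ)) • ∑ m, gradient (F m) x := by
  have h : HasFDerivAt (globalObjective F) ((1 / (M : ℝ)) • ∑ m, fderiv ℝ (F m) x) x := by
    have h1 := HasFDerivAt.fun_sum (u := Finset.univ) fun m _ => (hF m x).hasFDerivAt
    exact h1.const_smul (1 / (M : ℝ))
  simp [gradient, h.fderiv]

theorem isLSmooth_globalObjective {M : ℕ} (hM : 1 ≤ M) {F : Fin M → V → ℝ}
    (hF : ∀ m, IsLSmooth L (F m)) : IsLSmooth L (globalObjective F) := by
  have hM' : (0 : ℝ) < M := by exact_mod_cast hM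
  refine ⟨?_, fun x y => ?_⟩
  · exact (Differentiable.fun_sum fun m _ => (hF m).1).const_mul _
  · rw [gradient_globalObjective fun m => (hF m).1, gradient_globalObjective fun m => (hF m).1,
      ← smul_sub, ← Finset.sum_sub_distrib, norm_smul, Real.norm_of_nonneg (by positivity)]
    calc 1 / (M : ℝ) * ‖∑ m, (gradient (F m) x - gradient (F m) y)‖
        ≤ 1 / (M : ℝ) * ∑ _m : Fin M, L * ‖x - y‖ := by
          gcongr
          exact norm_sum_le_of_le _ fun m _ => (hF m).2 x y
      _ = L * ‖x - y‖ := by simp; field_simp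

/-- The first order characterization of strong convexity, one direction. -/
theorem StrongConvexOn.gradient_le (hf : StrongConvexOn Set.univ μ f) (hd : Differentiable ℝ f)
    (x z : V) : f x + inner ℝ (gradient f x) (z - x) + μ / 2 * ‖z - x‖ ^ 2 ≤ f z := by
  have h1 := (hasDerivAt_comp_line hd x (z - x) 0).hasDerivWithinAt (s := Set.Ioi 0)
  rw [hasDerivWithinAt_iff_tendsto_slope' (by simp)] at h1
  have h2 : Filter.Tendsto (fun t : ℝ => f z - f x - (1 - t) * (μ / 2 * ‖z - x‖ ^ 2))
      (nhdsWithin 0 (Set.Ioi 0)) (nhds (f z - f x - (1 - 0) * (μ / 2 * ‖z - x‖ ^ 2))) := by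
    refine Filter.Tendsto.mono_left (Continuous.tendsto ?_ 0) nhdsWithin_le_nhds
    fun_prop
  have h3 := le_of_tendsto_of_tendsto h1 h2 ?_
  · simp only [zero_smul, add_zero] at h3
    linarith
  · filter_upwards [Ioo_mem_nhdsGT (zero_lt_one' ℝ)] with t ht
    have h4 := hf.2 (Set.mem_univ x) (Set.mem_univ z) (sub_nonneg.2 ht.2.le) ht.1.le (by ring)
    rw [show (1 - t) • x + t • z = x + t • (z - x) by module, norm_sub_rev x z] at h4
    simp only [slope, smul_eq_mul, sub_zero, vsub_eq_sub, zero_smul, add_zero]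
    rw [inv_mul_le_iff₀ ht.1]
    simp only [smul_eq_mul] at h4
    linarith

/-- The first order inequalities of the clients average. With `μ = 0` this also serves the convex
case. -/
theorem strongConvexOn_gradient_le_globalObjective {M : ℕ} (hM : 1 ≤ M) {F : Fin M → V → ℝ}
    (hF : ∀ m, IsLSmooth L (F m)) (hc : ∀ m, StrongConvexOn Set.univ μ (F m)) (x z : V) :
    globalObjective F x + inner ℝ (gradient (globalObjective F) x) (z - x)
      + μ / 2 * ‖z - x‖ ^ 2 ≤ globalObjective F z := by
  have hM' : (0 : ℝ) < M := by exact_mod_cast hM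
  rw [gradient_globalObjective fun m => (hF m).1]
  unfold globalObjective
  rw [real_inner_smul_left, sum_inner, ← mul_add, ← Finset.sum_add_distrib]
  have h : ∑ m, (F m x + inner ℝ (gradient (F m) x) (z - x) + μ / 2 * ‖z - x‖ ^ 2) ≤
      ∑ m, F m z := Finset.sum_le_sum fun m _ => (hc m).gradient_le (hF m).1 x z
  rw [Finset.sum_add_distrib, Finset.sum_const, Finset.card_univ, Fintype.card_fin,
    nsmul_eq_mul] at h
  rw [one_div_mul_eq_div, one_div_mul_eq_div, ← sub_nonneg]
  have : (∑ m, F m z) / M - ((∑ m, (F m x + inner ℝ (gradient (F m) x) (z - x))) / M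
      + μ / 2 * ‖z - x‖ ^ 2) = (∑ m, F m z - (∑ m, (F m x + inner ℝ (gradient (F m) x) (z - x))
      + M * (μ / 2 * ‖z - x‖ ^ 2))) / M := by field_simp
  rw [this]
  exact div_nonneg (by linarith) hM'.le

/-! ### Proximal points -/

/-- Stationarity is a fixed point equation for `x ↦ y - ∇f(x) / (2L)`, a contraction with constant
`1/2`. Banach's theorem needs neither convexity of `f` nor compactness. -/
theorem IsLSmooth.exists_prox (hf : IsLSmooth L f) (hL : 0 < L) (y : V) :
    ∃ p, gradient f p + (2 * L) • (p - y) = 0 := by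
  have hc : ContractingWith (1 / 2) fun x => y - (1 / (2 * L)) • gradient f x := by
    refine ⟨by norm_num, LipschitzWith.of_dist_le_mul fun x z => ?_⟩
    rw [dist_eq_norm, dist_eq_norm, sub_sub_sub_cancel_left, ← smul_sub, norm_smul,
      Real.norm_of_nonneg (by positivity), ← norm_neg, neg_sub]
    have h := hf.2 x z
    calc 1 / (2 * L) * ‖gradient f x - gradient f z‖ ≤ 1 / (2 * L) * (L * ‖x - z‖) := by gcongr
      _ = _ := by simp; field_simp
  refine ⟨ContractingWith.fixedPoint _ hc, ?_⟩
  have h := hc.fixedPoint_isFixedPt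
  set p := ContractingWith.fixedPoint _ hc
  have h' : y - (1 / (2 * L)) • gradient f p = p := h
  rw [← h'] 
  nth_rw 1 [h']
  rw [sub_sub_cancel_left, smul_neg, smul_smul, mul_one_div_cancel (by positivity), one_smul,
    add_neg_cancel]

/-- The minimizer of `proxObjective f L y`, for an `L`-smooth `f`. -/
def proxPoint (f : V → ℝ) (L : ℝ) (y : V) : V :=
  open Classical in if h : ∃ p, gradient f p + (2 * L) • (p - y) = 0 then h.choose else 0

theorem IsLSmooth.proxPoint_spec (hf : IsLSmooth L f) (hL : 0 < L) (y : V) :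
    gradient f (proxPoint f L y) + (2 * L) • (proxPoint f L y - y) = 0 := by
  unfold proxPoint
  rw [dif_pos (hf.exists_prox hL y)]
  exact (hf.exists_prox hL y).choose_spec

/-- The gradient of the proximal objective is `L`-strongly monotone. -/
theorem IsLSmooth.monotone_prox (hf : IsLSmooth L f) (y x z : V) :
    L * ‖x - z‖ ^ 2 ≤ inner ℝ ((gradient f x + (2 * L) • (x - y))
      - (gradient f z + (2 * L) • (z - y))) (x - z) := by
  have h1 := abs_real_inner_le_norm (gradient f x - gradient f z) (x - z)
  have h2 := hf.2 x z
  rw [show (gradient f x + (2 * L) • (x - y)) - (gradient f z + (2 * L) • (z - y))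
    = (gradient f x - gradient f z) + (2 * L) • (x - z) by module, inner_add_left,
    real_inner_smul_left, real_inner_self_eq_norm_sq]
  nlinarith [abs_le.1 h1, mul_le_mul_of_nonneg_right h2 (norm_nonneg (x - z))]

theorem IsLSmooth.norm_prox_gradient_sub_le (hf : IsLSmooth L f) (hL : 0 < L) (y x z : V) :
    ‖(gradient f x + (2 * L) • (x - y)) - (gradient f z + (2 * L) • (z - y))‖
      ≤ 3 * L * ‖x - z‖ := by
  rw [show (gradient f x + (2 * L) • (x - y)) - (gradient f z + (2 * L) • (z - y))
    = (gradient f x - gradient f z) + (2 * L) • (x - z) by module]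
  refine (norm_add_le _ _).trans ?_
  rw [norm_smul, Real.norm_of_nonneg (by positivity)]
  linarith [hf.2 x z]

/-- Expanding the square around `p`, stationarity cancels the linear term and leaves the first order
remainder of `f` plus `L ‖x - p‖²`. The two quadratic bounds then pinch the gap between `L/2` and
`3L/2` times the squared distance. -/
theorem proxObjective_sub_eq {p y : V} (hp : gradient f p + (2 * L) • (p - y) = 0) (x : V) :
    proxObjective f L y x - proxObjective f L y p
      = f x - (f p + inner ℝ (gradient f p) (x - p)) + L * ‖x - p‖ ^ 2 := by
  unfold proxObjective
  rw [eq_neg_of_add_eq_zero_left hp, show x - y = (x - p) + (p - y) by abel, norm_add_sq_real,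
    inner_neg_left, real_inner_smul_left, real_inner_comm]
  ring

theorem IsLSmooth.le_proxObjective_sub (hf : IsLSmooth L f) (hL : 0 < L) (y x : V) :
    L / 2 * ‖x - proxPoint f L y‖ ^ 2
      ≤ proxObjective f L y x - proxObjective f L y (proxPoint f L y) := by
  rw [proxObjective_sub_eq (hf.proxPoint_spec hL y)]
  linarith [hf.quadratic_le (proxPoint f L y) x]

theorem IsLSmooth.proxObjective_sub_le (hf : IsLSmooth L f) (hL : 0 < L) (y x : V) :
    proxObjective f L y x - proxObjective f L y (proxPoint f L y)
      ≤ 3 * L / 2 * ‖x - proxPoint f L y‖ ^ 2 := by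
  rw [proxObjective_sub_eq (hf.proxPoint_spec hL y)]
  linarith [hf.le_quadratic (proxPoint f L y) x]

theorem IsLSmooth.iInf_proxObjective (hf : IsLSmooth L f) (hL : 0 < L) (y : V) :
    ⨅ x, proxObjective f L y x = proxObjective f L y (proxPoint f L y) := by
  have h : ∀ x, proxObjective f L y (proxPoint f L y) ≤ proxObjective f L y x := fun x => by
    have := hf.le_proxObjective_sub hL y x
    have : 0 ≤ L / 2 * ‖x - proxPoint f L y‖ ^ 2 := by positivity
    linarith
  exact le_antisymm (ciInf_le ⟨_, Set.forall_mem_range.2 h⟩ _) (le_ciInf h)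

/-- At `r` the stationarity equation for the centre `y` has residual `2L (z - y)`, and strong
monotonicity turns a residual into a distance. This makes the proximal points of random centres
measurable and square integrable. -/
theorem IsLSmooth.norm_proxPoint_sub_le (hf : IsLSmooth L f) (hL : 0 < L) (y z : V) :
    ‖proxPoint f L y - proxPoint f L z‖ ≤ 2 * ‖y - z‖ := by
  set p := proxPoint f L y
  set r := proxPoint f L z
  have h1 := hf.monotone_prox y p r
  have h2 : gradient f r + (2 * L) • (r - y) = (2 * L) • (z - y) := by
    have := hf.proxPoint_spec hL z
    rw [show (2 * L) • (r - y) = (2 * L) • (r - z) + (2 * L) • (z - y) by module, ← add_assoc,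
      this, zero_add]
  rw [hf.proxPoint_spec hL y, h2, zero_sub, ← smul_neg, neg_sub, real_inner_smul_left] at h1
  have h3 := real_inner_le_norm (y - z) (p - r)
  rcases (norm_nonneg (p - r)).eq_or_lt with h | h
  · rw [← h]; positivity
  · have h4 : L * ‖p - r‖ ^ 2 ≤ 2 * L * (‖y - z‖ * ‖p - r‖) := h1.trans (by gcongr)
    have h5 : (L * ‖p - r‖) * ‖p - r‖ ≤ (L * ‖p - r‖) * (2 * ‖y - z‖) := by linarith
    exact le_of_mul_le_mul_left h5 (by positivity)

theorem IsLSmooth.continuous_proxPoint (hf : IsLSmooth L f) (hL : 0 < L) :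
    Continuous (proxPoint f L) := by
  refine (LipschitzWith.of_dist_le_mul (K := 2) fun x y => ?_).continuous
  rw [dist_eq_norm, dist_eq_norm]
  exact hf.norm_proxPoint_sub_le hL x y

/-- A stationary point of `f` is its own proximal point, so the Lipschitz bound applies to the pair
`y`, `p`. -/
theorem IsLSmooth.norm_sub_proxPoint_le (hf : IsLSmooth L f) (hL : 0 < L) {p : V}
    (hp : gradient f p = 0) (y : V) : ‖proxPoint f L y - p‖ ≤ 2 * ‖y - p‖ := by
  have h : proxPoint f L p = p := by
    have h1 := hf.monotone_prox p (proxPoint f L p) p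
    rw [hf.proxPoint_spec hL p, hp, sub_self, smul_zero, add_zero, sub_zero, inner_zero_left] at h1
    have h2 : ‖proxPoint f L p - p‖ ^ 2 = 0 := by
      nlinarith [sq_nonneg ‖proxPoint f L p - p‖]
    exact sub_eq_zero.1 (norm_eq_zero.1 (pow_eq_zero_iff two_ne_zero |>.1 h2))
  simpa [h] using hf.norm_proxPoint_sub_le hL y p

theorem IsMinOn.gradient_eq_zero {p : V} (hp : IsMinOn f Set.univ p) : gradient f p = 0 := by
  have h : IsLocalMin f p := hp.isLocalMin Filter.univ_mem
  simp [gradient, h.fderiv_eq_zero]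

/-- One gradient step of length `1 / (9 L)` on the proximal objective. -/
theorem IsLSmooth.norm_prox_gradient_step_sq_le (hf : IsLSmooth L f) (hL : 0 < L) (y x : V) :
    ‖x - proxPoint f L y - (1 / (9 * L)) • (gradient f x + (2 * L) • (x - y))‖ ^ 2
      ≤ 8 / 9 * ‖x - proxPoint f L y‖ ^ 2 := by
  set p := proxPoint f L y
  have h1 := hf.monotone_prox y x p
  have h2 := hf.norm_prox_gradient_sub_le hL y x p
  rw [hf.proxPoint_spec hL y, sub_zero] at h1 h2
  set e := gradient f x + (2 * L) • (x - y)
  -- The step length is `L / (3L)²`, the minimizer of `1 - 2 η L + 9 η² L²`, and the factor is `1 -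
  -- 2/9 + 1/9`.
  rw [norm_sub_sq_real, real_inner_smul_right, norm_smul, Real.norm_of_nonneg (by positivity),
    mul_pow, real_inner_comm]
  have h3 : ‖e‖ ^ 2 ≤ (3 * L * ‖x - p‖) ^ 2 := pow_le_pow_left₀ (norm_nonneg _) h2 2
  have h4 : 1 / (9 * L) * (L * ‖x - p‖ ^ 2) ≤ 1 / (9 * L) * inner ℝ e (x - p) := by gcongr
  have h5 : (1 / (9 * L)) ^ 2 * ‖e‖ ^ 2 ≤ (1 / (9 * L)) ^ 2 * (3 * L * ‖x - p‖) ^ 2 := by gcongr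
  have h6 : 1 / (9 * L) * (L * ‖x - p‖ ^ 2) = 1 / 9 * ‖x - p‖ ^ 2 := by field_simp
  have h7 : (1 / (9 * L)) ^ 2 * (3 * L * ‖x - p‖) ^ 2 = 1 / 9 * ‖x - p‖ ^ 2 := by
    field_simp; norm_num
  linarith

end Smooth

/-! ### Square integrable random vectors -/

section L2

variable {Ω V : Type*} [MeasurableSpace Ω] {Pr : Measure Ω} [IsProbabilityMeasure Pr]
  [NormedAddCommGroup V] [InnerProductSpace ℝ V] [CompleteSpace V] {L : ℝ} {f : V → ℝ}
  {X Y : Ω → V}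

theorem MeasureTheory.MemLp.integrable_norm_sq (hX : MemLp X 2 Pr) :
    Integrable (fun ω => ‖X ω‖ ^ 2) Pr :=
  (memLp_two_iff_integrable_sq_norm hX.1).1 hX

theorem MeasureTheory.MemLp.integrable_inner_two (hX : MemLp X 2 Pr) (hY : MemLp Y 2 Pr) :
    Integrable (fun ω => inner ℝ (X ω) (Y ω)) Pr := by
  refine ((hX.integrable_norm_sq.add hY.integrable_norm_sq)).mono'
    (hX.1.inner hY.1) (Filter.Eventually.of_forall fun ω => ?_)
  have h := norm_inner_le_norm (𝕜 := ℝ) (X ω) (Y ω)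
  simp only [Pi.add_apply]
  nlinarith [two_mul_le_add_sq ‖X ω‖ ‖Y ω‖, sq_nonneg ‖X ω‖, sq_nonneg ‖Y ω‖]

theorem IsLSmooth.memLp_gradient_comp (hf : IsLSmooth L f) (hX : MemLp X 2 Pr) :
    MemLp (fun ω => gradient f (X ω)) 2 Pr := by
  have h : MemLp (fun ω => L * ‖X ω‖ + ‖gradient f 0‖) 2 Pr :=
    (hX.norm.const_mul L).add (memLp_const _)
  refine h.mono (hf.continuous_gradient.comp_aestronglyMeasurable hX.1)
    (Filter.Eventually.of_forall fun ω => ?_)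
  have h1 := hf.2 (X ω) 0
  rw [sub_zero] at h1
  have h2 := norm_sub_norm_le (gradient f (X ω)) (gradient f 0)
  exact (by linarith : _ ≤ L * ‖X ω‖ + ‖gradient f 0‖).trans (le_abs_self _)

theorem IsLSmooth.memLp_proxPoint_comp (hf : IsLSmooth L f) (hL : 0 < L) (hX : MemLp X 2 Pr) :
    MemLp (fun ω => proxPoint f L (X ω)) 2 Pr := by
  have h : MemLp (fun ω => 2 * ‖X ω‖ + ‖proxPoint f L 0‖) 2 Pr :=
    (hX.norm.const_mul 2).add (memLp_const _)
  refine h.mono ((hf.continuous_proxPoint hL).comp_aestronglyMeasurable hX.1)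
    (Filter.Eventually.of_forall fun ω => ?_)
  have h1 := hf.norm_proxPoint_sub_le hL (X ω) 0
  rw [sub_zero] at h1
  have h2 := norm_sub_norm_le (proxPoint f L (X ω)) (proxPoint f L 0)
  exact (by linarith : _ ≤ 2 * ‖X ω‖ + ‖proxPoint f L 0‖).trans (le_abs_self _)

theorem IsLSmooth.integrable_comp (hf : IsLSmooth L f) (hX : MemLp X 2 Pr) :
    Integrable (fun ω => f (X ω)) Pr := by
  have h : Integrable (fun ω => |f 0| + |inner ℝ (gradient f 0) (X ω)| + |L| / 2 * ‖X ω‖ ^ 2) Pr :=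
    ((integrable_const _).add ((memLp_const (gradient f 0)).integrable_inner_two hX).abs).add
      (hX.integrable_norm_sq.const_mul _)
  refine h.mono' (hf.1.continuous.comp_aestronglyMeasurable hX.1)
    (Filter.Eventually.of_forall fun ω => ?_)
  have h1 := hf.le_quadratic 0 (X ω)
  have h2 := hf.quadratic_le 0 (X ω)
  rw [sub_zero] at h1 h2
  have h3 : L / 2 * ‖X ω‖ ^ 2 ≤ |L| / 2 * ‖X ω‖ ^ 2 := by gcongr; exact le_abs_self L
  rw [Real.norm_eq_abs, abs_le]
  constructor <;> linarith [le_abs_self (f 0), neg_abs_le (f 0),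
    le_abs_self (inner ℝ (gradient f 0) (X ω)), neg_abs_le (inner ℝ (gradient f 0) (X ω))]

/-- Pythagoras for a sum of pairwise orthogonal square integrable random vectors. -/
theorem integral_norm_sub_smul_sum_sq {ι : Type*} (s : Finset ι) {N : ι → Ω → V} (c : ℝ)
    (hX : MemLp X 2 Pr) (hN : ∀ i ∈ s, MemLp (N i) 2 Pr)
    (hXN : ∀ i ∈ s, ∫ ω, inner ℝ (X ω) (N i ω) ∂Pr = 0)
    (hNN : ∀ i ∈ s, ∀ j ∈ s, i ≠ j → ∫ ω, inner ℝ (N i ω) (N j ω) ∂Pr = 0) :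
    ∫ ω, ‖X ω - c • ∑ i ∈ s, N i ω‖ ^ 2 ∂Pr
      = ∫ ω, ‖X ω‖ ^ 2 ∂Pr + c ^ 2 * ∑ i ∈ s, ∫ ω, ‖N i ω‖ ^ 2 ∂Pr := by
  have h1 : ∀ ω, ‖X ω - c • ∑ i ∈ s, N i ω‖ ^ 2 = ‖X ω‖ ^ 2
      + (-(2 * c) * ∑ i ∈ s, inner ℝ (X ω) (N i ω)
        + c ^ 2 * ∑ i ∈ s, ∑ j ∈ s, inner ℝ (N i ω) (N j ω)) := by
    intro ω
    rw [norm_sub_sq_real, real_inner_smul_right, norm_smul, mul_pow, Real.norm_eq_abs, sq_abs,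
      inner_sum, ← real_inner_self_eq_norm_sq (∑ i ∈ s, N i ω), sum_inner]
    simp_rw [inner_sum]
    ring
  have hi : ∀ i ∈ s, ∀ j ∈ s, Integrable (fun ω => inner ℝ (N i ω) (N j ω)) Pr :=
    fun i hi j hj => (hN i hi).integrable_inner_two (hN j hj)
  have hi1 : Integrable (fun ω => ∑ i ∈ s, inner ℝ (X ω) (N i ω)) Pr :=
    integrable_finsetSum _ fun i hi => hX.integrable_inner_two (hN i hi)
  have hi2 : ∀ i ∈ s, Integrable (fun ω => ∑ j ∈ s, inner ℝ (N i ω) (N j ω)) Pr :=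
    fun i h => integrable_finsetSum _ fun j hj => hi i h j hj
  have hi3 : Integrable (fun ω => ∑ i ∈ s, ∑ j ∈ s, inner ℝ (N i ω) (N j ω)) Pr :=
    integrable_finsetSum _ hi2
  simp_rw [h1]
  have hi4 : Integrable (fun ω => -(2 * c) * ∑ i ∈ s, inner ℝ (X ω) (N i ω)
      + c ^ 2 * ∑ i ∈ s, ∑ j ∈ s, inner ℝ (N i ω) (N j ω)) Pr :=
    (hi1.const_mul _).add (hi3.const_mul _)
  rw [integral_add hX.integrable_norm_sq hi4, integral_add (hi1.const_mul _) (hi3.const_mul _), integral_const_mul, integral_const_mul,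
    integral_finsetSum _ fun i hi => hX.integrable_inner_two (hN i hi), Finset.sum_eq_zero hXN,
    integral_finsetSum _ hi2, mul_zero, zero_add]
  congr 2
  refine Finset.sum_congr rfl fun i h => ?_
  rw [integral_finsetSum _ fun j hj => hi i h j hj, Finset.sum_eq_single_of_mem i h
    fun j hj hij => hNN i h j hj hij.symm]
  simp_rw [real_inner_self_eq_norm_sq]

end L2

/-! ### Oracle noise -/

section Noise

variable {Ω Ξ V : Type*} [MeasurableSpace Ω] [MeasurableSpace Ξ] {M : ℕ}

/-- The σ-algebra generated by the samples with indices in `A`. -/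
@[reducible] def sampleAlgebra (ξ : ℕ → ℕ → Fin M → Ω → Ξ) (A : Set (ℕ × ℕ × Fin M)) : MeasurableSpace Ω :=
  ⨆ i ∈ A, MeasurableSpace.comap (ξ i.1 i.2.1 i.2.2) inferInstance

theorem sampleAlgebra_mono (ξ : ℕ → ℕ → Fin M → Ω → Ξ) {A B : Set (ℕ × ℕ × Fin M)} (h : A ⊆ B) :
    sampleAlgebra ξ A ≤ sampleAlgebra ξ B :=
  biSup_mono h

theorem measurable_sampleAlgebra (ξ : ℕ → ℕ → Fin M → Ω → Ξ) {A : Set (ℕ × ℕ × Fin M)}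
    {s j : ℕ} {m : Fin M} (h : (s, j, m) ∈ A) : Measurable[sampleAlgebra ξ A] (ξ s j m) :=
  (comap_measurable (ξ s j m)).mono
    (le_iSup₂_of_le (f := fun (i : ℕ × ℕ × Fin M) (_ : i ∈ A) =>
      MeasurableSpace.comap (ξ i.1 i.2.1 i.2.2) inferInstance) (s, j, m) h le_rfl) le_rfl

variable {P : Fin M → Measure Ξ} {Pr : Measure Ω} {ξ : ℕ → ℕ → Fin M → Ω → Ξ}

theorem AreFreshSamples.sampleAlgebra_le (hξ : AreFreshSamples P Pr ξ)
    (A : Set (ℕ × ℕ × Fin M)) : sampleAlgebra ξ A ≤ (inferInstance : MeasurableSpace Ω) :=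
  iSup₂_le fun i _ => (hξ.measurable i.1 i.2.1 i.2.2).comap_le

/-- Samples with disjoint index sets generate independent σ-algebras. The complement of a single
index covers every history at once, including the samples of other clients in the same step. -/
theorem AreFreshSamples.indepFun (hξ : AreFreshSamples P Pr ξ) {W : Type*} [MeasurableSpace W]
    {s j : ℕ} {m : Fin M} {Z : Ω → W} (hZ : Measurable[sampleAlgebra ξ {(s, j, m)}ᶜ] Z) :
    IndepFun Z (ξ s j m) Pr := by
  have h := indep_iSup_of_disjoint (m := fun i : ℕ × ℕ × Fin M =>
      MeasurableSpace.comap (ξ i.1 i.2.1 i.2.2) inferInstance) (fun i => (hξ.measurable i.1 i.2.1 i.2.2).comap_le)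
    hξ.indep (disjoint_compl_left (a := {((s, j, m) : ℕ × ℕ × Fin M)}))
  refine indep_of_indep_of_le_right (indep_of_indep_of_le_left h hZ.comap_le) ?_
  simp

variable [NormedAddCommGroup V] [InnerProductSpace ℝ V] [CompleteSpace V]
  [SecondCountableTopology V] [MeasurableSpace V] [BorelSpace V] [IsProbabilityMeasure Pr]
  {F : Fin M → V → ℝ} {g : Fin M → V → Ξ → V} {L σ : ℝ}

theorem IsStochasticOracle.measurable_noise (hg : IsStochasticOracle F P g σ)
    (hF : ∀ m, IsLSmooth L (F m)) (m : Fin M) :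
    Measurable fun z : V × Ξ => g m z.1 z.2 - gradient (F m) z.1 :=
  (hg.measurable m).sub ((hF m).continuous_gradient.measurable.comp measurable_fst)

theorem IsStochasticOracle.lintegral_noise_le (hg : IsStochasticOracle F P g σ) (m : Fin M)
    (x : V) : ∫⁻ ζ, ‖g m x ζ - gradient (F m) x‖ₑ ^ 2 ∂(P m) ≤ ENNReal.ofReal (σ ^ 2) := by
  have := hg.isProbabilityMeasure m
  have h : MemLp (fun ζ => g m x ζ - gradient (F m) x) 2 (P m) :=
    (hg.memLp m x).sub (memLp_const _)
  have h1 := ofReal_integral_eq_lintegral_ofReal h.integrable_norm_sq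
    (Filter.Eventually.of_forall fun ζ => sq_nonneg _)
  refine le_trans (le_of_eq ?_) (ENNReal.ofReal_le_ofReal (hg.variance_le m x))
  rw [h1]
  refine lintegral_congr fun ζ => ?_
  rw [ENNReal.ofReal_pow (norm_nonneg _), ofReal_norm]

/-- This takes the place of conditional expectations: an expectation over an oracle call becomes an
iterated integral in which the query point is frozen, so the oracle assumptions at deterministic
points apply. -/
theorem IsStochasticOracle.map_prod_eq (hξ : AreFreshSamples P Pr ξ)
    {W : Type*} [MeasurableSpace W] {s j : ℕ} {m : Fin M} {Z : Ω → W}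
    (hZ : Measurable[sampleAlgebra ξ {(s, j, m)}ᶜ] Z) :
    Pr.map (fun ω => (Z ω, ξ s j m ω)) = (Pr.map Z).prod (P m) := by
  have hZ' : Measurable Z := hZ.mono (hξ.sampleAlgebra_le _) le_rfl
  rw [(indepFun_iff_map_prod_eq_prod_map_map hZ'.aemeasurable
    (hξ.measurable s j m).aemeasurable).1 (hξ.indepFun hZ), hξ.law]

/-- The noise of an oracle call has second moment at most `σ²`. -/
theorem IsStochasticOracle.noise_lintegral_le (hg : IsStochasticOracle F P g σ)
    (hF : ∀ m, IsLSmooth L (F m)) (hξ : AreFreshSamples P Pr ξ) {s j : ℕ} {m : Fin M} {X : Ω → V}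
    (hX : Measurable[sampleAlgebra ξ {(s, j, m)}ᶜ] X) :
    ∫⁻ ω, ‖g m (X ω) (ξ s j m ω) - gradient (F m) (X ω)‖ₑ ^ 2 ∂Pr ≤ ENNReal.ofReal (σ ^ 2) := by
  have := hg.isProbabilityMeasure m
  have hX' : Measurable X := hX.mono (hξ.sampleAlgebra_le _) le_rfl
  have : IsProbabilityMeasure (Pr.map X) := Measure.isProbabilityMeasure_map hX'.aemeasurable
  have hm : Measurable fun z : V × Ξ => ‖g m z.1 z.2 - gradient (F m) z.1‖ₑ ^ 2 :=
    (hg.measurable_noise hF m).enorm.pow_const 2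
  have h1 := lintegral_map hm (hX'.prodMk (hξ.measurable s j m)) (μ := Pr)
  rw [IsStochasticOracle.map_prod_eq hξ hX, lintegral_prod _ hm.aemeasurable] at h1
  rw [← h1]
  refine (lintegral_mono fun x => hg.lintegral_noise_le m x).trans ?_
  simp

/-- The variance bound is uniform in the query point, so no integrability of `X` is needed. -/
theorem IsStochasticOracle.memLp_noise (hg : IsStochasticOracle F P g σ)
    (hF : ∀ m, IsLSmooth L (F m)) (hξ : AreFreshSamples P Pr ξ) {s j : ℕ} {m : Fin M} {X : Ω → V}
    (hX : Measurable[sampleAlgebra ξ {(s, j, m)}ᶜ] X) :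
    MemLp (fun ω => g m (X ω) (ξ s j m ω) - gradient (F m) (X ω)) 2 Pr := by
  have hX' : Measurable X := hX.mono (hξ.sampleAlgebra_le _) le_rfl
  refine ⟨((hg.measurable_noise hF m).comp
    (hX'.prodMk (hξ.measurable s j m))).aestronglyMeasurable, ?_⟩
  rw [eLpNorm_lt_top_iff_lintegral_rpow_enorm_lt_top two_ne_zero ENNReal.ofNat_ne_top]
  have h := hg.noise_lintegral_le hF hξ hX
  simp only [ENNReal.toReal_ofNat, ENNReal.rpow_ofNat]
  exact h.trans_lt ENNReal.ofReal_lt_top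

theorem IsStochasticOracle.integral_noise_sq_le (hg : IsStochasticOracle F P g σ)
    (hF : ∀ m, IsLSmooth L (F m)) (hξ : AreFreshSamples P Pr ξ) {s j : ℕ} {m : Fin M} {X : Ω → V}
    (hX : Measurable[sampleAlgebra ξ {(s, j, m)}ᶜ] X) :
    ∫ ω, ‖g m (X ω) (ξ s j m ω) - gradient (F m) (X ω)‖ ^ 2 ∂Pr ≤ σ ^ 2 := by
  have h := hg.memLp_noise hF hξ hX
  have h1 := ofReal_integral_eq_lintegral_ofReal h.integrable_norm_sq
    (Filter.Eventually.of_forall fun ω => sq_nonneg _)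
  rw [← ENNReal.ofReal_le_ofReal_iff (sq_nonneg σ), h1]
  refine le_trans (le_of_eq ?_) (hg.noise_lintegral_le hF hξ hX)
  refine lintegral_congr fun ω => ?_
  rw [ENNReal.ofReal_pow (norm_nonneg _), ofReal_norm]

/-- The noise of an oracle call is orthogonal to everything that depends on other samples only. -/
theorem IsStochasticOracle.integral_inner_noise (hg : IsStochasticOracle F P g σ)
    (hF : ∀ m, IsLSmooth L (F m)) (hξ : AreFreshSamples P Pr ξ) {s j : ℕ} {m : Fin M}
    {X Y : Ω → V} (hX : Measurable[sampleAlgebra ξ {(s, j, m)}ᶜ] X)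
    (hY : Measurable[sampleAlgebra ξ {(s, j, m)}ᶜ] Y) (hY2 : MemLp Y 2 Pr) :
    ∫ ω, inner ℝ (Y ω) (g m (X ω) (ξ s j m ω) - gradient (F m) (X ω)) ∂Pr = 0 := by
  have := hg.isProbabilityMeasure m
  have hZ : Measurable[sampleAlgebra ξ {(s, j, m)}ᶜ] fun ω => (Y ω, X ω) := hY.prodMk hX
  have hZ' : Measurable fun ω => (Y ω, X ω) := hZ.mono (hξ.sampleAlgebra_le _) le_rfl
  have : IsProbabilityMeasure (Pr.map fun ω => (Y ω, X ω)) :=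
    Measure.isProbabilityMeasure_map hZ'.aemeasurable
  have hm : Measurable fun z : (V × V) × Ξ =>
      inner ℝ z.1.1 (g m z.1.2 z.2 - gradient (F m) z.1.2) :=
    (measurable_fst.comp measurable_fst).inner ((hg.measurable_noise hF m).comp
      ((measurable_snd.comp measurable_fst).prodMk measurable_snd))
  have hpair := hZ'.prodMk (hξ.measurable s j m)
  have h1 := integral_map hpair.aemeasurable (μ := Pr) hm.aestronglyMeasurable
  have hint : Integrable (fun z : (V × V) × Ξ =>
      inner ℝ z.1.1 (g m z.1.2 z.2 - gradient (F m) z.1.2))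
      (Pr.map fun ω => ((Y ω, X ω), ξ s j m ω)) :=
    (integrable_map_measure hm.aestronglyMeasurable hpair.aemeasurable).2
      (hY2.integrable_inner_two (hg.memLp_noise hF hξ hX))
  rw [IsStochasticOracle.map_prod_eq hξ hZ] at h1 hint
  rw [integral_prod _ hint] at h1
  rw [← h1]
  -- For frozen `Y` and `X` the inner integral pairs `Y` with the mean noise, which is zero by
  -- unbiasedness.
  refine integral_eq_zero_of_ae (Filter.Eventually.of_forall fun z => ?_)
  have hi : Integrable (g m z.2) (P m) := (hg.memLp m z.2).integrable one_le_two
  simp only [Pi.zero_apply]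
  rw [integral_inner (f := fun ζ => g m z.2 ζ - gradient (F m) z.2)
    (hi.sub (integrable_const _)), integral_sub hi (integrable_const _),
    hg.unbiased]
  simp

end Noise

/-! ### One round of SCAFFOLD, pathwise -/

section Round

variable {V : Type*} [NormedAddCommGroup V] [InnerProductSpace ℝ V] {M : ℕ}

theorem norm_sum_sq_le_card_mul {ι : Type*} (s : Finset ι) (a : ι → V) :
    ‖∑ i ∈ s, a i‖ ^ 2 ≤ s.card * ∑ i ∈ s, ‖a i‖ ^ 2 :=
  (pow_le_pow_left₀ (norm_nonneg _) (norm_sum_le s a) 2).trans sq_sum_le_card_mul_sum_sq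

theorem norm_add_three_sq_le (a b c : V) :
    ‖a + b + c‖ ^ 2 ≤ 3 * (‖a‖ ^ 2 + ‖b‖ ^ 2 + ‖c‖ ^ 2) := by
  have h := pow_le_pow_left₀ (norm_nonneg _) (norm_add₃_le (a := a) (b := b) (c := c)) 2
  nlinarith [sq_nonneg (‖a‖ - ‖b‖), sq_nonneg (‖a‖ - ‖c‖), sq_nonneg (‖b‖ - ‖c‖)]

theorem norm_sub_sq_le_young (a b : V) {t : ℝ} (ht : 0 < t) :
    ‖a - b‖ ^ 2 ≤ (1 + t) * ‖a‖ ^ 2 + (1 + 1 / t) * ‖b‖ ^ 2 := by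
  have h : 0 ≤ (t * ‖a‖ - ‖b‖) ^ 2 / t := by positivity
  have h1 : (t * ‖a‖ - ‖b‖) ^ 2 / t = t * ‖a‖ ^ 2 - 2 * (‖a‖ * ‖b‖) + 1 / t * ‖b‖ ^ 2 := by
    field_simp
    ring
  have h2 := pow_le_pow_left₀ (norm_nonneg _) (norm_sub_le a b) 2
  nlinarith

theorem scaffoldLocal_eq (η : ℝ) (G : ℕ → V → V) (c cm x : V) (k : ℕ) :
    scaffoldLocal η G c cm x k
      = x - η • ∑ j ∈ Finset.range k, (G j (scaffoldLocal η G c cm x j) - cm + c) := by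
  induction k with
  | zero => simp [scaffoldLocal]
  | succ k ih =>
    rw [Finset.sum_range_succ, smul_add, ← sub_sub, ← ih]
    rfl

/-- The `k`-th local iterate of client `m`. -/
def scaffoldIterate (p : ScaffoldParams) (G : ℕ → Fin M → V → V) (st : ScaffoldState M V)
    (m : Fin M) (k : ℕ) : V :=
  scaffoldLocal p.localStepSize (fun k => G k m) st.control (st.clientControl m) st.server k

variable {p : ScaffoldParams} {G : ℕ → Fin M → V → V} {st : ScaffoldState M V}

theorem scaffoldClient_eq (m : Fin M) : scaffoldClient p G st m = st.server - p.localStepSize •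
    ∑ j ∈ Finset.range p.localSteps,
      (G j m (scaffoldIterate p G st m j) - st.clientControl m + st.control) :=
  scaffoldLocal_eq _ _ _ _ _ _

/-- The displacement `x - yₘ` contains `K` copies of `c - cₘ`, which cancel and leave the average
gradient along the local path. Old control variates thus influence the new ones only through the
position of the local iterates. -/
theorem scaffoldClientControl_eq (hp : p.Admissible) (m : Fin M) :
    scaffoldClientControl p G st m = (1 / (p.localSteps : ℝ)) •
      ∑ j ∈ Finset.range p.localSteps, G j m (scaffoldIterate p G st m j) := by
  have hK : (p.localSteps : ℝ) ≠ 0 := by have := hp.localSteps_pos; positivity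
  have hη := hp.localStepSize_pos.ne'
  rw [scaffoldClientControl, scaffoldClient_eq, sub_sub_cancel, smul_smul, Finset.sum_add_distrib,
    Finset.sum_sub_distrib, Finset.sum_const, Finset.sum_const, Finset.card_range,
    ← Nat.cast_smul_eq_nsmul ℝ, ← Nat.cast_smul_eq_nsmul ℝ,
    show 1 / ((p.localSteps : ℝ) * p.localStepSize) * p.localStepSize = 1 / (p.localSteps : ℝ) by
      field_simp, smul_add, smul_sub, smul_smul, smul_smul, one_div_mul_cancel hK, one_smul,
    one_smul]
  abel

/-- This invariant is what makes the control corrections cancel in the server update. -/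
theorem scaffoldRound_control
    (hc : st.control = (1 / (M : ℝ)) • ∑ m, st.clientControl m) :
    (scaffoldRound p G st).control
      = (1 / (M : ℝ)) • ∑ m, (scaffoldRound p G st).clientControl m := by
  simp only [scaffoldRound, Finset.sum_sub_distrib, smul_sub]
  rw [← hc]
  abel

/-- The corrections `c - cₘ` have mean zero, so the server steps along the mean stochastic gradient
with effective step size the product of both step sizes and `K`. -/
theorem scaffoldRound_server (hp : p.Admissible) (hM : 1 ≤ M)
    (hc : st.control = (1 / (M : ℝ)) • ∑ m, st.clientControl m) :
    (scaffoldRound p G st).server = st.server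
      - (p.globalStepSize * p.localStepSize * p.localSteps) •
        (1 / (M : ℝ)) • ∑ m, scaffoldClientControl p G st m := by
  have hK : (p.localSteps : ℝ) ≠ 0 := by have := hp.localSteps_pos; positivity
  have hη := hp.localStepSize_pos.ne'
  have hM' : (M : ℝ) ≠ 0 := by positivity
  have h : ∀ m, scaffoldClient p G st m - st.server = -(p.localStepSize * p.localSteps) •
      (scaffoldClientControl p G st m - st.clientControl m + st.control) := by
    intro m
    rw [scaffoldClientControl, show st.clientControl m - st.control
      + (1 / ((p.localSteps : ℝ) * p.localStepSize)) • (st.server - scaffoldClient p G st m)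
      - st.clientControl m + st.control
      = (1 / ((p.localSteps : ℝ) * p.localStepSize)) • (st.server - scaffoldClient p G st m) by
        abel, smul_smul]
    rw [show -(p.localStepSize * p.localSteps) * (1 / ((p.localSteps : ℝ) * p.localStepSize)) = -1
      by field_simp]
    simp
  have h2 : (1 / (M : ℝ)) • ∑ m : Fin M, st.control = st.control := by
    rw [Finset.sum_const, Finset.card_univ, Fintype.card_fin, ← Nat.cast_smul_eq_nsmul ℝ,
      smul_smul, one_div_mul_cancel hM', one_smul]
  simp only [scaffoldRound, h]
  rw [← Finset.smul_sum, Finset.sum_add_distrib, Finset.sum_sub_distrib, smul_comm (1 / (M : ℝ)),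
    smul_add, smul_sub, ← hc, h2, smul_smul, sub_add_cancel, sub_eq_add_neg, ← neg_smul]
  congr 2
  ring

/-- The mean squared distance of the control variates to the client gradients at `r`. -/
def controlError (φ : Fin M → V → V) (r : V) (st : ScaffoldState M V) : ℝ :=
  1 / (M : ℝ) * ∑ m, ‖st.clientControl m - φ m r‖ ^ 2

/-- The error of the stochastic gradient in the `k`-th local step of client `m`. -/
def scaffoldNoise (φ : Fin M → V → V) (p : ScaffoldParams) (G : ℕ → Fin M → V → V)
    (st : ScaffoldState M V) (m : Fin M) (k : ℕ) : V :=
  G k m (scaffoldIterate p G st m k) - φ m (scaffoldIterate p G st m k)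

variable {L : ℝ} {φ : Fin M → V → V} {r : V}

/-- The drift of the local iterates. -/
theorem norm_scaffoldIterate_sub_le (hp : p.Admissible) (hL : 0 < L)
    (hφ : ∀ m x z, ‖φ m x - φ m z‖ ≤ 3 * L * ‖x - z‖)
    (hη : 6 * L * p.localSteps * p.localStepSize ≤ 1) (m : Fin M) {k : ℕ}
    (hk : k ≤ p.localSteps) :
    ‖scaffoldIterate p G st m k - st.server‖ ≤ 2 * p.localStepSize *
      (∑ j ∈ Finset.range p.localSteps, ‖scaffoldNoise φ p G st m j‖ + p.localSteps *
        (3 * L * ‖st.server - r‖ + ‖st.clientControl m - φ m r‖ + ‖st.control‖)) := by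
  set q := 3 * L * ‖st.server - r‖ + ‖st.clientControl m - φ m r‖ + ‖st.control‖ with hq
  set D := 2 * p.localStepSize *
      (∑ j ∈ Finset.range p.localSteps, ‖scaffoldNoise φ p G st m j‖ + p.localSteps * q) with hD
  have hη0 := hp.localStepSize_pos
  have hq0 : 0 ≤ q := by positivity
  have hD0 : 0 ≤ D := by positivity
  -- `D` is a self-consistent bound: noise and starting terms give `D/2`, and the drift of the
  -- earlier iterates, at most `D`, contributes `3 L K η D ≤ D/2`.
  induction k using Nat.strong_induction_on with
  | _ k ih =>
  have h1 : scaffoldIterate p G st m k - st.server = -(p.localStepSize •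
      ∑ j ∈ Finset.range k,
        (G j m (scaffoldIterate p G st m j) - st.clientControl m + st.control)) := by
    rw [scaffoldIterate, scaffoldLocal_eq]
    simp only [scaffoldIterate]
    abel
  rw [h1, norm_neg, norm_smul, Real.norm_of_nonneg hη0.le]
  have h2 : ∀ j ∈ Finset.range k,
      ‖G j m (scaffoldIterate p G st m j) - st.clientControl m + st.control‖
        ≤ ‖scaffoldNoise φ p G st m j‖ + (3 * L * D + q) := by
    intro j hj
    have hj' := Finset.mem_range.1 hj
    have hv := ih j hj' (hj'.le.trans hk)
    rw [show G j m (scaffoldIterate p G st m j) - st.clientControl m + st.control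
      = scaffoldNoise φ p G st m j + (φ m (scaffoldIterate p G st m j) - φ m st.server)
        + (φ m st.server - φ m r) - (st.clientControl m - φ m r) + st.control by
        rw [scaffoldNoise]; abel]
    have h3 := hφ m (scaffoldIterate p G st m j) st.server
    have h4 := hφ m st.server r
    have h5 : 3 * L * ‖scaffoldIterate p G st m j - st.server‖ ≤ 3 * L * D := by gcongr
    refine (norm_add_le _ _).trans ?_
    refine (add_le_add_left (norm_sub_le _ _) _).trans ?_
    refine (add_le_add_left (add_le_add_left norm_add₃_le _) _).trans ?_
    rw [hq]
    linarith
  calc p.localStepSize * ‖∑ j ∈ Finset.range k,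
        (G j m (scaffoldIterate p G st m j) - st.clientControl m + st.control)‖
      ≤ p.localStepSize * ∑ j ∈ Finset.range k,
          (‖scaffoldNoise φ p G st m j‖ + (3 * L * D + q)) := by
        gcongr
        exact norm_sum_le_of_le _ h2
    _ ≤ p.localStepSize * ∑ j ∈ Finset.range p.localSteps,
          (‖scaffoldNoise φ p G st m j‖ + (3 * L * D + q)) := by
        gcongr
    _ = D / 2 + (6 * L * p.localSteps * p.localStepSize) * (D / 2) := by
        rw [Finset.sum_add_distrib, Finset.sum_const, Finset.card_range, nsmul_eq_mul]
        nth_rw 2 [hD]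
        rw [hD]
        ring
    _ ≤ D / 2 + 1 * (D / 2) := by gcongr
    _ = D := by ring

/-- The parameters of the SCAFFOLD runs: the output is the last server model, and the effective
step size is `1 / (9 L)`. -/
def scaffoldParams (L : ℝ) (M T K : ℕ) : ScaffoldParams where
  rounds := T
  localSteps := K
  -- Times `K` and the global step size this is `1/(9L)`, while the total local step length is only
  -- `1/(900 L M K)`. Its square makes the noise in the drift no worse than the averaged noise
  -- `σ²/(M K)`.
  localStepSize := 1 / (9 * L * K * (100 * (M * K)))
  globalStepSize := 100 * (M * K)
  weight t := if t = T then 1 else 0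

theorem scaffoldParams_admissible {T K : ℕ} (hL : 0 < L) (hM : 1 ≤ M) (hT : 1 ≤ T) (hK : 1 ≤ K) :
    (scaffoldParams L M T K).Admissible where
  rounds_pos := hT
  localSteps_pos := hK
  localStepSize_pos := by
    have : (0 : ℝ) < M := by exact_mod_cast hM
    have : (0 : ℝ) < K := by exact_mod_cast hK
    simp only [scaffoldParams]
    positivity
  globalStepSize_ge := by
    have h1 : (1 : ℝ) ≤ M := by exact_mod_cast hM
    have h2 : (1 : ℝ) ≤ K := by exact_mod_cast hK
    simp only [scaffoldParams]
    nlinarith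
  weight_nonneg t := by
    simp only [scaffoldParams]
    split_ifs <;> norm_num
  weight_sum_pos := by simp [scaffoldParams]

variable {T K : ℕ}

/-- One round of SCAFFOLD decreases the potential
`‖x - r‖² + (1 / (1000 M K L²)) controlError`, up to noise. -/
theorem scaffoldRound_potential_le (hL : 0 < L) (hM : 1 ≤ M) (hT : 1 ≤ T) (hK : 1 ≤ K)
    (hφ : ∀ m x z, ‖φ m x - φ m z‖ ≤ 3 * L * ‖x - z‖) (hr : ∑ m, φ m r = 0)
    (hp : p = scaffoldParams L M T K)
    (hc : st.control = (1 / (M : ℝ)) • ∑ m, st.clientControl m) :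
    ‖(scaffoldRound p G st).server - r‖ ^ 2
      + 1 / (1000 * (M * K) * L ^ 2) * controlError φ r (scaffoldRound p G st)
    ≤ 33 / 32 * ‖(st.server - r - (1 / (9 * L)) • ((1 / (M : ℝ)) • ∑ m, φ m st.server))
          - (1 / (9 * L * (M * K))) • ∑ m, ∑ k ∈ Finset.range K, scaffoldNoise φ p G st m k‖ ^ 2
      + 1 / 30 * ‖st.server - r‖ ^ 2
      + 23 / 24 * (1 / (1000 * (M * K) * L ^ 2) * controlError φ r st)
      + 1 / (250 * L ^ 2 * (M * K)) * (1 / (M * K : ℝ)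
          * ∑ m, ∑ k ∈ Finset.range K, ‖scaffoldNoise φ p G st m k‖ ^ 2) := by
  have hM1 : (1 : ℝ) ≤ M := by exact_mod_cast hM
  have hK1 : (1 : ℝ) ≤ K := by exact_mod_cast hK
  have hM0 : (0 : ℝ) < M := by linarith
  have hK0 : (0 : ℝ) < K := by linarith
  have hpa : p.Admissible := hp ▸ scaffoldParams_admissible hL hM hT hK
  have hpK : p.localSteps = K := by rw [hp]; rfl
  have hpη : p.localStepSize = 1 / (9 * L * K * (100 * (M * K))) := by rw [hp]; rfl
  have hpg : p.globalStepSize = 100 * (M * K) := by rw [hp]; rfl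
  set n := scaffoldNoise φ p G st with hn
  set w := scaffoldIterate p G st with hw
  set A := ‖st.server - r‖ with hA
  set b := controlError φ r st with hb
  set D : Fin M → ℝ := fun m => 2 * p.localStepSize *
      (∑ j ∈ Finset.range K, ‖n m j‖ + K * (3 * L * A + ‖st.clientControl m - φ m r‖
        + ‖st.control‖)) with hD
  have hθ : (1 : ℝ) ≤ M * K := by nlinarith
  have hdrift : ∀ m, ∀ k ∈ Finset.range K, ‖w m k - st.server‖ ≤ D m := by
    intro m k hk
    have hk' : k ≤ p.localSteps := hpK ▸ (Finset.mem_range.1 hk).le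
    have h := norm_scaffoldIterate_sub_le (G := G) (st := st) (r := r) hpa hL hφ
      (by
        rw [hpK, hpη, show 6 * L * K * (1 / (9 * L * K * (100 * (M * K)))) = 1 / (150 * (M * K : ℝ))
          by field_simp; norm_num, div_le_one (by positivity)]
        linarith) m hk'
    rw [hpK] at h
    exact h
  set ν := 1 / (M * K : ℝ) * ∑ m, ∑ k ∈ Finset.range K, ‖n m k‖ ^ 2 with hν
  set E := 1 / (M : ℝ) * ∑ m, D m ^ 2 with hE
  have hν0 : 0 ≤ ν := by positivity
  have hE0 : 0 ≤ E := by positivity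
  have hb0 : 0 ≤ b := by rw [hb, controlError]; positivity
  -- the server control variate
  have hcb : ‖st.control‖ ^ 2 ≤ b := by
    have h1 : st.control = (1 / (M : ℝ)) • ∑ m, (st.clientControl m - φ m r) := by
      rw [Finset.sum_sub_distrib, hr, sub_zero, hc]
    rw [h1, norm_smul, mul_pow, Real.norm_of_nonneg (by positivity)]
    have h2 := norm_sum_sq_le_card_mul Finset.univ fun m => st.clientControl m - φ m r
    rw [Finset.card_univ, Fintype.card_fin] at h2
    calc (1 / (M : ℝ)) ^ 2 * ‖∑ m, (st.clientControl m - φ m r)‖ ^ 2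
        ≤ (1 / (M : ℝ)) ^ 2 * (M * ∑ m, ‖st.clientControl m - φ m r‖ ^ 2) := by gcongr
      _ = b := by rw [hb, controlError]; field_simp
  -- the drift
  have hEle : E ≤ 8 * (p.localStepSize * K) ^ 2 * (ν + 27 * L ^ 2 * A ^ 2 + 6 * b) := by
    have h1 : ∀ m, D m ^ 2 ≤ 8 * p.localStepSize ^ 2 * (K * ∑ j ∈ Finset.range K, ‖n m j‖ ^ 2
        + K ^ 2 * (3 * (9 * L ^ 2 * A ^ 2 + ‖st.clientControl m - φ m r‖ ^ 2 + b))) := by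
      intro m
      have h2 := sq_sum_le_card_mul_sum_sq (s := Finset.range K) (f := fun j => ‖n m j‖)
      rw [Finset.card_range] at h2
      set a := ∑ j ∈ Finset.range K, ‖n m j‖
      set c := ‖st.clientControl m - φ m r‖
      have h3 : (3 * L * A + c + ‖st.control‖) ^ 2 ≤ 3 * (9 * L ^ 2 * A ^ 2 + c ^ 2 + b) := by
        nlinarith [sq_nonneg (3 * L * A - c), sq_nonneg (3 * L * A - ‖st.control‖),
          sq_nonneg (c - ‖st.control‖)]
      have h4 : (a + K * (3 * L * A + c + ‖st.control‖)) ^ 2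
          ≤ 2 * (a ^ 2 + K ^ 2 * (3 * L * A + c + ‖st.control‖) ^ 2) := by
        nlinarith [sq_nonneg (a - K * (3 * L * A + c + ‖st.control‖))]
      calc D m ^ 2 = 4 * p.localStepSize ^ 2
            * (a + K * (3 * L * A + c + ‖st.control‖)) ^ 2 := by rw [hD]; ring
        _ ≤ 4 * p.localStepSize ^ 2 * (2 * (K * ∑ j ∈ Finset.range K, ‖n m j‖ ^ 2
            + K ^ 2 * (3 * (9 * L ^ 2 * A ^ 2 + c ^ 2 + b)))) := by
            gcongr
            refine h4.trans ?_
            gcongr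
        _ = _ := by ring
    calc E ≤ 1 / (M : ℝ) * ∑ m, 8 * p.localStepSize ^ 2 * (K * ∑ j ∈ Finset.range K, ‖n m j‖ ^ 2
        + K ^ 2 * (3 * (9 * L ^ 2 * A ^ 2 + ‖st.clientControl m - φ m r‖ ^ 2 + b))) := by
          rw [hE]
          gcongr with m
          exact h1 m
      _ = _ := by
        rw [← Finset.mul_sum, Finset.sum_add_distrib, ← Finset.mul_sum, ← Finset.mul_sum,
          ← Finset.mul_sum, Finset.sum_add_distrib, Finset.sum_add_distrib, Finset.sum_const,
          Finset.sum_const, Finset.card_univ, Fintype.card_fin, nsmul_eq_mul, nsmul_eq_mul, hν,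
          show ∑ m, ‖st.clientControl m - φ m r‖ ^ 2 = M * b by
            rw [hb, controlError]; field_simp]
        field_simp
        ring
  have hcc : ∀ m, scaffoldClientControl p G st m = (1 / (K : ℝ)) • ∑ j ∈ Finset.range K,
      (n m j + (φ m (w m j) - φ m st.server) + φ m st.server) := by
    intro m
    rw [scaffoldClientControl_eq hpa, hpK]
    congr 1
    refine Finset.sum_congr rfl fun j _ => ?_
    rw [hn, scaffoldNoise]
    abel
  -- the new control variates
  have hb' : controlError φ r (scaffoldRound p G st) ≤ 3 * ν + 27 * L ^ 2 * E
      + 27 * L ^ 2 * A ^ 2 := by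
    have h1 : ∀ m, ‖scaffoldClientControl p G st m - φ m r‖ ^ 2 ≤ 1 / (K : ℝ) *
        ∑ j ∈ Finset.range K, 3 * (‖n m j‖ ^ 2 + 9 * L ^ 2 * D m ^ 2 + 9 * L ^ 2 * A ^ 2) := by
      intro m
      have h2 : scaffoldClientControl p G st m - φ m r = (1 / (K : ℝ)) • ∑ j ∈ Finset.range K,
          (n m j + (φ m (w m j) - φ m st.server) + (φ m st.server - φ m r)) := by
        rw [hcc m]
        simp_rw [Finset.sum_add_distrib, Finset.sum_sub_distrib, Finset.sum_const,
          Finset.card_range, smul_add, smul_sub, ← Nat.cast_smul_eq_nsmul ℝ, smul_smul,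
          one_div_mul_cancel hK0.ne', one_smul]
        abel
      have h3 := norm_sum_sq_le_card_mul (Finset.range K) fun j =>
        n m j + (φ m (w m j) - φ m st.server) + (φ m st.server - φ m r)
      rw [Finset.card_range] at h3
      rw [h2, norm_smul, mul_pow, Real.norm_of_nonneg (by positivity)]
      calc (1 / (K : ℝ)) ^ 2 * ‖∑ j ∈ Finset.range K,
            (n m j + (φ m (w m j) - φ m st.server) + (φ m st.server - φ m r))‖ ^ 2
          ≤ (1 / (K : ℝ)) ^ 2 * (K * ∑ j ∈ Finset.range K,
            ‖n m j + (φ m (w m j) - φ m st.server) + (φ m st.server - φ m r)‖ ^ 2) := by gcongr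
        _ = 1 / (K : ℝ) * ∑ j ∈ Finset.range K,
            ‖n m j + (φ m (w m j) - φ m st.server) + (φ m st.server - φ m r)‖ ^ 2 := by
          field_simp
        _ ≤ _ := by
          gcongr with j hj
          refine (norm_add_three_sq_le _ _ _).trans ?_
          have h4 : ‖φ m (w m j) - φ m st.server‖ ^ 2 ≤ 9 * L ^ 2 * D m ^ 2 := by
            refine (pow_le_pow_left₀ (norm_nonneg _) ((hφ m _ _).trans (mul_le_mul_of_nonneg_left
              (hdrift m j hj) (by positivity))) 2).trans (le_of_eq (by ring))
          have h5 : ‖φ m st.server - φ m r‖ ^ 2 ≤ 9 * L ^ 2 * A ^ 2 :=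
            (pow_le_pow_left₀ (norm_nonneg _) (hφ m _ _) 2).trans (le_of_eq (by ring))
          linarith
    calc controlError φ r (scaffoldRound p G st)
        ≤ 1 / (M : ℝ) * ∑ m, 1 / (K : ℝ) * ∑ j ∈ Finset.range K,
            3 * (‖n m j‖ ^ 2 + 9 * L ^ 2 * D m ^ 2 + 9 * L ^ 2 * A ^ 2) := by
          rw [controlError]
          gcongr with m
          exact h1 m
      _ = _ := by
        simp_rw [← Finset.mul_sum, Finset.sum_add_distrib, Finset.sum_const, Finset.card_range,
          Finset.card_univ, Fintype.card_fin, nsmul_eq_mul, ← Finset.mul_sum]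
        rw [hν, hE]
        field_simp
        ring
  -- the new server model
  set e := (1 / (M * K : ℝ)) • ∑ m, ∑ k ∈ Finset.range K, (φ m (w m k) - φ m st.server) with he
  have hee : ‖e‖ ^ 2 ≤ 9 * L ^ 2 * E := by
    have h1 := norm_sum_sq_le_card_mul (Finset.univ ×ˢ Finset.range K)
      fun i : Fin M × ℕ => φ i.1 (w i.1 i.2) - φ i.1 st.server
    rw [Finset.sum_product, Finset.sum_product, Finset.card_product, Finset.card_univ,
      Fintype.card_fin, Finset.card_range, Nat.cast_mul] at h1
    rw [he, norm_smul, mul_pow, Real.norm_of_nonneg (by positivity)]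
    calc (1 / (M * K : ℝ)) ^ 2
          * ‖∑ m, ∑ k ∈ Finset.range K, (φ m (w m k) - φ m st.server)‖ ^ 2
        ≤ (1 / (M * K : ℝ)) ^ 2 * (M * K
          * ∑ m, ∑ k ∈ Finset.range K, ‖φ m (w m k) - φ m st.server‖ ^ 2) := by gcongr
      _ ≤ (1 / (M * K : ℝ)) ^ 2 * (M * K
          * ∑ m, ∑ k ∈ Finset.range K, 9 * L ^ 2 * D m ^ 2) := by
        gcongr with m _ k hk
        refine (pow_le_pow_left₀ (norm_nonneg _) ((hφ m _ _).trans (mul_le_mul_of_nonneg_left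
          (hdrift m k hk) (by positivity))) 2).trans (le_of_eq (by ring))
      _ = 9 * L ^ 2 * E := by
        simp_rw [Finset.sum_const, Finset.card_range, nsmul_eq_mul, ← Finset.mul_sum]
        rw [hE]
        field_simp
  set h := (st.server - r - (1 / (9 * L)) • ((1 / (M : ℝ)) • ∑ m, φ m st.server))
    - (1 / (9 * L * (M * K))) • ∑ m, ∑ k ∈ Finset.range K, n m k with hh
  have hserver : (scaffoldRound p G st).server - r = h - (1 / (9 * L)) • e := by
    rw [scaffoldRound_server hpa hM hc, hpg, hpK, hpη, show 100 * ((M : ℝ) * K)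
      * (1 / (9 * L * K * (100 * (M * K)))) * K = 1 / (9 * L) by field_simp, hh, he]
    simp_rw [hcc, Finset.sum_add_distrib, Finset.sum_const, Finset.card_range, smul_add,
      ← Nat.cast_smul_eq_nsmul ℝ, smul_smul, one_div_mul_cancel hK0.ne', one_smul,
      Finset.sum_add_distrib, ← Finset.smul_sum, smul_add, smul_smul]
    rw [show 1 / (9 * L) * (1 / (M : ℝ)) * (1 / K) = 1 / (9 * L * (M * K)) by field_simp,
      show 1 / (9 * L) * (1 / (M * K : ℝ)) = 1 / (9 * L * (M * K)) by field_simp]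
    abel
  -- The weight `1/32` is small enough that `33/32 · 8/9 = 11/12` leaves room below `23/24` for the
  -- drift and the control variates.
  have hs : ‖(scaffoldRound p G st).server - r‖ ^ 2 ≤ 33 / 32 * ‖h‖ ^ 2 + 33 / 9 * E := by
    rw [hserver]
    refine (norm_sub_sq_le_young _ _ (t := 1 / 32) (by norm_num)).trans ?_
    rw [norm_smul, mul_pow, Real.norm_of_nonneg (by positivity)]
    have h1 : (1 / (9 * L)) ^ 2 * ‖e‖ ^ 2 ≤ (1 / (9 * L)) ^ 2 * (9 * L ^ 2 * E) := by gcongr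
    have h2 : (1 / (9 * L)) ^ 2 * (9 * L ^ 2 * E) = 1 / 9 * E := by field_simp
    linarith
  -- conclusion
  set θ : ℝ := M * K with hθd
  -- The squared factor `100 M K` of the local step size makes the drift a small multiple of terms
  -- already in the potential. One factor `1/(M K)` is kept on the noise and the control error; the
  -- remaining ones are bounded by `1`.
  have hEf : E ≤ 1 / 100000 * (ν / (L ^ 2 * θ) + 27 * A ^ 2 + 6 * (b / (L ^ 2 * θ))) := by
    refine hEle.trans ?_
    rw [hpη, show 8 * (1 / (9 * L * K * (100 * θ)) * K) ^ 2 * (ν + 27 * L ^ 2 * A ^ 2 + 6 * b)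
      = 8 / 810000 * (1 / θ) * (ν / (L ^ 2 * θ) + 27 * (A ^ 2 * (1 / θ)) + 6 * (b / (L ^ 2 * θ)))
      by field_simp; ring]
    have h1 : 1 / θ ≤ 1 := by rw [div_le_one (by linarith)]; exact hθ
    have h2 : A ^ 2 * (1 / θ) ≤ A ^ 2 * 1 := by gcongr
    have h3 : 0 ≤ 1 / θ := by positivity
    have h4 : 8 / 810000 * (1 / θ) ≤ 1 / 100000 := by linarith
    gcongr
    linarith
  have hb'' : 1 / (1000 * θ * L ^ 2) * controlError φ r (scaffoldRound p G st)
      ≤ 3 / 1000 * (ν / (L ^ 2 * θ)) + 27 / 1000 * E + 27 / 1000 * A ^ 2 := by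
    have h1 : 1 / θ ≤ 1 := by rw [div_le_one (by linarith)]; exact hθ
    calc 1 / (1000 * θ * L ^ 2) * controlError φ r (scaffoldRound p G st)
        ≤ 1 / (1000 * θ * L ^ 2) * (3 * ν + 27 * L ^ 2 * E + 27 * L ^ 2 * A ^ 2) := by gcongr
      _ = 3 / 1000 * (ν / (L ^ 2 * θ)) + 27 / 1000 * (E * (1 / θ))
          + 27 / 1000 * (A ^ 2 * (1 / θ)) := by field_simp
      _ ≤ 3 / 1000 * (ν / (L ^ 2 * θ)) + 27 / 1000 * (E * 1) + 27 / 1000 * (A ^ 2 * 1) := by gcongr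
      _ = _ := by ring
  have h1 : 1 / (1000 * θ * L ^ 2) * b = 1 / 1000 * (b / (L ^ 2 * θ)) := by field_simp
  have h2 : 1 / (250 * L ^ 2 * θ) * ν = 1 / 250 * (ν / (L ^ 2 * θ)) := by field_simp
  have h3 : 0 ≤ ν / (L ^ 2 * θ) := by positivity
  have h4 : 0 ≤ b / (L ^ 2 * θ) := by positivity
  have h5 : 0 ≤ A ^ 2 := sq_nonneg _
  rw [h1, h2]
  linarith

end Round

/-! ### SCAFFOLD in expectation -/

section Expectation

variable {Ω Ξ V : Type*} [MeasurableSpace Ω] [MeasurableSpace Ξ] {M : ℕ}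
  {P : Fin M → Measure Ξ} {Pr : Measure Ω} {ξ : ℕ → ℕ → Fin M → Ω → Ξ}
  [NormedAddCommGroup V] [InnerProductSpace ℝ V] [CompleteSpace V]
  [SecondCountableTopology V] [MeasurableSpace V] [BorelSpace V] [IsProbabilityMeasure Pr]
  {F : Fin M → V → ℝ} {g : Fin M → V → Ξ → V} {L σ : ℝ}

/-- The indices of the samples drawn before the `j`-th oracle call in subproblem `s`. -/
def pastSamples (M s j : ℕ) : Set (ℕ × ℕ × Fin M) := {i | i.1 < s ∨ i.1 = s ∧ i.2.1 < j}

theorem pastSamples_mono {s j k : ℕ} (h : j ≤ k) : pastSamples M s j ⊆ pastSamples M s k := by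
  rintro i (hi | hi)
  · exact Or.inl hi
  · exact Or.inr ⟨hi.1, hi.2.trans_le h⟩

theorem pastSamples_subset_compl {s j k : ℕ} (h : j ≤ k) (m : Fin M) :
    pastSamples M s j ⊆ {(s, k, m)}ᶜ := by
  rintro i hi rfl
  rcases hi with hi | hi
  · exact lt_irrefl _ hi
  · exact absurd hi.2 (not_lt.2 h)

/-- The stochastic gradients of the clients in subproblem `s` with prox centre `y`. -/
def subproblemOracle (L : ℝ) (g : Fin M → V → Ξ → V) (ξ : ℕ → ℕ → Fin M → Ω → Ξ) (s : ℕ)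
    (y : Ω → V) (ω : Ω) (j : ℕ) (m : Fin M) (v : V) : V :=
  g m v (ξ s j m ω) + (2 * L) • (v - y ω)

/-- The gradients of the clients in a subproblem with prox centre `y`. -/
def subproblemGradient (F : Fin M → V → ℝ) (L : ℝ) (y : V) (m : Fin M) (v : V) : V :=
  gradient (F m) v + (2 * L) • (v - y)

/-- A random SCAFFOLD state that depends on the samples before call `j` of subproblem `s` only. -/
structure ScaffoldAdapted (ξ : ℕ → ℕ → Fin M → Ω → Ξ) (Pr : Measure Ω) (s j : ℕ)
    (st : Ω → ScaffoldState M V) : Prop where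
  measurable_server : Measurable[sampleAlgebra ξ (pastSamples M s j)] fun ω => (st ω).server
  measurable_clientControl : ∀ m, Measurable[sampleAlgebra ξ (pastSamples M s j)]
    fun ω => (st ω).clientControl m
  memLp_server : MemLp (fun ω => (st ω).server) 2 Pr
  memLp_clientControl : ∀ m, MemLp (fun ω => (st ω).clientControl m) 2 Pr
  control_eq : ∀ ω, (st ω).control = (1 / (M : ℝ)) • ∑ m, (st ω).clientControl m

variable {s j : ℕ} {y : Ω → V} {st : Ω → ScaffoldState M V} {p : ScaffoldParams}

theorem ScaffoldAdapted.measurable_control (hst : ScaffoldAdapted ξ Pr s j st) :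
    Measurable[sampleAlgebra ξ (pastSamples M s j)] fun ω => (st ω).control := by
  simp_rw [hst.control_eq]
  exact (Finset.measurable_sum _ fun m _ => hst.measurable_clientControl m).const_smul _

theorem ScaffoldAdapted.memLp_control (hst : ScaffoldAdapted ξ Pr s j st) :
    MemLp (fun ω => (st ω).control) 2 Pr := by
  simp_rw [hst.control_eq]
  exact (memLp_finsetSum _ fun m _ => hst.memLp_clientControl m).const_smul _

/-- The local iterates of a round that starts with call `j`. -/
def localIterate (L : ℝ) (g : Fin M → V → Ξ → V) (ξ : ℕ → ℕ → Fin M → Ω → Ξ) (s j : ℕ)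
    (y : Ω → V) (p : ScaffoldParams) (st : Ω → ScaffoldState M V) (m : Fin M) (k : ℕ) (ω : Ω) :
    V :=
  scaffoldIterate p (fun k => subproblemOracle L g ξ s y ω (j + k)) (st ω) m k

/-- The noise in the local steps of a round that starts with call `j`. -/
def localNoise (F : Fin M → V → ℝ) (L : ℝ) (g : Fin M → V → Ξ → V) (ξ : ℕ → ℕ → Fin M → Ω → Ξ)
    (s j : ℕ) (y : Ω → V) (p : ScaffoldParams) (st : Ω → ScaffoldState M V) (m : Fin M) (k : ℕ)
    (ω : Ω) : V :=
  g m (localIterate L g ξ s j y p st m k ω) (ξ s (j + k) m ω)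
    - gradient (F m) (localIterate L g ξ s j y p st m k ω)

theorem scaffoldNoise_eq (m : Fin M) (k : ℕ) (ω : Ω) :
    scaffoldNoise (subproblemGradient F L (y ω)) p
      (fun k => subproblemOracle L g ξ s y ω (j + k)) (st ω) m k
      = localNoise F L g ξ s j y p st m k ω := by
  simp only [scaffoldNoise, subproblemOracle, subproblemGradient, localNoise, localIterate]
  abel

theorem localIterate_succ (m : Fin M) (k : ℕ) (ω : Ω) :
    localIterate L g ξ s j y p st m (k + 1) ω = localIterate L g ξ s j y p st m k ω
      - p.localStepSize • (g m (localIterate L g ξ s j y p st m k ω) (ξ s (j + k) m ω)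
        + (2 * L) • (localIterate L g ξ s j y p st m k ω - y ω)
        - (st ω).clientControl m + (st ω).control) := rfl

theorem measurable_localIterate (hg : IsStochasticOracle F P g σ)
    (hy : Measurable[sampleAlgebra ξ (pastSamples M s j)] y)
    (hst : ScaffoldAdapted ξ Pr s j st) (m : Fin M) (k : ℕ) :
    Measurable[sampleAlgebra ξ (pastSamples M s (j + k))] (localIterate L g ξ s j y p st m k) := by
  induction k with
  | zero => exact hst.measurable_server
  | succ k ih =>
    have hle : sampleAlgebra ξ (pastSamples M s j)
        ≤ sampleAlgebra ξ (pastSamples M s (j + (k + 1))) :=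
      sampleAlgebra_mono ξ (pastSamples_mono (by omega))
    have hv := ih.mono (sampleAlgebra_mono ξ (pastSamples_mono
      (show j + k ≤ j + (k + 1) by omega))) le_rfl
    have hξm : Measurable[sampleAlgebra ξ (pastSamples M s (j + (k + 1)))] (ξ s (j + k) m) :=
      measurable_sampleAlgebra ξ (Or.inr ⟨rfl, by simp⟩)
    exact hv.sub (((((hg.measurable m).comp (hv.prodMk hξm)).add
      ((hv.sub (hy.mono hle le_rfl)).const_smul _)).sub
      ((hst.measurable_clientControl m).mono hle le_rfl)).add
      (hst.measurable_control.mono hle le_rfl) |>.const_smul p.localStepSize)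

theorem measurable_localIterate_compl (hg : IsStochasticOracle F P g σ)
    (hy : Measurable[sampleAlgebra ξ (pastSamples M s j)] y)
    (hst : ScaffoldAdapted ξ Pr s j st) (m m' : Fin M) {k k' : ℕ} (hk : k ≤ k') :
    Measurable[sampleAlgebra ξ {(s, j + k', m')}ᶜ] (localIterate L g ξ s j y p st m k) :=
  (measurable_localIterate hg hy hst m k).mono
    (sampleAlgebra_mono ξ (pastSamples_subset_compl (by omega) m')) le_rfl

theorem memLp_localNoise (hg : IsStochasticOracle F P g σ) (hF : ∀ m, IsLSmooth L (F m))
    (hξ : AreFreshSamples P Pr ξ) (hy : Measurable[sampleAlgebra ξ (pastSamples M s j)] y)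
    (hst : ScaffoldAdapted ξ Pr s j st) (m : Fin M) (k : ℕ) :
    MemLp (localNoise F L g ξ s j y p st m k) 2 Pr :=
  hg.memLp_noise hF hξ (measurable_localIterate_compl hg hy hst m m le_rfl)

theorem integral_localNoise_sq_le (hg : IsStochasticOracle F P g σ) (hF : ∀ m, IsLSmooth L (F m))
    (hξ : AreFreshSamples P Pr ξ) (hy : Measurable[sampleAlgebra ξ (pastSamples M s j)] y)
    (hst : ScaffoldAdapted ξ Pr s j st) (m : Fin M) (k : ℕ) :
    ∫ ω, ‖localNoise F L g ξ s j y p st m k ω‖ ^ 2 ∂Pr ≤ σ ^ 2 :=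
  hg.integral_noise_sq_le hF hξ (measurable_localIterate_compl hg hy hst m m le_rfl)

theorem integral_inner_localNoise (hg : IsStochasticOracle F P g σ)
    (hF : ∀ m, IsLSmooth L (F m)) (hξ : AreFreshSamples P Pr ξ)
    (hy : Measurable[sampleAlgebra ξ (pastSamples M s j)] y) (hst : ScaffoldAdapted ξ Pr s j st)
    {Y : Ω → V} (hY : Measurable[sampleAlgebra ξ (pastSamples M s j)] Y) (hY2 : MemLp Y 2 Pr)
    (m : Fin M) (k : ℕ) :
    ∫ ω, inner ℝ (Y ω) (localNoise F L g ξ s j y p st m k ω) ∂Pr = 0 :=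
  hg.integral_inner_noise hF hξ (measurable_localIterate_compl hg hy hst m m le_rfl)
    (hY.mono (sampleAlgebra_mono ξ (pastSamples_subset_compl (by omega) m)) le_rfl) hY2

/-- Order the two calls by step. The noise of the earlier one depends only on samples before its
step and on its own sample, so not on the sample of the other call. For equal steps the clients
differ, and the local iterates use samples of earlier steps only. -/
theorem integral_inner_localNoise_localNoise (hg : IsStochasticOracle F P g σ)
    (hF : ∀ m, IsLSmooth L (F m)) (hξ : AreFreshSamples P Pr ξ)
    (hy : Measurable[sampleAlgebra ξ (pastSamples M s j)] y) (hst : ScaffoldAdapted ξ Pr s j st)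
    {m m' : Fin M} {k k' : ℕ} (h : (m, k) ≠ (m', k')) :
    ∫ ω, inner ℝ (localNoise F L g ξ s j y p st m k ω)
      (localNoise F L g ξ s j y p st m' k' ω) ∂Pr = 0 := by
  wlog hk : k ≤ k' generalizing m m' k k'
  · simp_rw [real_inner_comm (localNoise F L g ξ s j y p st m' k' _)]
    exact this h.symm (not_le.1 hk).le
  · refine hg.integral_inner_noise hF hξ (measurable_localIterate_compl hg hy hst m' m' le_rfl) ?_
      (memLp_localNoise hg hF hξ hy hst m k)
    have hv := measurable_localIterate_compl (L := L) (p := p) hg hy hst m m' hk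
    refine (hg.measurable_noise hF m).comp (hv.prodMk (measurable_sampleAlgebra ξ ?_))
    simp only [Set.mem_compl_iff, Set.mem_singleton_iff, Prod.mk.injEq, true_and, add_right_inj]
    rintro ⟨rfl, rfl⟩
    exact h rfl

theorem memLp_localIterate (hg : IsStochasticOracle F P g σ) (hF : ∀ m, IsLSmooth L (F m))
    (hξ : AreFreshSamples P Pr ξ) (hy : Measurable[sampleAlgebra ξ (pastSamples M s j)] y)
    (hy2 : MemLp y 2 Pr) (hst : ScaffoldAdapted ξ Pr s j st) (m : Fin M) (k : ℕ) :
    MemLp (localIterate L g ξ s j y p st m k) 2 Pr := by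
  induction k with
  | zero => exact hst.memLp_server
  | succ k ih =>
    -- The oracle output at a random point is split into noise and true gradient. The hypothesis of
    -- square integrability at deterministic points would not suffice here.
    have h : MemLp (fun ω => localIterate L g ξ s j y p st m k ω
      - p.localStepSize • ((localNoise F L g ξ s j y p st m k ω
        + gradient (F m) (localIterate L g ξ s j y p st m k ω))
        + (2 * L) • (localIterate L g ξ s j y p st m k ω - y ω)
        - (st ω).clientControl m + (st ω).control)) 2 Pr :=
      ih.sub ((((((memLp_localNoise hg hF hξ hy hst m k).add ((hF m).memLp_gradient_comp ih)).add
        ((ih.sub hy2).const_smul _)).sub (hst.memLp_clientControl m)).add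
        hst.memLp_control).const_smul _)
    convert h using 2 with ω
    rw [localIterate_succ, localNoise, sub_add_cancel]

/-- The random state after a round that starts with call `j`. -/
def roundState (L : ℝ) (g : Fin M → V → Ξ → V) (ξ : ℕ → ℕ → Fin M → Ω → Ξ) (s j : ℕ)
    (y : Ω → V) (p : ScaffoldParams) (st : Ω → ScaffoldState M V) (ω : Ω) : ScaffoldState M V :=
  scaffoldRound p (fun k => subproblemOracle L g ξ s y ω (j + k)) (st ω)

theorem ScaffoldAdapted.roundState (hg : IsStochasticOracle F P g σ)
    (hF : ∀ m, IsLSmooth L (F m)) (hξ : AreFreshSamples P Pr ξ)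
    (hy : Measurable[sampleAlgebra ξ (pastSamples M s j)] y) (hy2 : MemLp y 2 Pr)
    (hst : ScaffoldAdapted ξ Pr s j st) :
    ScaffoldAdapted ξ Pr s (j + p.localSteps) (roundState L g ξ s j y p st) := by
  have hle : sampleAlgebra ξ (pastSamples M s j)
      ≤ sampleAlgebra ξ (pastSamples M s (j + p.localSteps)) :=
    sampleAlgebra_mono ξ (pastSamples_mono (by omega))
  have hv := fun m => measurable_localIterate (L := L) (p := p) hg hy hst m p.localSteps
  have hv2 := fun m => memLp_localIterate (p := p) hg hF hξ hy hy2 hst m p.localSteps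
  have hx := hst.measurable_server.mono hle le_rfl
  have hc := hst.measurable_control.mono hle le_rfl
  have hcm := fun m => (hst.measurable_clientControl m).mono hle le_rfl
  constructor
  · exact hx.add (((Finset.measurable_sum _ fun m _ => (hv m).sub hx).const_smul
      (1 / (M : ℝ))).const_smul p.globalStepSize)
  · exact fun m => ((hcm m).sub hc).add ((hx.sub (hv m)).const_smul
      (1 / ((p.localSteps : ℝ) * p.localStepSize)))
  · exact hst.memLp_server.add (((memLp_finsetSum _ fun m _ =>
      (hv2 m).sub hst.memLp_server).const_smul (1 / (M : ℝ))).const_smul p.globalStepSize)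
  · exact fun m => ((hst.memLp_clientControl m).sub hst.memLp_control).add
      ((hst.memLp_server.sub (hv2 m)).const_smul (1 / ((p.localSteps : ℝ) * p.localStepSize)))
  · exact fun ω => scaffoldRound_control (hst.control_eq ω)

/-- The potential of the analysis of SCAFFOLD. -/
def scaffoldPotential (F : Fin M → V → ℝ) (L : ℝ) (K : ℕ) (y : V) (st : ScaffoldState M V) : ℝ :=
  ‖st.server - proxPoint (globalObjective F) L y‖ ^ 2 + 1 / (1000 * (M * K) * L ^ 2)
    * controlError (subproblemGradient F L y) (proxPoint (globalObjective F) L y) st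

theorem integrable_controlError (hL : 0 < L) (hM : 1 ≤ M) (hF : ∀ m, IsLSmooth L (F m))
    (hy2 : MemLp y 2 Pr) (hst : ScaffoldAdapted ξ Pr s j st) :
    Integrable (fun ω => controlError (subproblemGradient F L (y ω))
      (proxPoint (globalObjective F) L (y ω)) (st ω)) Pr := by
  have hp := (isLSmooth_globalObjective hM hF).memLp_proxPoint_comp hL hy2
  exact (integrable_finsetSum _ fun m _ => ((hst.memLp_clientControl m).sub
    (((hF m).memLp_gradient_comp hp).add
      ((hp.sub hy2).const_smul (2 * L)))).integrable_norm_sq).const_mul _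

theorem integrable_scaffoldPotential (hL : 0 < L) (hM : 1 ≤ M) (hF : ∀ m, IsLSmooth L (F m))
    (hy2 : MemLp y 2 Pr) (hst : ScaffoldAdapted ξ Pr s j st) (K : ℕ) :
    Integrable (fun ω => scaffoldPotential F L K (y ω) (st ω)) Pr :=
  (hst.memLp_server.sub ((isLSmooth_globalObjective hM hF).memLp_proxPoint_comp hL
    hy2)).integrable_norm_sq.add ((integrable_controlError hL hM hF hy2 hst).const_mul _)

theorem avg_subproblemGradient (hM : 1 ≤ M) (hF : ∀ m, IsLSmooth L (F m)) (y x : V) :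
    (1 / (M : ℝ)) • ∑ m, subproblemGradient F L y m x
      = gradient (globalObjective F) x + (2 * L) • (x - y) := by
  have hM' : (M : ℝ) ≠ 0 := by positivity
  simp_rw [subproblemGradient, Finset.sum_add_distrib, Finset.sum_const, Finset.card_univ,
    Fintype.card_fin, smul_add, ← Nat.cast_smul_eq_nsmul ℝ]
  rw [gradient_globalObjective fun m => (hF m).1, smul_smul (1 / (M : ℝ)) (M : ℝ),
    one_div_mul_cancel hM', one_smul]

/-- One round of SCAFFOLD contracts the expected potential, up to noise. -/
theorem integral_scaffoldPotential_roundState_le {T K : ℕ} (hL : 0 < L) (hM : 1 ≤ M) (hT : 1 ≤ T)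
    (hK : 1 ≤ K) (hg : IsStochasticOracle F P g σ) (hF : ∀ m, IsLSmooth L (F m))
    (hξ : AreFreshSamples P Pr ξ) (hy : Measurable[sampleAlgebra ξ (pastSamples M s j)] y)
    (hy2 : MemLp y 2 Pr) (hst : ScaffoldAdapted ξ Pr s j st) :
    ∫ ω, scaffoldPotential F L K (y ω)
        (roundState L g ξ s j y (scaffoldParams L M T K) st ω) ∂Pr
      ≤ 23 / 24 * ∫ ω, scaffoldPotential F L K (y ω) (st ω) ∂Pr
        + 1 / 50 * (σ ^ 2 / (L ^ 2 * (M * K))) := by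
  set p := scaffoldParams L M T K with hpd
  have hM0 : (0 : ℝ) < M := by exact_mod_cast hM
  have hK0 : (0 : ℝ) < K := by exact_mod_cast hK
  have hf := isLSmooth_globalObjective hM hF
  set f := globalObjective F with hfd
  set n := localNoise F L g ξ s j y p st with hn
  have hn2 : ∀ m k, MemLp (n m k) 2 Pr := memLp_localNoise hg hF hξ hy hst
  have hp2 := hf.memLp_proxPoint_comp hL hy2
  have hpm : Measurable[sampleAlgebra ξ (pastSamples M s j)] fun ω => proxPoint f L (y ω) :=
    (hf.continuous_proxPoint hL).measurable.comp hy
  set h : Ω → V := fun ω => (st ω).server - proxPoint f L (y ω) - (1 / (9 * L)) •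
    (gradient f (st ω).server + (2 * L) • ((st ω).server - y ω)) with hh
  have hhm : Measurable[sampleAlgebra ξ (pastSamples M s j)] h :=
    (hst.measurable_server.sub hpm).sub (((hf.continuous_gradient.measurable.comp
      hst.measurable_server).add ((hst.measurable_server.sub hy).const_smul _)).const_smul _)
  have hh2 : MemLp h 2 Pr :=
    (hst.memLp_server.sub hp2).sub (((hf.memLp_gradient_comp hst.memLp_server).add
      ((hst.memLp_server.sub hy2).const_smul _)).const_smul _)
  have hA : Integrable (fun ω => ‖(st ω).server - proxPoint f L (y ω)‖ ^ 2) Pr :=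
    (hst.memLp_server.sub hp2).integrable_norm_sq
  set w := 1 / (1000 * (M * K) * L ^ 2) with hw
  have hb := (integrable_controlError hL hM hF hy2 hst).const_mul w
  set S : Ω → V := fun ω => ∑ i ∈ Finset.univ ×ˢ Finset.range K, n i.1 i.2 ω with hS
  have hS2 : MemLp S 2 Pr := memLp_finsetSum _ fun i _ => hn2 i.1 i.2
  have hsub : Integrable (fun ω => ‖h ω - (1 / (9 * L * (M * K))) • S ω‖ ^ 2) Pr :=
    (hh2.sub (hS2.const_smul _)).integrable_norm_sq
  set N : Ω → ℝ := fun ω => ∑ i ∈ Finset.univ ×ˢ Finset.range K, ‖n i.1 i.2 ω‖ ^ 2 with hN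
  have hNi : Integrable N Pr := integrable_finsetSum _ fun i _ => (hn2 i.1 i.2).integrable_norm_sq
  have hpath : ∀ ω, scaffoldPotential F L K (y ω) (roundState L g ξ s j y p st ω)
      ≤ 33 / 32 * ‖h ω - (1 / (9 * L * (M * K))) • S ω‖ ^ 2
        + 1 / 30 * ‖(st ω).server - proxPoint f L (y ω)‖ ^ 2
        + 23 / 24 * (w * controlError (subproblemGradient F L (y ω))
            (proxPoint (globalObjective F) L (y ω)) (st ω))
        + 1 / (250 * L ^ 2 * (M * K)) * (1 / (M * K : ℝ) * N ω) := by
    intro ω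
    have h1 := scaffoldRound_potential_le (p := p) (r := proxPoint f L (y ω))
      (G := fun k => subproblemOracle L g ξ s y ω (j + k)) (st := st ω) hL hM hT hK
      (φ := subproblemGradient F L (y ω))
      (fun m x z => (hF m).norm_prox_gradient_sub_le hL (y ω) x z)
      (by
        have h2 := avg_subproblemGradient hM hF (y ω) (proxPoint f L (y ω))
        rw [hf.proxPoint_spec hL] at h2
        exact (smul_eq_zero.1 h2).resolve_left (by positivity))
      hpd (hst.control_eq ω)
    rw [avg_subproblemGradient hM hF] at h1
    simp_rw [scaffoldNoise_eq] at h1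
    simp only [hS, hN, Finset.sum_product]
    exact h1
  have hSint : ∫ ω, ‖h ω - (1 / (9 * L * (M * K))) • S ω‖ ^ 2 ∂Pr
      ≤ 8 / 9 * ∫ ω, ‖(st ω).server - proxPoint f L (y ω)‖ ^ 2 ∂Pr
        + 1 / 81 * (σ ^ 2 / (L ^ 2 * (M * K))) := by
    rw [integral_norm_sub_smul_sum_sq _ _ hh2 (fun i _ => hn2 i.1 i.2)
      (fun i _ => integral_inner_localNoise hg hF hξ hy hst hhm hh2 i.1 i.2)
      (fun i _ i' _ hii' => integral_inner_localNoise_localNoise hg hF hξ hy hst hii')]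
    have h1 : ∫ ω, ‖h ω‖ ^ 2 ∂Pr
        ≤ ∫ ω, 8 / 9 * ‖(st ω).server - proxPoint f L (y ω)‖ ^ 2 ∂Pr :=
      integral_mono hh2.integrable_norm_sq (hA.const_mul _)
        fun ω => hf.norm_prox_gradient_step_sq_le hL (y ω) (st ω).server
    rw [integral_const_mul] at h1
    have h2 : ∑ i ∈ Finset.univ ×ˢ Finset.range K, ∫ ω, ‖n i.1 i.2 ω‖ ^ 2 ∂Pr
        ≤ ∑ _i ∈ (Finset.univ : Finset (Fin M)) ×ˢ Finset.range K, σ ^ 2 :=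
      Finset.sum_le_sum fun i _ => integral_localNoise_sq_le hg hF hξ hy hst i.1 i.2
    rw [Finset.sum_const, Finset.card_product, Finset.card_univ, Fintype.card_fin,
      Finset.card_range, nsmul_eq_mul, Nat.cast_mul] at h2
    have h3 : (1 / (9 * L * (M * K))) ^ 2 * ∑ i ∈ Finset.univ ×ˢ Finset.range K,
        ∫ ω, ‖n i.1 i.2 ω‖ ^ 2 ∂Pr ≤ (1 / (9 * L * (M * K))) ^ 2 * (M * K * σ ^ 2) := by gcongr
    have h4 : (1 / (9 * L * (M * K))) ^ 2 * (M * K * σ ^ 2)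
        = 1 / 81 * (σ ^ 2 / (L ^ 2 * (M * K))) := by field_simp; ring
    linarith
  have hNint : ∫ ω, N ω ∂Pr ≤ M * K * σ ^ 2 := by
    rw [integral_finsetSum _ fun i _ => (hn2 i.1 i.2).integrable_norm_sq]
    refine (Finset.sum_le_sum fun i _ =>
      integral_localNoise_sq_le hg hF hξ hy hst i.1 i.2).trans (le_of_eq ?_)
    rw [Finset.sum_const, Finset.card_product, Finset.card_univ, Fintype.card_fin,
      Finset.card_range, nsmul_eq_mul, Nat.cast_mul]
  have hmono := integral_mono
    (integrable_scaffoldPotential hL hM hF hy2 (hst.roundState (p := p) hg hF hξ hy hy2) K)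
    ((((hsub.const_mul (33 / 32)).add (hA.const_mul (1 / 30))).add
      (hb.const_mul (23 / 24))).add
      ((hNi.const_mul (1 / (M * K : ℝ))).const_mul (1 / (250 * L ^ 2 * (M * K))))) hpath
  refine hmono.trans ?_
  have e1 : ∫ ω, scaffoldPotential F L K (y ω) (st ω) ∂Pr
      = ∫ ω, ‖(st ω).server - proxPoint f L (y ω)‖ ^ 2 ∂Pr
        + ∫ ω, w * controlError (subproblemGradient F L (y ω))
            (proxPoint (globalObjective F) L (y ω)) (st ω) ∂Pr := integral_add hA hb
  have hN' : 1 / (250 * L ^ 2 * (M * K)) * (1 / (M * K : ℝ) * ∫ ω, N ω ∂Pr)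
      ≤ 1 / (250 * L ^ 2 * (M * K)) * (1 / (M * K : ℝ) * (M * K * σ ^ 2)) := by gcongr
  have hN'' : 1 / (250 * L ^ 2 * (M * K)) * (1 / (M * K : ℝ) * (M * K * σ ^ 2))
      = 1 / 250 * (σ ^ 2 / (L ^ 2 * (M * K))) := by field_simp
  have hA0 : 0 ≤ ∫ ω, ‖(st ω).server - proxPoint f L (y ω)‖ ^ 2 ∂Pr :=
    integral_nonneg fun ω => sq_nonneg _
  have hσ0 : 0 ≤ σ ^ 2 / (L ^ 2 * (M * K)) := by positivity
  rw [integral_add' (((hsub.const_mul (33 / 32)).add (hA.const_mul (1 / 30))).add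
      (hb.const_mul (23 / 24)))
      ((hNi.const_mul (1 / (M * K : ℝ))).const_mul (1 / (250 * L ^ 2 * (M * K)))),
    integral_add' ((hsub.const_mul (33 / 32)).add (hA.const_mul (1 / 30)))
      (hb.const_mul (23 / 24)),
    integral_add' (hsub.const_mul (33 / 32)) (hA.const_mul (1 / 30)), e1]
  -- The constants fit because `33/32 · 8/9 + 1/30 ≤ 23/24` and `33/32 · 1/81 + 1/250 ≤ 1/50`.
  simp only [integral_const_mul]
  linarith

end Expectation

/-! ### Accuracy of a full SCAFFOLD run on one subproblem -/

section Solver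

variable {Ω Ξ V : Type*} [MeasurableSpace Ω] [MeasurableSpace Ξ] {M : ℕ}
  {P : Fin M → Measure Ξ} {Pr : Measure Ω} {ξ : ℕ → ℕ → Fin M → Ω → Ξ}
  [NormedAddCommGroup V] [InnerProductSpace ℝ V] [CompleteSpace V]
  [SecondCountableTopology V] [MeasurableSpace V] [BorelSpace V] [IsProbabilityMeasure Pr]
  {F : Fin M → V → ℝ} {g : Fin M → V → Ξ → V} {L σ : ℝ} {s : ℕ} {y z : Ω → V}
  {p : ScaffoldParams}

/-- The random state of SCAFFOLD after `t` rounds on subproblem `s`. -/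
def solverState (L : ℝ) (g : Fin M → V → Ξ → V) (ξ : ℕ → ℕ → Fin M → Ω → Ξ) (s : ℕ) (y z : Ω → V)
    (p : ScaffoldParams) (t : ℕ) (ω : Ω) : ScaffoldState M V :=
  scaffoldState p (subproblemOracle L g ξ s y ω) (z ω) t

theorem solverState_succ (t : ℕ) : solverState L g ξ s y z p (t + 1)
    = roundState L g ξ s (1 + t * p.localSteps) y p (solverState L g ξ s y z p t) := rfl

theorem scaffoldAdapted_solverState_zero (hg : IsStochasticOracle F P g σ)
    (hF : ∀ m, IsLSmooth L (F m)) (hξ : AreFreshSamples P Pr ξ)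
    (hy : Measurable[sampleAlgebra ξ (pastSamples M s 0)] y) (hy2 : MemLp y 2 Pr)
    (hz : Measurable[sampleAlgebra ξ (pastSamples M s 0)] z) (hz2 : MemLp z 2 Pr) :
    ScaffoldAdapted ξ Pr s 1 (solverState L g ξ s y z p 0) := by
  have hle := sampleAlgebra_mono ξ (pastSamples_mono (M := M) (s := s) zero_le_one)
  have hz' := hz.mono hle le_rfl
  constructor
  · exact hz'
  · exact fun m => ((hg.measurable m).comp (hz'.prodMk (measurable_sampleAlgebra ξ
      (Or.inr ⟨rfl, zero_lt_one⟩)))).add ((hz'.sub (hy.mono hle le_rfl)).const_smul (2 * L))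
  · exact hz2
  · intro m
    have h := (hg.memLp_noise hF hξ (s := s) (j := 0) (m := m) (hz.mono (sampleAlgebra_mono ξ
      (pastSamples_subset_compl le_rfl m)) le_rfl)).add ((hF m).memLp_gradient_comp hz2)
    refine ((memLp_congr_ae (Filter.Eventually.of_forall fun ω => ?_)).1 h).add
      ((hz2.sub hy2).const_smul (2 * L))
    simp
  · exact fun ω => rfl

theorem scaffoldAdapted_solverState (hg : IsStochasticOracle F P g σ)
    (hF : ∀ m, IsLSmooth L (F m)) (hξ : AreFreshSamples P Pr ξ)
    (hy : Measurable[sampleAlgebra ξ (pastSamples M s 0)] y) (hy2 : MemLp y 2 Pr)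
    (hz : Measurable[sampleAlgebra ξ (pastSamples M s 0)] z) (hz2 : MemLp z 2 Pr) (t : ℕ) :
    ScaffoldAdapted ξ Pr s (1 + t * p.localSteps) (solverState L g ξ s y z p t) := by
  induction t with
  | zero => simpa using scaffoldAdapted_solverState_zero hg hF hξ hy hy2 hz hz2
  | succ t ih =>
    rw [solverState_succ, show 1 + (t + 1) * p.localSteps = 1 + t * p.localSteps + p.localSteps
      by ring]
    exact ih.roundState hg hF hξ (hy.mono (sampleAlgebra_mono ξ (pastSamples_mono (Nat.zero_le _)))
      le_rfl) hy2

/-- The initial control variates are gradients at `z` with one noise each. Their error is small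
after weighting: `18/1000` of the squared distance, which the factor `2` covers, and twice the noise
over `1000`. -/
theorem integral_scaffoldPotential_zero_le {K : ℕ} (hL : 0 < L) (hM : 1 ≤ M) (hK : 1 ≤ K)
    (hg : IsStochasticOracle F P g σ) (hF : ∀ m, IsLSmooth L (F m)) (hξ : AreFreshSamples P Pr ξ)
    (hy : Measurable[sampleAlgebra ξ (pastSamples M s 0)] y) (hy2 : MemLp y 2 Pr)
    (hz : Measurable[sampleAlgebra ξ (pastSamples M s 0)] z) (hz2 : MemLp z 2 Pr) :
    ∫ ω, scaffoldPotential F L K (y ω) (solverState L g ξ s y z p 0 ω) ∂Pr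
      ≤ 2 * ∫ ω, ‖z ω - proxPoint (globalObjective F) L (y ω)‖ ^ 2 ∂Pr
        + 1 / 500 * (σ ^ 2 / (L ^ 2 * (M * K))) := by
  have hM0 : (0 : ℝ) < M := by exact_mod_cast hM
  have hK0 : (0 : ℝ) < K := by exact_mod_cast hK
  have hθ : (1 : ℝ) ≤ M * K := by exact_mod_cast Nat.mul_le_mul hM hK
  have hf := isLSmooth_globalObjective hM hF
  set r : Ω → V := fun ω => proxPoint (globalObjective F) L (y ω) with hr
  have hA : Integrable (fun ω => ‖z ω - r ω‖ ^ 2) Pr :=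
    (hz2.sub (hf.memLp_proxPoint_comp hL hy2)).integrable_norm_sq
  have hzc := fun m => hz.mono (sampleAlgebra_mono ξ
    (pastSamples_subset_compl (M := M) (s := s) (le_refl 0) m)) le_rfl
  set n : Fin M → Ω → V := fun m ω => g m (z ω) (ξ s 0 m ω) - gradient (F m) (z ω) with hn
  have hni : ∀ m, Integrable (fun ω => ‖n m ω‖ ^ 2) Pr :=
    fun m => (hg.memLp_noise hF hξ (hzc m)).integrable_norm_sq
  have hpath : ∀ ω, scaffoldPotential F L K (y ω) (solverState L g ξ s y z p 0 ω)
      ≤ 2 * ‖z ω - r ω‖ ^ 2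
        + 1 / (1000 * (M * K) * L ^ 2) * (1 / (M : ℝ) * (2 * ∑ m, ‖n m ω‖ ^ 2)) := by
    intro ω
    have h1 : ∀ m, ‖subproblemOracle L g ξ s y ω 0 m (z ω)
        - subproblemGradient F L (y ω) m (r ω)‖ ^ 2
        ≤ 2 * ‖n m ω‖ ^ 2 + 18 * L ^ 2 * ‖z ω - r ω‖ ^ 2 := by
      intro m
      rw [show subproblemOracle L g ξ s y ω 0 m (z ω) - subproblemGradient F L (y ω) m (r ω)
        = n m ω - (subproblemGradient F L (y ω) m (r ω) - subproblemGradient F L (y ω) m (z ω)) by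
          simp only [subproblemOracle, subproblemGradient, hn]; abel]
      refine (norm_sub_sq_le_young _ _ zero_lt_one).trans ?_
      have h2 := (hF m).norm_prox_gradient_sub_le hL (y ω) (r ω) (z ω)
      rw [norm_sub_rev (r ω)] at h2
      have h3 := pow_le_pow_left₀ (norm_nonneg _) h2 2
      simp only [subproblemGradient]
      linarith
    have h2 : controlError (subproblemGradient F L (y ω)) (r ω) (solverState L g ξ s y z p 0 ω)
        ≤ 1 / (M : ℝ) * (2 * ∑ m, ‖n m ω‖ ^ 2) + 18 * L ^ 2 * ‖z ω - r ω‖ ^ 2 := by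
      calc _ ≤ 1 / (M : ℝ) * ∑ m, (2 * ‖n m ω‖ ^ 2 + 18 * L ^ 2 * ‖z ω - r ω‖ ^ 2) := by
            rw [controlError]
            gcongr with m
            exact h1 m
        _ = _ := by
          rw [Finset.sum_add_distrib, ← Finset.mul_sum, Finset.sum_const, Finset.card_univ,
            Fintype.card_fin, nsmul_eq_mul]
          field_simp
    have h3 : 1 / (1000 * (M * K) * L ^ 2) * (18 * L ^ 2 * ‖z ω - r ω‖ ^ 2)
        ≤ 18 / 1000 * ‖z ω - r ω‖ ^ 2 := by
      have h4 : 1 / (M * K : ℝ) ≤ 1 := by rw [div_le_one (by linarith)]; exact hθ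
      calc _ = 18 / 1000 * (‖z ω - r ω‖ ^ 2 * (1 / (M * K : ℝ))) := by field_simp
        _ ≤ 18 / 1000 * (‖z ω - r ω‖ ^ 2 * 1) := by gcongr
        _ = _ := by ring
    have h5 : scaffoldPotential F L K (y ω) (solverState L g ξ s y z p 0 ω)
        = ‖z ω - r ω‖ ^ 2 + 1 / (1000 * (M * K) * L ^ 2) *
          controlError (subproblemGradient F L (y ω)) (r ω) (solverState L g ξ s y z p 0 ω) := rfl
    have h6 := mul_le_mul_of_nonneg_left h2
      (show 0 ≤ 1 / (1000 * (M * K) * L ^ 2) by positivity)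
    rw [h5]
    linarith [sq_nonneg ‖z ω - r ω‖]
  have hNi : Integrable (fun ω => ∑ m, ‖n m ω‖ ^ 2) Pr := integrable_finsetSum _ fun m _ => hni m
  have hN : ∫ ω, ∑ m, ‖n m ω‖ ^ 2 ∂Pr ≤ M * σ ^ 2 := by
    rw [integral_finsetSum _ fun m _ => hni m]
    refine (Finset.sum_le_sum fun m _ => hg.integral_noise_sq_le hF hξ (hzc m)).trans ?_
    simp
  refine (integral_mono (integrable_scaffoldPotential hL hM hF hy2
    (scaffoldAdapted_solverState_zero hg hF hξ hy hy2 hz hz2) K)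
    ((hA.const_mul 2).add (((hNi.const_mul 2).const_mul (1 / (M : ℝ))).const_mul
      (1 / (1000 * (M * K) * L ^ 2)))) hpath).trans ?_
  rw [integral_add' (hA.const_mul 2) (((hNi.const_mul 2).const_mul (1 / (M : ℝ))).const_mul
      (1 / (1000 * (M * K) * L ^ 2)))]
  simp only [integral_const_mul]
  have h7 : 1 / (1000 * (M * K) * L ^ 2) * (1 / (M : ℝ) * (2 * ∫ ω, ∑ m, ‖n m ω‖ ^ 2 ∂Pr))
      ≤ 1 / (1000 * (M * K) * L ^ 2) * (1 / (M : ℝ) * (2 * (M * σ ^ 2))) := by gcongr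
  have h8 : 1 / (1000 * (M * K) * L ^ 2) * (1 / (M : ℝ) * (2 * (M * σ ^ 2)))
      = 1 / 500 * (σ ^ 2 / (L ^ 2 * (M * K))) := by field_simp; ring
  linarith

theorem scaffold_scaffoldParams {T K : ℕ} (G : ℕ → Fin M → V → V) (x₀ : V) :
    scaffold (scaffoldParams L M T K) G x₀
      = (scaffoldState (scaffoldParams L M T K) G x₀ T).server := by
  simp [scaffold, scaffoldParams, Finset.sum_ite_eq', ite_smul]

/-- The accuracy of SCAFFOLD on a Catalyst subproblem. -/
theorem integral_norm_solverState_sq_le {T K : ℕ} (hL : 0 < L) (hM : 1 ≤ M) (hT : 1 ≤ T)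
    (hK : 1 ≤ K) (hg : IsStochasticOracle F P g σ) (hF : ∀ m, IsLSmooth L (F m))
    (hξ : AreFreshSamples P Pr ξ)
    (hy : Measurable[sampleAlgebra ξ (pastSamples M s 0)] y) (hy2 : MemLp y 2 Pr)
    (hz : Measurable[sampleAlgebra ξ (pastSamples M s 0)] z) (hz2 : MemLp z 2 Pr) :
    ∫ ω, ‖(solverState L g ξ s y z (scaffoldParams L M T K) T ω).server
        - proxPoint (globalObjective F) L (y ω)‖ ^ 2 ∂Pr
      ≤ 2 * (23 / 24) ^ T * ∫ ω, ‖z ω - proxPoint (globalObjective F) L (y ω)‖ ^ 2 ∂Pr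
        + σ ^ 2 / (L ^ 2 * (M * K)) := by
  have hσ0 : 0 ≤ σ ^ 2 / (L ^ 2 * (M * K)) := by positivity
  set R := ∫ ω, ‖z ω - proxPoint (globalObjective F) L (y ω)‖ ^ 2 ∂Pr with hR
  have hst := scaffoldAdapted_solverState (p := scaffoldParams L M T K) hg hF hξ hy hy2 hz hz2
  -- The unrolled recursion: the noise saturates at `(1/50) / (1 - 23/24) = 24/50`.
  have hΦ : ∀ t, ∫ ω, scaffoldPotential F L K (y ω)
      (solverState L g ξ s y z (scaffoldParams L M T K) t ω) ∂Pr
      ≤ (23 / 24) ^ t * (2 * R + 1 / 500 * (σ ^ 2 / (L ^ 2 * (M * K))))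
        + 24 / 50 * (1 - (23 / 24) ^ t) * (σ ^ 2 / (L ^ 2 * (M * K))) := by
    intro t
    induction t with
    | zero =>
      simpa using integral_scaffoldPotential_zero_le (p := scaffoldParams L M T K)
        hL hM hK hg hF hξ hy hy2 hz hz2
    | succ t ih =>
      have h := integral_scaffoldPotential_roundState_le hL hM hT hK hg hF hξ
        (hy.mono (sampleAlgebra_mono ξ (pastSamples_mono (Nat.zero_le _))) le_rfl) hy2 (hst t)
      rw [solverState_succ]
      refine h.trans ((add_le_add_left (mul_le_mul_of_nonneg_left ih (by norm_num)) _).trans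
        (le_of_eq ?_))
      ring
  have h1 : ∫ ω, ‖(solverState L g ξ s y z (scaffoldParams L M T K) T ω).server
        - proxPoint (globalObjective F) L (y ω)‖ ^ 2 ∂Pr
      ≤ ∫ ω, scaffoldPotential F L K (y ω)
        (solverState L g ξ s y z (scaffoldParams L M T K) T ω) ∂Pr := by
    refine integral_mono ((hst T).memLp_server.sub
      ((isLSmooth_globalObjective hM hF).memLp_proxPoint_comp hL hy2)).integrable_norm_sq
      (integrable_scaffoldPotential hL hM hF hy2 (hst T) K) fun ω => ?_
    simp only [scaffoldPotential, controlError]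
    exact le_add_of_nonneg_right (by positivity)
  refine (h1.trans (hΦ T)).trans ?_
  have h2 : (0 : ℝ) ≤ (23 / 24) ^ T := by positivity
  have h3 : ((23 : ℝ) / 24) ^ T ≤ 1 := pow_le_one₀ (by norm_num) (by norm_num)
  nlinarith [mul_nonneg h2 hσ0, mul_le_mul_of_nonneg_right h3 hσ0]

end Solver

/-! ### Catalyst with SCAFFOLD -/

section CatalystScaffold

variable {Ω Ξ V : Type*} [MeasurableSpace Ω] [MeasurableSpace Ξ] {M : ℕ}
  {P : Fin M → Measure Ξ} {Pr : Measure Ω} {ξ : ℕ → ℕ → Fin M → Ω → Ξ}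
  [NormedAddCommGroup V] [InnerProductSpace ℝ V] [CompleteSpace V]
  [SecondCountableTopology V] [MeasurableSpace V] [BorelSpace V] [IsProbabilityMeasure Pr]
  {F : Fin M → V → ℝ} {g : Fin M → V → Ξ → V} {L σ θ : ℝ} {β : ℕ → ℝ} {x₀ : V}
  {prm : ℕ → ScaffoldParams} {T K : ℕ → ℕ}

/-- A random Catalyst state that depends on the samples before subproblem `s` only. -/
structure CatalystAdapted (ξ : ℕ → ℕ → Fin M → Ω → Ξ) (Pr : Measure Ω) (s : ℕ)
    (st : Ω → CatalystState V) : Prop where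
  measurable_iterate : Measurable[sampleAlgebra ξ (pastSamples M s 0)] fun ω => (st ω).iterate
  measurable_nextCenter :
    Measurable[sampleAlgebra ξ (pastSamples M s 0)] fun ω => (st ω).nextCenter
  measurable_center : Measurable[sampleAlgebra ξ (pastSamples M s 0)] fun ω => (st ω).center
  memLp_iterate : MemLp (fun ω => (st ω).iterate) 2 Pr
  memLp_nextCenter : MemLp (fun ω => (st ω).nextCenter) 2 Pr
  memLp_center : MemLp (fun ω => (st ω).center) 2 Pr

theorem catalystScaffold_succ_iterate (hprm : ∀ s, prm s = scaffoldParams L M (T s) (K s)) (s : ℕ)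
    (ω : Ω) : (catalystScaffold L g ξ prm θ β x₀ (s + 1) ω).iterate
      = (solverState L g ξ (s + 1) (fun ω => (catalystScaffold L g ξ prm θ β x₀ s ω).nextCenter)
          (fun ω => (catalystScaffold L g ξ prm θ β x₀ s ω).iterate
            + θ • ((catalystScaffold L g ξ prm θ β x₀ s ω).nextCenter
              - (catalystScaffold L g ξ prm θ β x₀ s ω).center))
          (scaffoldParams L M (T (s + 1)) (K (s + 1))) (T (s + 1)) ω).server := by
  rw [solverState, ← scaffold_scaffoldParams, ← hprm]
  rfl

theorem catalystScaffold_succ_nextCenter (s : ℕ) (ω : Ω) :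
    (catalystScaffold L g ξ prm θ β x₀ (s + 1) ω).nextCenter
      = (catalystScaffold L g ξ prm θ β x₀ (s + 1) ω).iterate
        + β (s + 1) • ((catalystScaffold L g ξ prm θ β x₀ (s + 1) ω).iterate
          - (catalystScaffold L g ξ prm θ β x₀ s ω).iterate) := rfl

theorem catalystScaffold_succ_center (s : ℕ) (ω : Ω) :
    (catalystScaffold L g ξ prm θ β x₀ (s + 1) ω).center
      = (catalystScaffold L g ξ prm θ β x₀ s ω).nextCenter := rfl

/-- After `s` iterations the samples of the subproblems up to `s` have been used, hence the index `s
+ 1`. The starting point and centre of the next subproblem are then independent of its samples. -/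
theorem catalystAdapted_catalystScaffold (hprm : ∀ s, prm s = scaffoldParams L M (T s) (K s))
    (hg : IsStochasticOracle F P g σ) (hF : ∀ m, IsLSmooth L (F m))
    (hξ : AreFreshSamples P Pr ξ) (s : ℕ) :
    CatalystAdapted ξ Pr (s + 1) (catalystScaffold L g ξ prm θ β x₀ s) := by
  induction s with
  | zero =>
    exact ⟨measurable_const, measurable_const, measurable_const, memLp_const _, memLp_const _,
      memLp_const _⟩
  | succ s ih =>
    have hle : sampleAlgebra ξ (pastSamples M (s + 1) 0)
        ≤ sampleAlgebra ξ (pastSamples M (s + 1 + 1) 0) := by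
      refine sampleAlgebra_mono ξ ?_
      rintro i (hi | hi)
      · exact Or.inl (by omega)
      · exact absurd hi.2 (Nat.not_lt_zero _)
    have hsub : pastSamples M (s + 1) (1 + T (s + 1) * K (s + 1))
        ⊆ pastSamples M (s + 1 + 1) 0 := by
      rintro i (hi | hi) <;> exact Or.inl (by omega)
    have hst := scaffoldAdapted_solverState (p := scaffoldParams L M (T (s + 1)) (K (s + 1)))
      hg hF hξ ih.measurable_nextCenter ih.memLp_nextCenter (ih.measurable_iterate.add
        ((ih.measurable_nextCenter.sub ih.measurable_center).const_smul θ))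
      (ih.memLp_iterate.add ((ih.memLp_nextCenter.sub ih.memLp_center).const_smul θ))
      (T (s + 1))
    have h1 : Measurable[sampleAlgebra ξ (pastSamples M (s + 1 + 1) 0)]
        fun ω => (catalystScaffold L g ξ prm θ β x₀ (s + 1) ω).iterate := by
      simp_rw [catalystScaffold_succ_iterate hprm]
      exact hst.measurable_server.mono (sampleAlgebra_mono ξ hsub) le_rfl
    have h2 : MemLp (fun ω => (catalystScaffold L g ξ prm θ β x₀ (s + 1) ω).iterate) 2 Pr := by
      simp_rw [catalystScaffold_succ_iterate hprm]
      exact hst.memLp_server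
    exact ⟨h1, h1.add ((h1.sub (ih.measurable_iterate.mono hle le_rfl)).const_smul _),
      ih.measurable_nextCenter.mono hle le_rfl, h2,
      h2.add ((h2.sub ih.memLp_iterate).const_smul _), ih.memLp_nextCenter⟩

/-- An iteration of Catalyst with SCAFFOLD reaches its accuracy if the subproblem solver takes
enough rounds for its starting point and enough local steps for the noise. -/
theorem integral_norm_iterate_sub_proxPoint_sq_le
    (hprm : ∀ s, prm s = scaffoldParams L M (T s) (K s)) (hT : ∀ s, 1 ≤ T s) (hK : ∀ s, 1 ≤ K s)
    (hL : 0 < L) (hM : 1 ≤ M) (hg : IsStochasticOracle F P g σ)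
    (hF : ∀ m, IsLSmooth L (F m)) (hξ : AreFreshSamples P Pr ξ) {s : ℕ} {R tol : ℝ}
    (htol : 0 < tol)
    (hR : ∫ ω, ‖(catalystScaffold L g ξ prm θ β x₀ s ω).iterate
      + θ • ((catalystScaffold L g ξ prm θ β x₀ s ω).nextCenter
        - (catalystScaffold L g ξ prm θ β x₀ s ω).center)
      - proxPoint (globalObjective F) L
        (catalystScaffold L g ξ prm θ β x₀ s ω).nextCenter‖ ^ 2 ∂Pr ≤ R)
    (hTR : 2 * (23 / 24) ^ T (s + 1) * R ≤ tol / (3 * L))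
    (hKσ : 3 * σ ^ 2 / (L * M * tol) ≤ K (s + 1)) :
    ∫ ω, ‖(catalystScaffold L g ξ prm θ β x₀ (s + 1) ω).iterate
      - proxPoint (globalObjective F) L
        (catalystScaffold L g ξ prm θ β x₀ (s + 1) ω).center‖ ^ 2 ∂Pr ≤ 2 * tol / (3 * L) := by
  have hM0 : (0 : ℝ) < M := by exact_mod_cast hM
  have hK0 : (0 : ℝ) < K (s + 1) := by exact_mod_cast hK (s + 1)
  have ih := catalystAdapted_catalystScaffold (θ := θ) (β := β) (x₀ := x₀) hprm hg hF hξ s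
  have h := integral_norm_solverState_sq_le hL hM (hT (s + 1)) (hK (s + 1)) hg hF hξ
    ih.measurable_nextCenter ih.memLp_nextCenter (ih.measurable_iterate.add
      ((ih.measurable_nextCenter.sub ih.measurable_center).const_smul θ))
    (ih.memLp_iterate.add ((ih.memLp_nextCenter.sub ih.memLp_center).const_smul θ))
  simp_rw [catalystScaffold_succ_iterate hprm, catalystScaffold_succ_center]
  refine h.trans ?_
  have h1 : 2 * (23 / 24) ^ T (s + 1) * ∫ ω, ‖(catalystScaffold L g ξ prm θ β x₀ s ω).iterate
      + θ • ((catalystScaffold L g ξ prm θ β x₀ s ω).nextCenter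
        - (catalystScaffold L g ξ prm θ β x₀ s ω).center)
      - proxPoint (globalObjective F) L
        (catalystScaffold L g ξ prm θ β x₀ s ω).nextCenter‖ ^ 2 ∂Pr
      ≤ 2 * (23 / 24) ^ T (s + 1) * R := by gcongr
  have h2 : σ ^ 2 / (L ^ 2 * (M * K (s + 1))) ≤ tol / (3 * L) := by
    rw [div_le_iff₀ (by positivity)] at hKσ
    rw [div_le_div_iff₀ (by positivity) (by positivity)]
    nlinarith
  have h3 : 2 * tol / (3 * L) = tol / (3 * L) + tol / (3 * L) := by ring
  rw [h3]
  exact add_le_add (h1.trans hTR) h2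

theorem integrable_proxObjective_sub (hL : 0 < L) {f : V → ℝ} (hf : IsLSmooth L f)
    {x c : Ω → V} (hx : MemLp x 2 Pr) (hc : MemLp c 2 Pr) :
    Integrable (fun ω => proxObjective f L (c ω) (x ω) - ⨅ z, proxObjective f L (c ω) z) Pr := by
  simp_rw [hf.iInf_proxObjective hL]
  have hp := hf.memLp_proxPoint_comp hL hc
  exact ((hf.integrable_comp hx).add ((hx.sub hc).integrable_norm_sq.const_mul L)).sub
    ((hf.integrable_comp hp).add ((hp.sub hc).integrable_norm_sq.const_mul L))

theorem integral_proxObjective_sub_le (hL : 0 < L) {f : V → ℝ} (hf : IsLSmooth L f)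
    {x c : Ω → V} (hx : MemLp x 2 Pr) (hc : MemLp c 2 Pr) {tol : ℝ}
    (h : ∫ ω, ‖x ω - proxPoint f L (c ω)‖ ^ 2 ∂Pr ≤ 2 * tol / (3 * L)) :
    ∫ ω, (proxObjective f L (c ω) (x ω) - ⨅ z, proxObjective f L (c ω) z) ∂Pr ≤ tol := by
  have hi := ((hx.sub (hf.memLp_proxPoint_comp hL hc)).integrable_norm_sq.const_mul (3 * L / 2))
  have h1 := integral_mono (integrable_proxObjective_sub hL hf hx hc) hi fun ω => by
    rw [hf.iInf_proxObjective hL]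
    exact hf.proxObjective_sub_le hL (c ω) (x ω)
  refine h1.trans ?_
  rw [integral_const_mul]
  calc 3 * L / 2 * ∫ ω, ‖x ω - proxPoint f L (c ω)‖ ^ 2 ∂Pr
      ≤ 3 * L / 2 * (2 * tol / (3 * L)) := by gcongr
    _ = tol := by field_simp

theorem meetsTolerances_of_integral_norm_sq_le
    (hprm : ∀ s, prm s = scaffoldParams L M (T s) (K s)) (hL : 0 < L) (hM : 1 ≤ M)
    (hg : IsStochasticOracle F P g σ) (hF : ∀ m, IsLSmooth L (F m)) (hξ : AreFreshSamples P Pr ξ)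
    {S : ℕ} {tol : ℕ → ℝ}
    (h : ∀ s ∈ Finset.Icc 1 S, ∫ ω, ‖(catalystScaffold L g ξ prm θ β x₀ s ω).iterate
      - proxPoint (globalObjective F) L
        (catalystScaffold L g ξ prm θ β x₀ s ω).center‖ ^ 2 ∂Pr ≤ 2 * tol s / (3 * L)) :
    MeetsTolerances Pr (globalObjective F) L S (catalystScaffold L g ξ prm θ β x₀) tol := by
  intro s hs
  have hst := catalystAdapted_catalystScaffold (θ := θ) (β := β) (x₀ := x₀) hprm hg hF hξ s
  have hf := isLSmooth_globalObjective hM hF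
  exact ⟨integrable_proxObjective_sub hL hf hst.memLp_iterate hst.memLp_center,
    integral_proxObjective_sub_le hL hf hst.memLp_iterate hst.memLp_center (h s hs)⟩

/-! ### The number of rounds and of local steps -/

/-- Enough rounds to reduce the initial error by the factor `X`. -/
def roundsFor (X : ℝ) : ℕ := ⌈24 * Real.log X⌉₊ + 1

/-- Enough local steps for the accuracy `tol`. -/
def localStepsFor (L : ℝ) (M : ℕ) (σ tol : ℝ) : ℕ := ⌈3 * σ ^ 2 / (L * M * tol)⌉₊ + 1

theorem one_le_roundsFor (X : ℝ) : 1 ≤ roundsFor X := Nat.le_add_left _ _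

theorem one_le_localStepsFor (L : ℝ) (M : ℕ) (σ tol : ℝ) : 1 ≤ localStepsFor L M σ tol :=
  Nat.le_add_left _ _

theorem pow_roundsFor_le {X : ℝ} (hX : 0 < X) : (23 / 24 : ℝ) ^ roundsFor X ≤ 1 / X := by
  have h1 : (23 / 24 : ℝ) ≤ Real.exp (-(1 / 24)) := by
    have := Real.add_one_le_exp (-(1 / 24) : ℝ)
    linarith
  calc (23 / 24 : ℝ) ^ roundsFor X ≤ Real.exp (-(1 / 24)) ^ roundsFor X := by gcongr
    _ = Real.exp (-(roundsFor X / 24)) := by rw [← Real.exp_nat_mul]; ring_nf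
    _ ≤ Real.exp (-Real.log X) := by
      have h2 := Nat.le_ceil (24 * Real.log X)
      have h3 : (roundsFor X : ℝ) = ⌈24 * Real.log X⌉₊ + 1 := by simp [roundsFor]
      gcongr
      linarith
    _ = 1 / X := by rw [Real.exp_neg, Real.exp_log hX, one_div]

theorem roundsFor_le {X : ℝ} (hX : 1 ≤ X) : (roundsFor X : ℝ) ≤ 24 * Real.log X + 2 := by
  have h := (Nat.ceil_lt_add_one (show 0 ≤ 24 * Real.log X by
    have := Real.log_nonneg hX; positivity)).le
  simp only [roundsFor, Nat.cast_add, Nat.cast_one]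
  linarith

theorem le_localStepsFor (L : ℝ) (M : ℕ) (σ tol : ℝ) :
    3 * σ ^ 2 / (L * M * tol) ≤ localStepsFor L M σ tol := by
  have h := Nat.le_ceil (3 * σ ^ 2 / (L * M * tol))
  simp only [localStepsFor, Nat.cast_add, Nat.cast_one]
  linarith

theorem localStepsFor_le {L : ℝ} {M : ℕ} {σ tol : ℝ} (hL : 0 < L) (htol : 0 < tol) :
    (localStepsFor L M σ tol : ℝ) ≤ 3 * σ ^ 2 / (L * M * tol) + 2 := by
  have h := (Nat.ceil_lt_add_one (show 0 ≤ 3 * σ ^ 2 / (L * M * tol) by positivity)).le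
  simp only [localStepsFor, Nat.cast_add, Nat.cast_one]
  linarith

end CatalystScaffold

/-! ### Costs and accuracy for the chosen SCAFFOLD parameters -/

section CatalystParams

/-- The parameters of the SCAFFOLD runs inside Catalyst: the initial error is reduced by the factor
`X`, and the noise is averaged to the accuracy `tol s`. -/
def catalystParams (L : ℝ) (M : ℕ) (σ X : ℝ) (tol : ℕ → ℝ) (s : ℕ) : ScaffoldParams :=
  scaffoldParams L M (roundsFor X) (localStepsFor L M σ (tol s))

theorem catalystParams_admissible {L : ℝ} {M : ℕ} (hL : 0 < L) (hM : 1 ≤ M) (σ X : ℝ)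
    (tol : ℕ → ℝ) (s : ℕ) : (catalystParams L M σ X tol s).Admissible :=
  scaffoldParams_admissible hL hM (one_le_roundsFor _) (one_le_localStepsFor _ _ _ _)

theorem totalComm_catalystParams (L : ℝ) (M : ℕ) (σ X : ℝ) (tol : ℕ → ℝ) (S : ℕ) :
    (totalComm S (catalystParams L M σ X tol) : ℝ) = S * (1 + roundsFor X) := by
  simp [totalComm, ScaffoldParams.comm, catalystParams, scaffoldParams]

/-- Since `X` is the same for all subproblems, the number of rounds factors out. What remains is a
count proportional to `S` and a noise part governed by the sum of `1 / tol s`. -/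
theorem totalSamples_catalystParams_le {L : ℝ} {M : ℕ} (hL : 0 < L) (σ X : ℝ) {tol : ℕ → ℝ}
    (htol : ∀ s, 0 < tol s) (S : ℕ) :
    (totalSamples S (catalystParams L M σ X tol) : ℝ) ≤ S * (1 + 2 * roundsFor X)
      + roundsFor X * (3 * σ ^ 2 / (L * M)) * ∑ s ∈ Finset.Icc 1 S, 1 / tol s := by
  have h : ∀ s ∈ Finset.Icc 1 S, ((catalystParams L M σ X tol s).samples : ℝ)
      ≤ (1 + 2 * roundsFor X) + roundsFor X * (3 * σ ^ 2 / (L * M)) * (1 / tol s) := by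
    intro s _
    have h1 := localStepsFor_le (M := M) (σ := σ) hL (htol s)
    have h2 : 3 * σ ^ 2 / (L * M * tol s) = 3 * σ ^ 2 / (L * M) * (1 / tol s) := by
      rw [div_mul_div_comm, mul_one]
    simp only [ScaffoldParams.samples, catalystParams, scaffoldParams, Nat.cast_add, Nat.cast_mul,
      Nat.cast_one]
    rw [h2] at h1
    nlinarith [mul_le_mul_of_nonneg_left h1 (Nat.cast_nonneg (α := ℝ) (roundsFor X))]
  rw [totalSamples, Nat.cast_sum]
  refine (Finset.sum_le_sum h).trans (le_of_eq ?_)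
  rw [Finset.sum_add_distrib, Finset.sum_const, Nat.card_Icc, ← Finset.mul_sum, nsmul_eq_mul]
  simp

theorem one_le_log_of_three_le {x : ℝ} (hx : 3 ≤ x) : 1 ≤ Real.log x := by
  rw [Real.le_log_iff_exp_le (by linarith)]
  linarith [Real.exp_one_lt_d9]

variable {Ω Ξ V : Type*} [MeasurableSpace Ω] [MeasurableSpace Ξ] {M : ℕ}
  {P : Fin M → Measure Ξ} {Pr : Measure Ω} {ξ : ℕ → ℕ → Fin M → Ω → Ξ}
  [NormedAddCommGroup V] [InnerProductSpace ℝ V] [CompleteSpace V]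
  [SecondCountableTopology V] [MeasurableSpace V] [BorelSpace V] [IsProbabilityMeasure Pr]
  {F : Fin M → V → ℝ} {g : Fin M → V → Ξ → V} {L σ θ : ℝ} {β : ℕ → ℝ} {x₀ : V}

/-- The rounds cut a squared starting distance `X tol / (6L)` to `tol / (3L)`, and the local steps
leave at most as much noise. The total `2 tol / (3L)` is the squared distance that guarantees a
function gap of `tol`. -/
theorem catalystParams_accuracy (hL : 0 < L) (hM : 1 ≤ M) (hg : IsStochasticOracle F P g σ)
    (hF : ∀ m, IsLSmooth L (F m)) (hξ : AreFreshSamples P Pr ξ) {s : ℕ} {X : ℝ} {tol : ℕ → ℝ}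
    (hX : 0 < X) (htol : ∀ s, 0 < tol s)
    (hR : ∫ ω, ‖(catalystScaffold L g ξ (catalystParams L M σ X tol) θ β x₀ s ω).iterate
      + θ • ((catalystScaffold L g ξ (catalystParams L M σ X tol) θ β x₀ s ω).nextCenter
        - (catalystScaffold L g ξ (catalystParams L M σ X tol) θ β x₀ s ω).center)
      - proxPoint (globalObjective F) L
        (catalystScaffold L g ξ (catalystParams L M σ X tol) θ β x₀ s ω).nextCenter‖ ^ 2 ∂Pr
      ≤ X * tol (s + 1) / (6 * L)) :
    ∫ ω, ‖(catalystScaffold L g ξ (catalystParams L M σ X tol) θ β x₀ (s + 1) ω).iterate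
      - proxPoint (globalObjective F) L
        (catalystScaffold L g ξ (catalystParams L M σ X tol) θ β x₀ (s + 1) ω).center‖ ^ 2 ∂Pr
      ≤ 2 * tol (s + 1) / (3 * L) := by
  have ht := htol (s + 1)
  refine integral_norm_iterate_sub_proxPoint_sq_le (T := fun _ => roundsFor X)
    (K := fun s => localStepsFor L M σ (tol s)) (fun _ => rfl) (fun _ => one_le_roundsFor _)
    (fun _ => one_le_localStepsFor _ _ _ _) hL hM hg hF hξ ht hR ?_ (le_localStepsFor _ _ _ _)
  calc 2 * (23 / 24) ^ roundsFor X * (X * tol (s + 1) / (6 * L))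
      ≤ 2 * (1 / X) * (X * tol (s + 1) / (6 * L)) := by
        gcongr
        exact pow_roundsFor_le hX
    _ = tol (s + 1) / (3 * L) := by field_simp; norm_num

theorem catalystAdapted_catalystParams (hg : IsStochasticOracle F P g σ)
    (hF : ∀ m, IsLSmooth L (F m)) (hξ : AreFreshSamples P Pr ξ) (X : ℝ) (tol : ℕ → ℝ) (s : ℕ) :
    CatalystAdapted ξ Pr (s + 1)
      (catalystScaffold L g ξ (catalystParams L M σ X tol) θ β x₀ s) :=
  catalystAdapted_catalystScaffold (T := fun _ => roundsFor X)
    (K := fun s => localStepsFor L M σ (tol s)) (fun _ => rfl) hg hF hξ s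

theorem meetsTolerances_catalystParams (hL : 0 < L) (hM : 1 ≤ M)
    (hg : IsStochasticOracle F P g σ) (hF : ∀ m, IsLSmooth L (F m)) (hξ : AreFreshSamples P Pr ξ)
    {S : ℕ} {X : ℝ} {tol : ℕ → ℝ}
    (h : ∀ s < S, ∫ ω,
      ‖(catalystScaffold L g ξ (catalystParams L M σ X tol) θ β x₀ (s + 1) ω).iterate
      - proxPoint (globalObjective F) L
        (catalystScaffold L g ξ (catalystParams L M σ X tol) θ β x₀ (s + 1) ω).center‖ ^ 2 ∂Pr
        ≤ 2 * tol (s + 1) / (3 * L)) :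
    MeetsTolerances Pr (globalObjective F) L S
      (catalystScaffold L g ξ (catalystParams L M σ X tol) θ β x₀) tol := by
  refine meetsTolerances_of_integral_norm_sq_le (T := fun _ => roundsFor X)
    (K := fun s => localStepsFor L M σ (tol s)) (fun _ => rfl) hL hM hg hF hξ fun s hs => ?_
  obtain ⟨hs1, hs2⟩ := Finset.mem_Icc.1 hs
  obtain ⟨t, rfl⟩ : ∃ t, s = t + 1 := ⟨s - 1, by omega⟩
  exact h t (by omega)

end CatalystParams

/-! ### The nonconvex case -/

section Nonconvex

variable {Ω Ξ V : Type*} [MeasurableSpace Ω] [MeasurableSpace Ξ] {M : ℕ}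
  {P : Fin M → Measure Ξ} {Pr : Measure Ω} {ξ : ℕ → ℕ → Fin M → Ω → Ξ}
  [NormedAddCommGroup V] [InnerProductSpace ℝ V] [CompleteSpace V]
  [SecondCountableTopology V] [MeasurableSpace V] [BorelSpace V] [IsProbabilityMeasure Pr]
  {F : Fin M → V → ℝ} {g : Fin M → V → Ξ → V} {L σ Δ : ℝ} {x₀ : V} {S : ℕ}
  {prm : ℕ → ScaffoldParams}

theorem nextCenter_eq_iterate (θ : ℝ) (s : ℕ) (ω : Ω) :
    (catalystScaffold L g ξ prm θ (fun _ => 0) x₀ s ω).nextCenter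
      = (catalystScaffold L g ξ prm θ (fun _ => 0) x₀ s ω).iterate := by
  cases s with
  | zero => rfl
  | succ s => rw [catalystScaffold_succ_nextCenter, zero_smul, add_zero]

/-- The minimum of the proximal objective is at most its value at the centre, which is the objective
there, so an accurate solution decreases the objective up to `tol`. -/
theorem nonconvex_descent (hL : 0 < L) (hM : 1 ≤ M) (hF : ∀ m, IsLSmooth L (F m)) {x x' : Ω → V}
    {tol : ℝ} (hx : MemLp x 2 Pr) (hx' : MemLp x' 2 Pr)
    (h : ∫ ω, ‖x' ω - proxPoint (globalObjective F) L (x ω)‖ ^ 2 ∂Pr ≤ 2 * tol / (3 * L)) :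
    ∫ ω, globalObjective F (x' ω) ∂Pr + L * ∫ ω, ‖x' ω - x ω‖ ^ 2 ∂Pr
      ≤ ∫ ω, globalObjective F (x ω) ∂Pr + tol := by
  have hf := isLSmooth_globalObjective hM hF
  have h1 := integral_proxObjective_sub_le hL hf hx' hx h
  have h2 : ∫ ω, (proxObjective (globalObjective F) L (x ω) (x' ω) - globalObjective F (x ω)) ∂Pr
      ≤ ∫ ω, (proxObjective (globalObjective F) L (x ω) (x' ω)
        - ⨅ z, proxObjective (globalObjective F) L (x ω) z) ∂Pr := by
    refine integral_mono (((hf.integrable_comp hx').add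
      ((hx'.sub hx).integrable_norm_sq.const_mul L)).sub (hf.integrable_comp hx))
      (integrable_proxObjective_sub hL hf hx' hx) fun ω => ?_
    rw [hf.iInf_proxObjective hL]
    have h3 := hf.le_proxObjective_sub hL (x ω) (x ω)
    have h4 : proxObjective (globalObjective F) L (x ω) (x ω) = globalObjective F (x ω) := by
      simp [proxObjective]
    have h5 : 0 ≤ L / 2 * ‖x ω - proxPoint (globalObjective F) L (x ω)‖ ^ 2 := by positivity
    linarith
  have hpi : Integrable (fun ω => proxObjective (globalObjective F) L (x ω) (x' ω)) Pr :=
    (hf.integrable_comp hx').add ((hx'.sub hx).integrable_norm_sq.const_mul L)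
  have hni : Integrable (fun ω => L * ‖x' ω - x ω‖ ^ 2) Pr :=
    (hx'.sub hx).integrable_norm_sq.const_mul L
  rw [integral_sub hpi (hf.integrable_comp hx)] at h2
  have h6 : ∫ ω, proxObjective (globalObjective F) L (x ω) (x' ω) ∂Pr
      = ∫ ω, globalObjective F (x' ω) ∂Pr + L * ∫ ω, ‖x' ω - x ω‖ ^ 2 ∂Pr := by
    simp only [proxObjective]
    rw [integral_add (hf.integrable_comp hx') hni, integral_const_mul]
  linarith

/-- The gradient at `x'` is the proximal residual minus `2L (x' - x)`. The residual vanishes at the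
proximal point, so it is at most `3L` times the distance to that point. -/
theorem nonconvex_gradient_le (hL : 0 < L) {f : V → ℝ} (hf : IsLSmooth L f) (x x' : V) :
    ‖gradient f x'‖ ^ 2
      ≤ 18 * L ^ 2 * ‖x' - proxPoint f L x‖ ^ 2 + 8 * L ^ 2 * ‖x' - x‖ ^ 2 := by
  have h1 := hf.norm_prox_gradient_sub_le hL x x' (proxPoint f L x)
  rw [hf.proxPoint_spec hL, sub_zero] at h1
  have h2 := norm_sub_sq_le_young (gradient f x' + (2 * L) • (x' - x)) ((2 * L) • (x' - x))
    zero_lt_one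
  rw [add_sub_cancel_right, norm_smul, Real.norm_of_nonneg (by positivity)] at h2
  have h3 := pow_le_pow_left₀ (norm_nonneg _) h1 2
  nlinarith

/-- The tolerances add up to `Δ`, so the mean of `f` never exceeds `f x₀ + Δ`. This bounds the
starting distance of the next subproblem, so accuracy and potential are established together by
induction. -/
theorem nonconvex_convergence (hL : 0 < L) (hM : 1 ≤ M) (hΔ : 0 < Δ) (hS : 1 ≤ S)
    (hF : ∀ m, IsLSmooth L (F m)) (hx₀ : ∀ x, globalObjective F x₀ - globalObjective F x ≤ Δ)
    (hg : IsStochasticOracle F P g σ) (hξ : AreFreshSamples P Pr ξ)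
    {run : ℕ → Ω → CatalystState V} (hrun : run = catalystScaffold L g ξ
      (catalystParams L M σ (24 * S) fun _ => Δ / S) 0 (fun _ => 0) x₀) :
    MeetsTolerances Pr (globalObjective F) L S run (fun _ => Δ / S) ∧
    (∀ s, Integrable (fun ω => ‖gradient (globalObjective F) (run s ω).iterate‖ ^ 2) Pr) ∧
    ∑ s ∈ Finset.Icc 1 S, ∫ ω, ‖gradient (globalObjective F) (run s ω).iterate‖ ^ 2 ∂Pr
      ≤ 28 * L * Δ := by
  have hS0 : (0 : ℝ) < S := by exact_mod_cast hS
  have hf := isLSmooth_globalObjective hM hF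
  set f := globalObjective F with hfd
  have hx : ∀ s, MemLp (fun ω => (run s ω).iterate) 2 Pr := fun s => by
    rw [hrun]; exact (catalystAdapted_catalystParams hg hF hξ _ _ s).memLp_iterate
  have hnext : ∀ s ω, (run s ω).nextCenter = (run s ω).iterate := fun s ω => by
    rw [hrun]; exact nextCenter_eq_iterate 0 s ω
  have hcenter : ∀ s ω, (run (s + 1) ω).center = (run s ω).iterate := fun s ω => by
    rw [← hnext, hrun]; rfl
  have hprox : ∀ s, Integrable (fun ω => ‖(run s ω).iterate
      - proxPoint f L (run s ω).iterate‖ ^ 2) Pr := fun s =>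
    ((hx s).sub (hf.memLp_proxPoint_comp hL (hx s))).integrable_norm_sq
  -- The factor `24 S` corresponds to a squared starting distance `4Δ/L`: the iterate lies in mean
  -- at most `2Δ` above `f x₀ - Δ`, a lower bound of `f`, and half of `L` times the squared distance
  -- is at most this excess.
  have hstep : ∀ s < S, ∫ ω, f (run s ω).iterate ∂Pr ≤ f x₀ + s * (Δ / S) →
      ∫ ω, ‖(run (s + 1) ω).iterate - proxPoint f L (run (s + 1) ω).center‖ ^ 2 ∂Pr
        ≤ 2 * (Δ / S) / (3 * L) := by
    intro s hs hfs
    have hs' : (s : ℝ) ≤ S := by exact_mod_cast hs.le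
    rw [hrun]
    refine catalystParams_accuracy hL hM hg hF hξ (tol := fun _ => Δ / S) (by positivity)
      (fun _ => by positivity) ?_
    rw [← hrun]
    simp_rw [zero_smul, add_zero, hnext]
    have h1 : ∫ ω, L / 2 * ‖(run s ω).iterate - proxPoint f L (run s ω).iterate‖ ^ 2 ∂Pr
        ≤ ∫ ω, (f (run s ω).iterate - (f x₀ - Δ)) ∂Pr := by
      refine integral_mono ((hprox s).const_mul _)
        ((hf.integrable_comp (hx s)).sub (integrable_const _)) fun ω => ?_
      have h2 := hf.le_proxObjective_sub hL (run s ω).iterate (run s ω).iterate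
      have h3 := hx₀ (proxPoint f L (run s ω).iterate)
      have h4 : 0 ≤ L * ‖proxPoint f L (run s ω).iterate - (run s ω).iterate‖ ^ 2 := by positivity
      simp only [proxObjective, sub_self, norm_zero] at h2 ⊢
      linarith
    rw [integral_const_mul, integral_sub (hf.integrable_comp (hx s)) (integrable_const _),
      integral_const, probReal_univ, one_smul] at h1
    have h5 : (s : ℝ) * (Δ / S) ≤ Δ := by
      calc (s : ℝ) * (Δ / S) ≤ S * (Δ / S) := by gcongr
        _ = Δ := by field_simp
    have h6 : 24 * (S : ℝ) * (Δ / S) / (6 * L) = 4 * Δ / L := by field_simp; norm_num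
    rw [h6, le_div_iff₀ hL]
    linarith
  have hdesc : ∀ s, ∫ ω, ‖(run (s + 1) ω).iterate - proxPoint f L (run (s + 1) ω).center‖ ^ 2 ∂Pr
        ≤ 2 * (Δ / S) / (3 * L) →
      ∫ ω, f (run (s + 1) ω).iterate ∂Pr
        + L * ∫ ω, ‖(run (s + 1) ω).iterate - (run s ω).iterate‖ ^ 2 ∂Pr
        ≤ ∫ ω, f (run s ω).iterate ∂Pr + Δ / S := by
    intro s h
    simp_rw [hcenter] at h
    exact nonconvex_descent hL hM hF (hx s) (hx (s + 1)) h
  have hpot : ∀ s ≤ S, ∫ ω, f (run s ω).iterate ∂Pr ≤ f x₀ + s * (Δ / S) := by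
    intro s
    induction s with
    | zero =>
      intro _
      have h0 : ∀ ω, (run 0 ω).iterate = x₀ := fun ω => by rw [hrun]; rfl
      simp [h0]
    | succ s ih =>
      intro hs
      have h1 := hdesc s (hstep s (by omega) (ih (by omega)))
      have h2 : 0 ≤ L * ∫ ω, ‖(run (s + 1) ω).iterate - (run s ω).iterate‖ ^ 2 ∂Pr :=
        mul_nonneg hL.le (integral_nonneg fun ω => sq_nonneg _)
      have h3 := ih (by omega)
      push_cast
      linarith
  have htol := fun s (hs : s < S) => hstep s hs (hpot s hs.le)
  have hgi : ∀ s, Integrable (fun ω => ‖gradient f (run s ω).iterate‖ ^ 2) Pr :=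
    fun s => (hf.memLp_gradient_comp (hx s)).integrable_norm_sq
  refine ⟨?_, hgi, ?_⟩
  · rw [hrun] at htol ⊢
    exact meetsTolerances_catalystParams hL hM hg hF hξ htol
  -- The residual contributes `12 L` and the tolerance in the descent `8 L`. The telescoped decrease
  -- adds another `8 L Δ`, which gives `28 L Δ` in total.
  · have hgrad : ∀ s < S, ∫ ω, ‖gradient f (run (s + 1) ω).iterate‖ ^ 2 ∂Pr ≤ 20 * L * (Δ / S)
        + 8 * L * (∫ ω, f (run s ω).iterate ∂Pr - ∫ ω, f (run (s + 1) ω).iterate ∂Pr) := by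
      intro s hs
      have h1 := htol s hs
      have h2 := hdesc s h1
      simp_rw [hcenter] at h1
      have h3 := integral_mono (hgi (s + 1))
        (((((hx (s + 1)).sub (hf.memLp_proxPoint_comp hL (hx s))).integrable_norm_sq).const_mul
          (18 * L ^ 2)).add (((hx (s + 1)).sub (hx s)).integrable_norm_sq.const_mul (8 * L ^ 2)))
        fun ω => nonconvex_gradient_le hL hf (run s ω).iterate (run (s + 1) ω).iterate
      rw [integral_add' ((((hx (s + 1)).sub
        (hf.memLp_proxPoint_comp hL (hx s))).integrable_norm_sq).const_mul (18 * L ^ 2))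
        (((hx (s + 1)).sub (hx s)).integrable_norm_sq.const_mul (8 * L ^ 2))] at h3
      simp only [integral_const_mul, Pi.sub_apply] at h3
      have h4 := mul_le_mul_of_nonneg_left h1 (show 0 ≤ 18 * L ^ 2 by positivity)
      have h5 : 18 * L ^ 2 * (2 * (Δ / S) / (3 * L)) = 12 * L * (Δ / S) := by
        field_simp; norm_num
      have h6 := mul_le_mul_of_nonneg_left h2 (show 0 ≤ 8 * L by positivity)
      linarith
    have hsum : ∑ s ∈ Finset.Icc 1 S, ∫ ω, ‖gradient f (run s ω).iterate‖ ^ 2 ∂Pr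
        = ∑ s ∈ Finset.range S, ∫ ω, ‖gradient f (run (s + 1) ω).iterate‖ ^ 2 ∂Pr := by
      rw [Finset.range_eq_Ico, Finset.sum_Ico_add' (fun s =>
        ∫ ω, ‖gradient f (run s ω).iterate‖ ^ 2 ∂Pr) 0 S 1]
      rfl
    rw [hsum]
    refine (Finset.sum_le_sum fun s hs => hgrad s (Finset.mem_range.1 hs)).trans ?_
    rw [Finset.sum_add_distrib, Finset.sum_const, ← Finset.mul_sum,
      Finset.sum_range_sub' (fun s => ∫ ω, f (run s ω).iterate ∂Pr), Finset.card_range,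
      nsmul_eq_mul]
    have h0 : ∀ ω, (run 0 ω).iterate = x₀ := fun ω => by rw [hrun]; rfl
    simp only [h0, integral_const, probReal_univ, one_smul]
    have h7 : f x₀ - Δ ≤ ∫ ω, f (run S ω).iterate ∂Pr := by
      have h8 := integral_mono (μ := Pr) (integrable_const (f x₀ - Δ)) (hf.integrable_comp (hx S))
        fun ω => by have := hx₀ (run S ω).iterate; simp only; linarith
      simpa using h8
    have h9 : (S : ℝ) * (20 * L * (Δ / S)) = 20 * L * Δ := by field_simp
    nlinarith

end Nonconvex

/-- With `S` of order `1/ε²` the sum of `1 / tol s` is `S²/Δ`, of order `1/ε⁴`. The factor `24 S` is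
polynomial in `1/ε`, so the rounds are of order `Λ`; additive constants are absorbed using `1 ≤ Λ`.
-/
theorem nonconvex_cost {L Δ : ℝ} (hL : 0 < L) (hΔ : 0 < Δ) :
    ∃ C : ℝ, ∀ (M : ℕ) (σ ε : ℝ), 1 ≤ M → 0 ≤ σ → 0 < ε → ε ≤ 1 →
      ∃ S : ℕ, 1 ≤ S ∧ 28 * L * Δ ≤ S * ε ^ 2 ∧
        (totalComm S (catalystParams L M σ (24 * S) fun _ => Δ / S) : ℝ)
          ≤ C * (1 / ε ^ 2) * Real.log (2 + σ + 1 / ε) ∧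
        (totalSamples S (catalystParams L M σ (24 * S) fun _ => Δ / S) : ℝ)
          ≤ C * (1 / ε ^ 2 + σ ^ 2 / (M * ε ^ 4)) * Real.log (2 + σ + 1 / ε) := by
  set a := 28 * L * Δ + 2 with ha
  have ha0 : 2 ≤ a := by have := mul_pos hL hΔ; linarith
  set c := Real.log (24 * a) with hc
  have hc0 : 0 ≤ c := Real.log_nonneg (by linarith)
  refine ⟨a * (48 * c + 101) + 3 * (24 * c + 50) * a ^ 2 / (L * Δ), ?_⟩
  intro M σ ε hM hσ hε hε1
  have hM0 : (0 : ℝ) < M := by exact_mod_cast hM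
  set S := ⌈28 * L * Δ / ε ^ 2⌉₊ + 1 with hSd
  have hS1 : 1 ≤ S := Nat.le_add_left _ _
  have hS0 : (1 : ℝ) ≤ S := by exact_mod_cast hS1
  have hSc : (S : ℝ) = ⌈28 * L * Δ / ε ^ 2⌉₊ + 1 := by rw [hSd]; push_cast; ring
  have hε2 : 1 ≤ 1 / ε ^ 2 := by
    rw [le_div_iff₀ (by positivity), one_mul]; exact pow_le_one₀ hε.le hε1
  have hSle : (S : ℝ) ≤ a * (1 / ε ^ 2) := by
    have h := (Nat.ceil_lt_add_one (show 0 ≤ 28 * L * Δ / ε ^ 2 by positivity)).le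
    rw [hSc, ha, add_mul, mul_one_div]
    linarith
  set Λ := Real.log (2 + σ + 1 / ε) with hΛ
  have hε' : 1 ≤ 1 / ε := by rw [le_div_iff₀ hε, one_mul]; exact hε1
  have hΛ1 : 1 ≤ Λ := one_le_log_of_three_le (by linarith)
  have hlogε : Real.log (1 / ε) ≤ Λ := Real.log_le_log (by positivity) (by linarith)
  have hlogS : Real.log (24 * S) ≤ c + 2 * Λ := by
    calc Real.log (24 * S) ≤ Real.log (24 * a * (1 / ε) ^ 2) := by
          refine Real.log_le_log (by positivity) ?_
          rw [one_div_pow]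
          linarith
      _ = c + 2 * Real.log (1 / ε) := by
          rw [Real.log_mul (by positivity) (by positivity), Real.log_pow]; push_cast; ring
      _ ≤ c + 2 * Λ := by linarith
  set T := roundsFor (24 * S) with hT
  have hTle : (T : ℝ) ≤ (24 * c + 50) * Λ := by
    have h := roundsFor_le (X := 24 * (S : ℝ)) (by linarith)
    nlinarith
  have hT0 : (0 : ℝ) ≤ T := Nat.cast_nonneg _
  have hLΔ := mul_pos hL hΔ
  refine ⟨S, hS1, ?_, ?_, ?_⟩
  · have h := Nat.le_ceil (28 * L * Δ / ε ^ 2)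
    rw [div_le_iff₀ (by positivity)] at h
    rw [hSc]
    nlinarith [sq_nonneg ε]
  · rw [totalComm_catalystParams, ← hT]
    calc (S : ℝ) * (1 + T) ≤ (a * (1 / ε ^ 2)) * (Λ + (24 * c + 50) * Λ) := by gcongr
      _ = a * (24 * c + 51) * (1 / ε ^ 2) * Λ := by ring
      _ ≤ _ := by
        gcongr
        have h1 : 0 ≤ 3 * (24 * c + 50) * a ^ 2 / (L * Δ) := by positivity
        nlinarith
  · refine (totalSamples_catalystParams_le hL σ _ (fun _ => by positivity) S).trans ?_
    rw [← hT, Finset.sum_const, Nat.card_Icc, nsmul_eq_mul, Nat.add_sub_cancel]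
    have h1 : (S : ℝ) * (1 + 2 * T) ≤ a * (48 * c + 101) * (1 / ε ^ 2) * Λ := by
      calc (S : ℝ) * (1 + 2 * T) ≤ (a * (1 / ε ^ 2)) * (Λ + 2 * ((24 * c + 50) * Λ)) := by gcongr
        _ = _ := by ring
    have h2 : T * (3 * σ ^ 2 / (L * M)) * (S * (1 / (Δ / S)))
        ≤ 3 * (24 * c + 50) * a ^ 2 / (L * Δ) * (σ ^ 2 / (M * ε ^ 4)) * Λ := by
      calc T * (3 * σ ^ 2 / (L * M)) * (S * (1 / (Δ / S)))
          = T * (3 * σ ^ 2 / (L * M * Δ)) * (S : ℝ) ^ 2 := by field_simp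
        _ ≤ ((24 * c + 50) * Λ) * (3 * σ ^ 2 / (L * M * Δ)) * (a * (1 / ε ^ 2)) ^ 2 := by gcongr
        _ = _ := by field_simp
    have h3 : 0 ≤ 3 * (24 * c + 50) * a ^ 2 / (L * Δ) * (1 / ε ^ 2) * Λ := by positivity
    have h4 : 0 ≤ a * (48 * c + 101) * (σ ^ 2 / (M * ε ^ 4)) * Λ := by positivity
    linarith

/-! ### Acceleration -/

section Acceleration

variable {V : Type*} [NormedAddCommGroup V] [InnerProductSpace ℝ V] [CompleteSpace V] {L : ℝ}

/-- The point `vˢ` with `xˢ⁺¹ = (1 - αₛ) xˢ + αₛ vˢ⁺¹`. -/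
def catalystEstimate (α : ℕ → ℝ) (x : ℕ → V) : ℕ → V
  | 0 => x 0
  | s + 1 => x s + (1 / α s) • (x (s + 1) - x s)

theorem catalystEstimate_succ {α : ℕ → ℝ} {s : ℕ} (hα : α s ≠ 0) (x : ℕ → V) :
    x (s + 1) = (1 - α s) • x s + α s • catalystEstimate α x (s + 1) := by
  rw [catalystEstimate, smul_add, smul_smul, mul_one_div_cancel hα, one_smul]
  module

theorem norm_convex_combination_sq_le {a : ℝ} (h0 : 0 ≤ a) (h1 : a ≤ 1) (x z : V) :
    ‖(1 - a) • x + a • z‖ ^ 2 ≤ (1 - a) * ‖x‖ ^ 2 + a * ‖z‖ ^ 2 := by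
  have h : ‖(1 - a) • x + a • z‖ ^ 2
      = (1 - a) * ‖x‖ ^ 2 + a * ‖z‖ ^ 2 - a * (1 - a) * ‖x - z‖ ^ 2 := by
    simp only [norm_add_sq_real, norm_sub_sq_real, norm_smul, real_inner_smul_left,
      real_inner_smul_right, mul_pow, Real.norm_eq_abs, sq_abs]
    ring
  rw [h]
  have : 0 ≤ a * (1 - a) * ‖x - z‖ ^ 2 := by
    have : 0 ≤ 1 - a := by linarith
    positivity
  linarith

theorem norm_extrapolation_sub_sq_le {b : ℝ} (h0 : 0 ≤ b) (h1 : b ≤ 1) (x x' r : V) :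
    ‖x' + b • (x' - x) - r‖ ^ 2 ≤ 6 * ‖x' - r‖ ^ 2 + 3 * ‖x - r‖ ^ 2 := by
  have h2 : ‖x' + b • (x' - x) - r‖ ≤ 2 * ‖x' - r‖ + ‖x - r‖ := by
    calc ‖x' + b • (x' - x) - r‖ = ‖(x' - r) + b • ((x' - r) - (x - r))‖ := by congr 1; module
      _ ≤ ‖x' - r‖ + b * (‖x' - r‖ + ‖x - r‖) := by
        refine (norm_add_le _ _).trans ?_
        rw [norm_smul, Real.norm_of_nonneg h0]
        gcongr
        exact norm_sub_le _ _
      _ ≤ ‖x' - r‖ + 1 * (‖x' - r‖ + ‖x - r‖) := by gcongr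
      _ = _ := by ring
  have h3 := pow_le_pow_left₀ (norm_nonneg _) h2 2
  nlinarith [sq_nonneg (‖x' - r‖ - ‖x - r‖)]

/-- The estimate sequence inequality for an inexact proximal step. -/
theorem accelerated_step {f : V → ℝ} {μ a : ℝ} {x x' v' r : V} (ha0 : 0 ≤ a) (ha1 : a ≤ 1)
    (hμ : 0 ≤ μ)
    (hf : ∀ x z, f x + inner ℝ (gradient f x) (z - x) + μ / 2 * ‖z - x‖ ^ 2 ≤ f z)
    (hx' : x' = (1 - a) • x + a • v') :
    f x' - f r ≤ (1 - a) * (f x - f r) + a * inner ℝ (gradient f x') (v' - r)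
      - a * μ / 2 * ‖r - x'‖ ^ 2 := by
  have h1 := mul_le_mul_of_nonneg_left (hf x' x) (sub_nonneg.2 ha1)
  have h2 := mul_le_mul_of_nonneg_left (hf x' r) ha0
  -- The weights `1 - a` at `x` and `a` at `r` are chosen so that both directions combine to `-a (v'
  -- - r)`, by the relation defining `v'`.
  have h3 : (1 - a) * inner ℝ (gradient f x') (x - x') + a * inner ℝ (gradient f x') (r - x')
      = -(a * inner ℝ (gradient f x') (v' - r)) := by
    rw [← real_inner_smul_right, ← real_inner_smul_right, ← real_inner_smul_right,
      ← inner_add_right, ← inner_neg_right]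
    congr 1
    rw [show (1 - a) • (x - x') + a • (r - x') = ((1 - a) • x + a • r) - x' by module]
    nth_rw 1 [hx']
    module
  have h4 : 0 ≤ (1 - a) * (μ / 2 * ‖x - x'‖ ^ 2) := by
    have := sub_nonneg.2 ha1
    positivity
  linarith

theorem mul_inner_le_young {a c : ℝ} (hc : 0 < c) (e w : V) :
    a * inner ℝ e w ≤ ‖e‖ ^ 2 / (4 * c) + c * a ^ 2 * ‖w‖ ^ 2 := by
  have h1 := abs_le.1 (abs_real_inner_le_norm e w)
  have h2 : 0 ≤ (‖e‖ - 2 * c * |a| * ‖w‖) ^ 2 / (4 * c) := by positivity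
  have h3 : (‖e‖ - 2 * c * |a| * ‖w‖) ^ 2 / (4 * c)
      = ‖e‖ ^ 2 / (4 * c) + c * a ^ 2 * ‖w‖ ^ 2 - |a| * (‖e‖ * ‖w‖) := by
    rw [← sq_abs a]
    field_simp
    ring
  have h4 : a * inner ℝ e w ≤ |a| * (‖e‖ * ‖w‖) := by
    calc a * inner ℝ e w ≤ |a * inner ℝ e w| := le_abs_self _
      _ = |a| * |inner ℝ e w| := abs_mul _ _
      _ ≤ _ := by gcongr; exact abs_real_inner_le_norm e w
  linarith

theorem IsLSmooth.norm_prox_gradient_sq_le {f : V → ℝ} (hf : IsLSmooth L f) (hL : 0 < L)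
    (y x : V) :
    ‖gradient f x + (2 * L) • (x - y)‖ ^ 2 ≤ 9 * L ^ 2 * ‖x - proxPoint f L y‖ ^ 2 := by
  have h1 := hf.norm_prox_gradient_sub_le hL y x (proxPoint f L y)
  rw [hf.proxPoint_spec hL, sub_zero] at h1
  refine (pow_le_pow_left₀ (norm_nonneg _) h1 2).trans (le_of_eq (by ring))

end Acceleration

/-! ### Distance of the starting point from the subproblem solution -/

section WarmStart

variable {Ω Ξ V : Type*} [MeasurableSpace Ω] [MeasurableSpace Ξ] {M : ℕ}
  {P : Fin M → Measure Ξ} {Pr : Measure Ω} {ξ : ℕ → ℕ → Fin M → Ω → Ξ}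
  [NormedAddCommGroup V] [InnerProductSpace ℝ V] [CompleteSpace V]
  [SecondCountableTopology V] [MeasurableSpace V] [BorelSpace V] [IsProbabilityMeasure Pr]
  {F : Fin M → V → ℝ} {g : Fin M → V → Ξ → V} {L σ : ℝ} {x₀ : V} {S : ℕ}

/-- The starting point of a subproblem is close to its solution if the iterates stay close to a
stationary point. -/
theorem integral_norm_start_sub_proxPoint_sq_le {θ ρ : ℝ} {β : ℕ → ℝ} {r : V}
    (hL : 0 < L) (hM : 1 ≤ M) (hg : IsStochasticOracle F P g σ)
    (hF : ∀ m, IsLSmooth L (F m)) (hξ : AreFreshSamples P Pr ξ)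
    (hr : gradient (globalObjective F) r = 0) (hθ0 : 0 ≤ θ) (hθ1 : θ ≤ 1)
    (hβ0 : ∀ s, 0 ≤ β (s + 1)) (hβ1 : ∀ s, β (s + 1) ≤ 1) {X : ℝ} {tol : ℕ → ℝ}
    {run : ℕ → Ω → CatalystState V}
    (hrun : run = catalystScaffold L g ξ (catalystParams L M σ X tol) θ β x₀) {s : ℕ}
    (hρ : ∀ t ≤ s, ∫ ω, ‖(run t ω).iterate - r‖ ^ 2 ∂Pr ≤ ρ) :
    ∫ ω, ‖(run s ω).iterate + θ • ((run s ω).nextCenter - (run s ω).center)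
      - proxPoint (globalObjective F) L (run s ω).nextCenter‖ ^ 2 ∂Pr ≤ 273 * ρ := by
  have hf := isLSmooth_globalObjective hM hF
  have had := fun s => hrun ▸ catalystAdapted_catalystParams (θ := θ) (β := β) (x₀ := x₀)
    (L := L) hg hF hξ X tol s
  have hi : ∀ {Z : Ω → V}, MemLp Z 2 Pr → Integrable (fun ω => ‖Z ω - r‖ ^ 2) Pr :=
    fun hZ => (hZ.sub (memLp_const r)).integrable_norm_sq
  have h0 : ∀ ω, (run 0 ω).iterate = x₀ ∧ (run 0 ω).nextCenter = x₀ ∧ (run 0 ω).center = x₀ :=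
    fun ω => by rw [hrun]; exact ⟨rfl, rfl, rfl⟩
  have hρ0 : ‖x₀ - r‖ ^ 2 ≤ ρ := by simpa [h0] using hρ 0 (Nat.zero_le _)
  have hρ00 : 0 ≤ ρ := (sq_nonneg _).trans hρ0
  have hnext : ∀ t ≤ s, ∫ ω, ‖(run t ω).nextCenter - r‖ ^ 2 ∂Pr ≤ 9 * ρ := by
    intro t ht
    cases t with
    | zero =>
      simp only [h0, integral_const, probReal_univ, one_smul]
      linarith
    | succ t =>
      have h1 := integral_mono (hi (had (t + 1)).memLp_nextCenter)
        (((hi (had (t + 1)).memLp_iterate).const_mul 6).add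
          ((hi (had t).memLp_iterate).const_mul 3)) fun ω => by
        have h2 := norm_extrapolation_sub_sq_le (hβ0 t) (hβ1 t) (run t ω).iterate
          (run (t + 1) ω).iterate r
        have h3 : (run (t + 1) ω).nextCenter = (run (t + 1) ω).iterate
            + β (t + 1) • ((run (t + 1) ω).iterate - (run t ω).iterate) := by rw [hrun]; rfl
        rw [h3]
        exact h2
      rw [integral_add' ((hi (had (t + 1)).memLp_iterate).const_mul 6)
          ((hi (had t).memLp_iterate).const_mul 3)] at h1
      simp only [integral_const_mul] at h1
      linarith [hρ (t + 1) ht, hρ t (by omega)]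
  have hcenter : ∫ ω, ‖(run s ω).center - r‖ ^ 2 ∂Pr ≤ 9 * ρ := by
    cases s with
    | zero =>
      simp only [h0, integral_const, probReal_univ, one_smul]
      linarith
    | succ s =>
      have h3 : ∀ ω, (run (s + 1) ω).center = (run s ω).nextCenter := fun ω => by rw [hrun]; rfl
      simp_rw [h3]
      exact hnext s (by omega)
  have hA := hi (had s).memLp_iterate
  have hN := hi (had s).memLp_nextCenter
  have hC := hi (had s).memLp_center
  have h1 := integral_mono (((((had s).memLp_iterate).add
    ((((had s).memLp_nextCenter).sub (had s).memLp_center).const_smul θ)).sub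
    (hf.memLp_proxPoint_comp hL (had s).memLp_nextCenter)).integrable_norm_sq)
    (((hA.const_mul 3).add (hN.const_mul 27)).add (hC.const_mul 3)) fun ω => by
    set x := (run s ω).iterate
    set n := (run s ω).nextCenter
    set c := (run s ω).center
    have h2 := hf.norm_sub_proxPoint_le hL hr n
    have h4 : ‖x + θ • (n - c) - proxPoint (globalObjective F) L n‖
        ≤ ‖x - r‖ + 3 * ‖n - r‖ + ‖c - r‖ := by
      calc ‖x + θ • (n - c) - proxPoint (globalObjective F) L n‖
          = ‖(x - r) + θ • ((n - r) - (c - r)) - (proxPoint (globalObjective F) L n - r)‖ := by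
            congr 1; module
        _ ≤ (‖x - r‖ + θ * (‖n - r‖ + ‖c - r‖)) + 2 * ‖n - r‖ := by
          refine (norm_sub_le _ _).trans (add_le_add ((norm_add_le _ _).trans ?_) h2)
          rw [norm_smul, Real.norm_of_nonneg hθ0]
          gcongr
          exact norm_sub_le _ _
        _ ≤ (‖x - r‖ + 1 * (‖n - r‖ + ‖c - r‖)) + 2 * ‖n - r‖ := by gcongr
        _ = _ := by ring
    have h5 := pow_le_pow_left₀ (norm_nonneg _) h4 2
    show ‖x + θ • (n - c) - proxPoint (globalObjective F) L n‖ ^ 2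
      ≤ 3 * ‖x - r‖ ^ 2 + 27 * ‖n - r‖ ^ 2 + 3 * ‖c - r‖ ^ 2
    nlinarith [sq_nonneg (‖x - r‖ - 3 * ‖n - r‖), sq_nonneg (‖x - r‖ - ‖c - r‖),
      sq_nonneg (3 * ‖n - r‖ - ‖c - r‖)]
  refine h1.trans ?_
  rw [integral_add' ((hA.const_mul 3).add (hN.const_mul 27)) (hC.const_mul 3),
    integral_add' (hA.const_mul 3) (hN.const_mul 27)]
  simp only [integral_const_mul]
  -- The constant is `3 + 27 · 9 + 3 · 9 = 273`.
  linarith [hρ s le_rfl, hnext s le_rfl, hcenter]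

end WarmStart

/-! ### The convex case -/

section Convex

theorem catalystAlpha_convex_succ (s : ℕ) : catalystAlpha 0 1 (s + 1) ^ 2
    = (1 - catalystAlpha 0 1 (s + 1)) * catalystAlpha 0 1 s ^ 2 := by
  simpa using (catalystAlpha_spec 0 1 one_pos s).2

theorem catalystAlpha_convex_pos (s : ℕ) : 0 < catalystAlpha 0 1 s :=
  (catalystAlpha_spec 0 1 one_pos s).1

/-- For `b = 1/α` the recursion reads `b'² - b' = b²`, so `b` grows by at least `1/2` and at most
`1` in each step. -/
theorem catalystAlpha_convex_inv_bounds (s : ℕ) :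
    ((s : ℝ) + 2) / 2 ≤ 1 / catalystAlpha 0 1 s ∧ 1 / catalystAlpha 0 1 s ≤ s + 1 := by
  induction s with
  | zero => simp [catalystAlpha]
  | succ s ih =>
    have h := catalystAlpha_convex_succ s
    have h0 := catalystAlpha_convex_pos s
    have h1 := catalystAlpha_convex_pos (s + 1)
    set a := catalystAlpha 0 1 s
    set b := catalystAlpha 0 1 (s + 1)
    have e : (1 / b) ^ 2 - 1 / b = (1 / a) ^ 2 := by
      field_simp
      linarith
    have ha : 0 < 1 / a := by positivity
    have hb : 0 < 1 / b := by positivity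
    obtain ⟨i1, i2⟩ := ih
    push_cast
    constructor
    · by_contra! hlt
      nlinarith
    · by_contra! hlt
      nlinarith

theorem catalystAlpha_convex_le_one (s : ℕ) : catalystAlpha 0 1 s ≤ 1 := by
  have h := (catalystAlpha_convex_inv_bounds s).1
  have h0 := catalystAlpha_convex_pos s
  rw [le_div_iff₀ h0] at h
  nlinarith [Nat.cast_nonneg (α := ℝ) s]

/-- The recursion gives `αₛ² + αₛ₊₁ = αₛ² / αₛ₊₁`. In this form the next centre is visibly a convex
combination of `x` and `v`. -/
theorem catalystBeta_convex_succ (s : ℕ) : catalystBeta 0 1 (s + 1)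
    = catalystAlpha 0 1 (s + 1) * (1 - catalystAlpha 0 1 s) / catalystAlpha 0 1 s := by
  have h := catalystAlpha_convex_succ s
  have h0 := catalystAlpha_convex_pos s
  have h1 := catalystAlpha_convex_pos (s + 1)
  rw [catalystBeta, Nat.add_sub_cancel, div_eq_div_iff (by positivity) h0.ne']
  linear_combination (-(1 - catalystAlpha 0 1 s)) * h

theorem catalystBeta_convex_mem (s : ℕ) :
    0 ≤ catalystBeta 0 1 (s + 1) ∧ catalystBeta 0 1 (s + 1) ≤ 1 := by
  have h0 := catalystAlpha_convex_pos s
  have h1 := catalystAlpha_convex_pos (s + 1)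
  have h2 := sub_nonneg.2 (catalystAlpha_convex_le_one s)
  have h3 : catalystAlpha 0 1 (s + 1) ≤ catalystAlpha 0 1 s := by
    have h := catalystAlpha_convex_succ s
    nlinarith [pow_pos h0 2]
  rw [catalystBeta_convex_succ]
  refine ⟨by positivity, ?_⟩
  rw [div_le_one h0]
  nlinarith

variable {V : Type*} [NormedAddCommGroup V] [InnerProductSpace ℝ V] [CompleteSpace V] {L : ℝ}

/-- Here `x' - y = a (v' - v)`, so the gradient at `x'` is the proximal residual `e` minus `2 L a
(v' - v)`. The second term telescopes in the squared distances to `r`. Young's inequality with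
weight `t` splits the pairing of `e` with `v' - r`, at the price of a factor `1 - t` on the left and
the squared residual over `t` on the right. Division by `a²` lets the gap coefficients of successive
steps match. -/
theorem convex_step {f : V → ℝ} {a t : ℝ} {x x' v v' y r : V} (hL : 0 < L) (ha0 : 0 < a)
    (ha1 : a ≤ 1) (ht : 0 < t) (hf : IsLSmooth L f)
    (hc : ∀ x z, f x + inner ℝ (gradient f x) (z - x) + 0 / 2 * ‖z - x‖ ^ 2 ≤ f z)
    (hy : y = (1 - a) • x + a • v) (hx' : x' = (1 - a) • x + a • v') :
    1 / a ^ 2 * (f x' - f r) + L * (1 - t) * ‖v' - r‖ ^ 2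
      ≤ (1 - a) / a ^ 2 * (f x - f r) + L * ‖v - r‖ ^ 2
        + 9 * L / (4 * t * a ^ 2) * ‖x' - proxPoint f L y‖ ^ 2 := by
  have h1 := accelerated_step (r := r) ha0.le ha1 le_rfl hc hx'
  set e := gradient f x' + (2 * L) • (x' - y) with he
  have h2 : gradient f x' = e - (2 * L * a) • ((v' - r) - (v - r)) := by
    rw [he, hx', hy]
    module
  have h3 : inner ℝ (gradient f x') (v' - r) = inner ℝ e (v' - r)
      - 2 * L * a * (‖v' - r‖ ^ 2 - inner ℝ (v - r) (v' - r)) := by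
    rw [h2, inner_sub_left, real_inner_smul_left, inner_sub_left, real_inner_self_eq_norm_sq]
  have h4 : 2 * inner ℝ (v - r) (v' - r) ≤ ‖v - r‖ ^ 2 + ‖v' - r‖ ^ 2 := by
    have := norm_sub_sq_real (v - r) (v' - r)
    linarith [sq_nonneg ‖v - r - (v' - r)‖]
  have h5 := mul_inner_le_young (a := a) (mul_pos hL ht) e (v' - r)
  have h6 : ‖e‖ ^ 2 ≤ 9 * L ^ 2 * ‖x' - proxPoint f L y‖ ^ 2 :=
    hf.norm_prox_gradient_sq_le hL y x'
  have h7 : ‖e‖ ^ 2 / (4 * (L * t)) ≤ 9 * L / (4 * t) * ‖x' - proxPoint f L y‖ ^ 2 := by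
    calc ‖e‖ ^ 2 / (4 * (L * t))
        ≤ 9 * L ^ 2 * ‖x' - proxPoint f L y‖ ^ 2 / (4 * (L * t)) := by gcongr
      _ = _ := by field_simp
  have h8 : L * a ^ 2 * (2 * inner ℝ (v - r) (v' - r))
      ≤ L * a ^ 2 * (‖v - r‖ ^ 2 + ‖v' - r‖ ^ 2) := by gcongr
  have h9 : f x' - f r + a ^ 2 * (L * (1 - t) * ‖v' - r‖ ^ 2) ≤ (1 - a) * (f x - f r)
      + a ^ 2 * (L * ‖v - r‖ ^ 2) + 9 * L / (4 * t) * ‖x' - proxPoint f L y‖ ^ 2 := by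
    rw [h3] at h1
    linarith
  have h10 := mul_le_mul_of_nonneg_left h9 (show 0 ≤ 1 / a ^ 2 by positivity)
  have e1 : 1 / a ^ 2 * (f x' - f r + a ^ 2 * (L * (1 - t) * ‖v' - r‖ ^ 2))
      = 1 / a ^ 2 * (f x' - f r) + L * (1 - t) * ‖v' - r‖ ^ 2 := by field_simp
  have e2 : 1 / a ^ 2 * ((1 - a) * (f x - f r)
      + a ^ 2 * (L * ‖v - r‖ ^ 2) + 9 * L / (4 * t) * ‖x' - proxPoint f L y‖ ^ 2)
      = (1 - a) / a ^ 2 * (f x - f r) + L * ‖v - r‖ ^ 2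
        + 9 * L / (4 * t * a ^ 2) * ‖x' - proxPoint f L y‖ ^ 2 := by field_simp
  rwa [e1, e2] at h10

/-- The extrapolated centre is the point `y` that `convex_step` needs. -/
theorem nextCenter_convex {α : ℕ → ℝ} (hα : α = catalystAlpha 0 1) (x : ℕ → V) (s : ℕ) :
    x (s + 1) + catalystBeta 0 1 (s + 1) • (x (s + 1) - x s)
      = (1 - α (s + 1)) • x (s + 1) + α (s + 1) • catalystEstimate α x (s + 1) := by
  have h0 : α s ≠ 0 := hα ▸ (catalystAlpha_convex_pos s).ne'
  rw [catalystBeta_convex_succ, ← hα, catalystEstimate]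
  have h1 : α (s + 1) * (1 - α s) / α s = α (s + 1) * (1 / α s) - α (s + 1) := by field_simp
  rw [h1]
  module

end Convex

/-! ### Convergence in the convex case -/

section ConvexConvergence

/-- The sum of the weights in Young's inequality in the convex case. -/
def youngSum (γ : ℝ) : ℝ := ∑' n : ℕ, 1 / ((n : ℝ) + 2) ^ (1 + γ / 2)

theorem sum_le_youngSum {γ : ℝ} (hγ : 0 < γ) (s : ℕ) :
    ∑ n ∈ Finset.range s, 1 / ((n : ℝ) + 2) ^ (1 + γ / 2) ≤ youngSum γ := by
  have h := (Real.summable_one_div_nat_add_rpow 2 (1 + γ / 2)).2 (by linarith)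
  have h1 : (fun n : ℕ => 1 / |(n : ℝ) + 2| ^ (1 + γ / 2))
      = fun n : ℕ => 1 / ((n : ℝ) + 2) ^ (1 + γ / 2) := by
    funext n
    rw [abs_of_pos (by positivity)]
  rw [h1] at h
  exact h.sum_le_tsum _ fun n _ => by positivity

/-- The bound on the estimate sequence in the convex case. -/
def convexBound (L Δ D γ : ℝ) : ℝ := Real.exp (youngSum γ) * (L * D ^ 2 + 4 / 3 * Δ)

theorem le_convexBound {L Δ D γ : ℝ} (hL : 0 < L) (hΔ : 0 < Δ) (hγ : 0 < γ) :
    L * D ^ 2 + 4 / 3 * Δ ≤ convexBound L Δ D γ := by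
  have h1 : 0 ≤ youngSum γ := by simpa using sum_le_youngSum hγ 0
  have h2 := Real.one_le_exp h1
  have h3 : 0 ≤ L * D ^ 2 + 4 / 3 * Δ := by positivity
  rw [convexBound]
  nlinarith

/-- Combine `1 + 2t ≤ exp (2t)` with `(1 - t)(1 + 2t) ≥ 1`. The losses of all iterations then
multiply to the exponential of a sum. -/
theorem exp_two_mul_ge {t : ℝ} (h0 : 0 ≤ t) (h1 : t ≤ 1 / 2) : 1 ≤ (1 - t) * Real.exp (2 * t) := by
  have h := Real.add_one_le_exp (2 * t)
  nlinarith

variable {Ω Ξ V : Type*} [MeasurableSpace Ω] [MeasurableSpace Ξ] {M : ℕ}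
  {P : Fin M → Measure Ξ} {Pr : Measure Ω} {ξ : ℕ → ℕ → Fin M → Ω → Ξ}
  [NormedAddCommGroup V] [InnerProductSpace ℝ V] [CompleteSpace V]
  [SecondCountableTopology V] [MeasurableSpace V] [BorelSpace V] [IsProbabilityMeasure Pr]
  {F : Fin M → V → ℝ} {g : Fin M → V → Ξ → V} {L σ Δ D γ : ℝ} {x₀ r : V} {S : ℕ}

theorem memLp_catalystEstimate {α : ℕ → ℝ} {x : ℕ → Ω → V} (hx : ∀ s, MemLp (x s) 2 Pr) (s : ℕ) :
    MemLp (fun ω => catalystEstimate α (fun s => x s ω) s) 2 Pr := by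
  cases s with
  | zero => exact hx 0
  | succ s => exact (hx s).add (((hx (s + 1)).sub (hx s)).const_smul _)

theorem convex_convergence (hL : 0 < L) (hM : 1 ≤ M) (hΔ : 0 < Δ) (hγ : 0 < γ)
    (hF : ∀ m, IsLSmooth L (F m)) (hc : ∀ m, ConvexOn ℝ Set.univ (F m))
    (hr : IsMinOn (globalObjective F) Set.univ r) (hD : ‖x₀ - r‖ ≤ D)
    (hg : IsStochasticOracle F P g σ) (hξ : AreFreshSamples P Pr ξ)
    {X : ℝ} {tol : ℕ → ℝ} (htol : tol = fun s : ℕ => 2 * Δ / (9 * ((s : ℝ) + 1) ^ (4 + γ)))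
    (hX0 : 0 < X) (hX : ∀ s < S, 1638 * convexBound L Δ D γ ≤ X * tol (s + 1))
    {run : ℕ → Ω → CatalystState V} (hrun : run = catalystScaffold L g ξ
      (catalystParams L M σ X tol) 1 (catalystBeta 0 1) x₀) :
    MeetsTolerances Pr (globalObjective F) L S run tol ∧
    (∀ s, Integrable (fun ω => globalObjective F (run s ω).iterate) Pr) ∧
    ∀ s < S, ∫ ω, globalObjective F (run (s + 1) ω).iterate ∂Pr - globalObjective F r
      ≤ catalystAlpha 0 1 s ^ 2 * convexBound L Δ D γ := by
  have hf := isLSmooth_globalObjective hM hF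
  have hcf := strongConvexOn_gradient_le_globalObjective (μ := 0) hM hF
    fun m => strongConvexOn_zero.2 (hc m)
  have hr0 := hr.gradient_eq_zero
  have hmin : ∀ x, globalObjective F r ≤ globalObjective F x := fun x => hr (Set.mem_univ x)
  set f := globalObjective F with hfd
  set B := convexBound L Δ D γ with hB
  have hBL : L * D ^ 2 + 4 / 3 * Δ ≤ B := le_convexBound hL hΔ hγ
  have htol0 : ∀ s, 0 < tol s := fun s => by rw [htol]; positivity
  set α := catalystAlpha 0 1 with hα
  have had := fun s => hrun ▸ catalystAdapted_catalystParams (θ := 1) (β := catalystBeta 0 1)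
    (x₀ := x₀) (L := L) hg hF hξ X tol s
  have hx := fun s => (had s).memLp_iterate
  set vv : ℕ → Ω → V := fun s ω => catalystEstimate α (fun s => (run s ω).iterate) s with hvv
  have hv : ∀ s, MemLp (vv s) 2 Pr := memLp_catalystEstimate hx
  have hfi := fun s => hf.integrable_comp (hx s)
  have hiX : ∀ s, Integrable (fun ω => ‖(run s ω).iterate - r‖ ^ 2) Pr :=
    fun s => ((hx s).sub (memLp_const r)).integrable_norm_sq
  have hiW : ∀ s, Integrable (fun ω => ‖vv s ω - r‖ ^ 2) Pr :=
    fun s => ((hv s).sub (memLp_const r)).integrable_norm_sq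
  set A : ℕ → ℝ := fun s => ∫ ω, (f (run s ω).iterate - f r) ∂Pr with hA
  set W : ℕ → ℝ := fun s => ∫ ω, ‖vv s ω - r‖ ^ 2 ∂Pr with hW
  have hA0 : ∀ s, 0 ≤ A s := fun s => integral_nonneg fun ω => sub_nonneg.2 (hmin _)
  have hW0 : ∀ s, 0 ≤ W s := fun s => integral_nonneg fun ω => sq_nonneg _
  have hnext : ∀ s ω, (run s ω).nextCenter
      = (1 - α s) • (run s ω).iterate + α s • vv s ω := by
    intro s ω
    cases s with
    | zero =>
      have h1 : vv 0 ω = (run 0 ω).iterate := rfl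
      rw [h1, ← add_smul, sub_add_cancel, one_smul, hrun]
      rfl
    | succ s =>
      have h1 := nextCenter_convex hα (fun s => (run s ω).iterate) s
      simp only [hvv]
      rw [← h1, hrun]
      rfl
  have hcenter : ∀ s ω, (run (s + 1) ω).center = (run s ω).nextCenter :=
    fun s ω => by rw [hrun]; rfl
  have hsucc : ∀ s ω, (run (s + 1) ω).iterate
      = (1 - α s) • (run s ω).iterate + α s • vv (s + 1) ω := fun s ω =>
    catalystEstimate_succ (catalystAlpha_convex_pos s).ne' fun s => (run s ω).iterate
  -- The identity `(1 - αₛ₊₁) / αₛ₊₁² = 1 / αₛ²` makes successive steps chain. Since `α₀ = 1`, the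
  -- gap term is absent from `H 0`.
  set H : ℕ → ℝ := fun s => (1 - α s) / α s ^ 2 * A s + L * W s with hH
  -- The exponent `4 + γ` of the tolerance splits as `2 + 2 (1 + γ/2)`: the `2` pays for `1 / αₛ²`,
  -- one summable factor pays for the division by `t s`, and the other remains. The error is thus at
  -- most `4/3 Δ t s`.
  set t : ℕ → ℝ := fun s => 1 / 2 * (1 / ((s : ℝ) + 2) ^ (1 + γ / 2)) with ht
  -- one iteration
  have hstep : ∀ s, ∫ ω, ‖(run (s + 1) ω).iterate - proxPoint f L (run (s + 1) ω).center‖ ^ 2 ∂Pr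
      ≤ 2 * tol (s + 1) / (3 * L) →
      H (s + 1) + 4 / 3 * Δ ≤ Real.exp (2 * t s) * (H s + 4 / 3 * Δ) := by
    intro s hs
    have ha0 := catalystAlpha_convex_pos s
    have ha1 := catalystAlpha_convex_le_one s
    rw [← hα] at ha0 ha1
    set w : ℝ := ((s : ℝ) + 2) ^ (1 + γ / 2) with hw
    have hn2 : (2 : ℝ) ≤ (s : ℝ) + 2 := by linarith [Nat.cast_nonneg (α := ℝ) s]
    have hw1 : 1 ≤ w := Real.one_le_rpow (by linarith) (by linarith)
    have hts : t s = 1 / 2 * (1 / w) := rfl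
    have ht0 : 0 < t s := by rw [hts]; positivity
    have ht1 : t s ≤ 1 / 2 := by
      have : 1 / w ≤ 1 := by rw [div_le_one (by linarith)]; exact hw1
      rw [hts]
      linarith
    have htols : tol (s + 1) = 2 * Δ / (9 * (((s : ℝ) + 2) ^ 2 * w ^ 2)) := by
      rw [htol]
      simp only
      congr 2
      push_cast
      rw [show (s : ℝ) + 1 + 1 = (s : ℝ) + 2 by ring, hw, ← Real.rpow_natCast _ 2,
        ← Real.rpow_natCast _ 2, ← Real.rpow_mul (by linarith), ← Real.rpow_add (by linarith)]
      congr 1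
      push_cast
      ring
    have h1 := integral_mono
      (((hfi (s + 1)).sub (integrable_const (f r))).const_mul (1 / α s ^ 2) |>.add
        ((hiW (s + 1)).const_mul (L * (1 - t s))))
      ((((hfi s).sub (integrable_const (f r))).const_mul ((1 - α s) / α s ^ 2) |>.add
        ((hiW s).const_mul L)).add
        ((((hx (s + 1)).sub (hf.memLp_proxPoint_comp hL
          (had (s + 1)).memLp_center)).integrable_norm_sq).const_mul
            (9 * L / (4 * t s * α s ^ 2)))) fun ω =>
      convex_step (r := r) hL ha0 ha1 ht0 hf hcf ((hcenter s ω).trans (hnext s ω)) (hsucc s ω)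
    rw [integral_add' (((hfi (s + 1)).sub (integrable_const (f r))).const_mul (1 / α s ^ 2))
        ((hiW (s + 1)).const_mul (L * (1 - t s))),
      integral_add' (((hfi s).sub (integrable_const (f r))).const_mul ((1 - α s) / α s ^ 2) |>.add
        ((hiW s).const_mul L)) ((((hx (s + 1)).sub (hf.memLp_proxPoint_comp hL
          (had (s + 1)).memLp_center)).integrable_norm_sq).const_mul
            (9 * L / (4 * t s * α s ^ 2))),
      integral_add' (((hfi s).sub (integrable_const (f r))).const_mul ((1 - α s) / α s ^ 2))
        ((hiW s).const_mul L)] at h1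
    simp only [integral_const_mul, Pi.sub_apply] at h1
    have h2 : 9 * L / (4 * t s * α s ^ 2) * ∫ ω, ‖(run (s + 1) ω).iterate
        - proxPoint f L (run (s + 1) ω).center‖ ^ 2 ∂Pr ≤ 4 / 3 * Δ * t s := by
      calc _ ≤ 9 * L / (4 * t s * α s ^ 2) * (2 * tol (s + 1) / (3 * L)) := by gcongr
        _ = 2 * Δ / (3 * w) * ((1 / α s) ^ 2 / ((s : ℝ) + 2) ^ 2) := by
          rw [htols, hts]
          field_simp
          norm_num
        _ ≤ 2 * Δ / (3 * w) * 1 := by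
          gcongr
          rw [div_le_one (by positivity)]
          gcongr
          linarith [(catalystAlpha_convex_inv_bounds s).2]
        _ = 4 / 3 * Δ * t s := by rw [hts]; field_simp; norm_num
    have h3 : (1 - α (s + 1)) / α (s + 1) ^ 2 = 1 / α s ^ 2 := by
      have h4 := catalystAlpha_convex_succ s
      have h5 := catalystAlpha_convex_pos (s + 1)
      rw [← hα] at h4 h5
      rw [div_eq_div_iff (by positivity) (by positivity)]
      linarith
    -- The shift by `4/3 Δ` makes the recursion purely multiplicative: multiplying it by `1 - t s`
    -- loses exactly the additive error `4/3 Δ t s`.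
    have h6 : (1 - t s) * (H (s + 1) + 4 / 3 * Δ) ≤ H s + 4 / 3 * Δ := by
      have h7 : 0 ≤ t s * (1 / α s ^ 2 * A (s + 1)) := by
        have := hA0 (s + 1)
        positivity
      simp only [hH, h3]
      change 1 / α s ^ 2 * A (s + 1) + L * (1 - t s) * W (s + 1) ≤ _ at h1
      change _ ≤ (1 - α s) / α s ^ 2 * A s + L * W s + _ at h1
      linarith
    have h8 := exp_two_mul_ge ht0.le ht1
    have h9 : 0 ≤ H (s + 1) + 4 / 3 * Δ := by
      simp only [hH, h3]
      have := hA0 (s + 1)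
      have := hW0 (s + 1)
      positivity
    calc H (s + 1) + 4 / 3 * Δ ≤ ((1 - t s) * Real.exp (2 * t s)) * (H (s + 1) + 4 / 3 * Δ) :=
          le_mul_of_one_le_left h9 h8
      _ = Real.exp (2 * t s) * ((1 - t s) * (H (s + 1) + 4 / 3 * Δ)) := by ring
      _ ≤ _ := by gcongr
  have hD2 : ‖x₀ - r‖ ^ 2 ≤ D ^ 2 := pow_le_pow_left₀ (norm_nonneg _) hD 2
  have h00 : ∀ ω, (run 0 ω).iterate = x₀ := fun ω => by rw [hrun]; rfl
  have hv0 : ∀ ω, vv 0 ω = x₀ := h00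
  have hbound : ∀ s, H s + 4 / 3 * Δ
      ≤ Real.exp (∑ n ∈ Finset.range s, 1 / ((n : ℝ) + 2) ^ (1 + γ / 2))
        * (L * D ^ 2 + 4 / 3 * Δ) → H s ≤ B := by
    intro s h
    have h1 : Real.exp (∑ n ∈ Finset.range s, 1 / ((n : ℝ) + 2) ^ (1 + γ / 2))
        * (L * D ^ 2 + 4 / 3 * Δ) ≤ B := by
      rw [hB, convexBound]
      gcongr
      exact sum_le_youngSum hγ s
    linarith
  have hWB : ∀ s, H s ≤ B → W s ≤ B / L := by
    intro s h
    rw [le_div_iff₀ hL]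
    have h1 : 0 ≤ (1 - α s) / α s ^ 2 * A s := by
      have := hA0 s
      have := sub_nonneg.2 (catalystAlpha_convex_le_one s)
      rw [← hα] at this
      positivity
    simp only [hH] at h
    linarith
  have htolstep : ∀ s < S, (∀ u ≤ s, ∫ ω, ‖(run u ω).iterate - r‖ ^ 2 ∂Pr ≤ B / L) →
      ∫ ω, ‖(run (s + 1) ω).iterate - proxPoint f L (run (s + 1) ω).center‖ ^ 2 ∂Pr
        ≤ 2 * tol (s + 1) / (3 * L) := by
    intro s hs h
    have h1 := integral_norm_start_sub_proxPoint_sq_le hL hM hg hF hξ hr0 zero_le_one le_rfl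
      (fun s => (catalystBeta_convex_mem s).1) (fun s => (catalystBeta_convex_mem s).2) hrun h
    have h2 : 273 * (B / L) ≤ X * tol (s + 1) / (6 * L) := by
      rw [le_div_iff₀ (by positivity)]
      calc 273 * (B / L) * (6 * L) = 1638 * B := by field_simp; ring
        _ ≤ _ := hX s hs
    rw [hrun] at h1 ⊢
    exact catalystParams_accuracy hL hM hg hF hξ hX0 htol0 (h1.trans h2)
  -- The bound on `H` and the bound on all iterates so far are carried together: the iterates yield
  -- the next accuracy, this yields the next `H`, and the new iterate is a convex combination of the
  -- old one and `v`, both within `B / L` of `r` in mean square.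
  have hmain : ∀ s ≤ S, (H s + 4 / 3 * Δ
      ≤ Real.exp (∑ n ∈ Finset.range s, 1 / ((n : ℝ) + 2) ^ (1 + γ / 2))
        * (L * D ^ 2 + 4 / 3 * Δ)) ∧
      ∀ u ≤ s, ∫ ω, ‖(run u ω).iterate - r‖ ^ 2 ∂Pr ≤ B / L := by
    intro s
    induction s with
    | zero =>
      intro _
      have h1 : W 0 = ‖x₀ - r‖ ^ 2 := by simp [hW, hv0]
      have h2 : α 0 = 1 := rfl
      constructor
      · simp only [hH, h1, h2]
        simp only [Finset.range_zero, Finset.sum_empty, Real.exp_zero]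
        have := mul_le_mul_of_nonneg_left hD2 hL.le
        linarith
      · intro u hu
        rw [Nat.le_zero.1 hu, le_div_iff₀ hL]
        simp only [h00, integral_const, probReal_univ, one_smul]
        nlinarith
    | succ s ih =>
      intro hs
      obtain ⟨i1, i2⟩ := ih (by omega)
      have h1 := hstep s (htolstep s (by omega) i2)
      have h2 : H (s + 1) + 4 / 3 * Δ
          ≤ Real.exp (∑ n ∈ Finset.range (s + 1), 1 / ((n : ℝ) + 2) ^ (1 + γ / 2))
            * (L * D ^ 2 + 4 / 3 * Δ) := by
        refine h1.trans ?_
        rw [Finset.sum_range_succ, Real.exp_add, mul_comm (Real.exp (∑ n ∈ _, _)), mul_assoc]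
        have h3 : 2 * t s = 1 / ((s : ℝ) + 2) ^ (1 + γ / 2) := by simp only [ht]; ring
        rw [h3]
        gcongr
      refine ⟨h2, fun u hu => ?_⟩
      rcases Nat.lt_or_ge u (s + 1) with h | h
      · exact i2 u (by omega)
      · obtain rfl : u = s + 1 := le_antisymm hu h
        have h4 := hWB _ (hbound _ h2)
        have h5 := i2 s le_rfl
        have ha0 := catalystAlpha_convex_pos s
        have ha1 := catalystAlpha_convex_le_one s
        rw [← hα] at ha0 ha1
        have h6 := integral_mono (hiX (s + 1)) (((hiX s).const_mul (1 - α s)).add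
          ((hiW (s + 1)).const_mul (α s))) fun ω => by
          have h7 := norm_convex_combination_sq_le ha0.le ha1 ((run s ω).iterate - r)
            (vv (s + 1) ω - r)
          rw [show (1 - α s) • ((run s ω).iterate - r) + α s • (vv (s + 1) ω - r)
            = (run (s + 1) ω).iterate - r by rw [hsucc]; module] at h7
          exact h7
        rw [integral_add' ((hiX s).const_mul (1 - α s)) ((hiW (s + 1)).const_mul (α s))] at h6
        simp only [integral_const_mul] at h6
        have h8 := mul_le_mul_of_nonneg_left h5 (sub_nonneg.2 ha1)
        have h9 := mul_le_mul_of_nonneg_left h4 ha0.le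
        simp only [hW] at h9
        linarith
  have htolS := fun s (hs : s < S) => htolstep s hs (hmain s hs.le).2
  refine ⟨?_, hfi, fun s hs => ?_⟩
  · rw [hrun] at htolS ⊢
    exact meetsTolerances_catalystParams hL hM hg hF hξ htolS
  · have h1 := hbound _ (hmain (s + 1) hs).1
    have h2 : (1 - α (s + 1)) / α (s + 1) ^ 2 = 1 / α s ^ 2 := by
      have h4 := catalystAlpha_convex_succ s
      have h5 := catalystAlpha_convex_pos (s + 1)
      have h6 := catalystAlpha_convex_pos s
      rw [← hα] at h4 h5 h6
      rw [div_eq_div_iff (by positivity) (by positivity)]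
      linarith
    have ha0 := catalystAlpha_convex_pos s
    rw [← hα] at ha0
    have h3 : A (s + 1) = ∫ ω, f (run (s + 1) ω).iterate ∂Pr - f r := by
      simp only [hA]
      rw [integral_sub (hfi _) (integrable_const _), integral_const, probReal_univ, one_smul]
    rw [← h3]
    simp only [hH, h2] at h1
    have h4 : 1 / α s ^ 2 * A (s + 1) ≤ B := by
      have := mul_nonneg hL.le (hW0 (s + 1))
      linarith
    rw [one_div_mul_eq_div, div_le_iff₀ (by positivity)] at h4
    linarith

end ConvexConvergence

/-- The gap after `S` iterations is at most `4B/S²`, so `S` is of order `1/√ε`. The tolerances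
decrease, so the `X` for the last subproblem serves all of them, and the sum of `1 / tol s` is at
most `S / tol S`, of order `S ^ (5 + γ)`. This is the origin of the exponent `2.5 + γ/2`. -/
theorem convex_cost {L Δ D γ : ℝ} (hL : 0 < L) (hΔ : 0 < Δ) (hγ : 0 < γ) (hγ1 : γ ≤ 1) :
    ∃ C : ℝ, ∀ (M : ℕ) (σ ε : ℝ), 1 ≤ M → 0 ≤ σ → 0 < ε → ε ≤ 1 →
      ∃ (S : ℕ) (X : ℝ), 1 ≤ S ∧ 0 < X ∧
        (∀ s < S, 1638 * convexBound L Δ D γ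
          ≤ X * (2 * Δ / (9 * (((s + 1 : ℕ) : ℝ) + 1) ^ (4 + γ)))) ∧
        4 * convexBound L Δ D γ ≤ ε * (S : ℝ) ^ 2 ∧
        (totalComm S (catalystParams L M σ X fun s : ℕ =>
          2 * Δ / (9 * ((s : ℝ) + 1) ^ (4 + γ))) : ℝ)
            ≤ C * (1 / √ε) * Real.log (2 + σ + 1 / ε) ∧
        (totalSamples S (catalystParams L M σ X fun s : ℕ =>
          2 * Δ / (9 * ((s : ℝ) + 1) ^ (4 + γ))) : ℝ)
            ≤ C * (1 / √ε + σ ^ 2 / (M * ε ^ (2.5 + γ / 2 : ℝ))) * Real.log (2 + σ + 1 / ε) := by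
  have hBL := le_convexBound (D := D) hL hΔ hγ
  set B := convexBound L Δ D γ
  have hBΔ : 4 / 3 * Δ ≤ B := by
    have : 0 ≤ L * D ^ 2 := by positivity
    linarith
  have hB0 : 0 < B := by linarith
  set b := 2 * √B + 3 with hb
  have hb1 : 1 ≤ b := by linarith [Real.sqrt_nonneg B]
  have hb0 : 0 < b := by linarith
  -- The number `7371 = 1638 · 9/2` comes from dividing by the `2Δ/9` in the tolerance, and `b / √ε`
  -- will bound `S + 1`.
  set c := Real.log (7371 * B / Δ * b ^ 5) with hc
  have hBΔ' : 1 ≤ 7371 * B / Δ := by rw [one_le_div hΔ]; linarith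
  have hc0 : 0 ≤ c := Real.log_nonneg (one_le_mul_of_one_le_of_one_le hBΔ' (one_le_pow₀ hb1))
  refine ⟨b * (48 * c + 149) + (24 * c + 74) * (27 / (2 * L * Δ)) * b ^ (5 + γ), ?_⟩
  intro M σ ε hM hσ hε hε1
  have hM0 : (0 : ℝ) < M := by exact_mod_cast hM
  have hsε : 0 < √ε := Real.sqrt_pos.2 hε
  have hsε1 : √ε ≤ 1 := Real.sqrt_le_one.2 hε1
  have hsεε : ε ≤ √ε := by
    have := Real.mul_self_sqrt hε.le
    nlinarith
  have hsε' : 1 ≤ 1 / √ε := by rw [le_div_iff₀ hsε, one_mul]; exact hsε1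
  set S := ⌈2 * √B / √ε⌉₊ + 1 with hS
  have hS1 : 1 ≤ S := Nat.le_add_left _ _
  have hSc : (S : ℝ) = ⌈2 * √B / √ε⌉₊ + 1 := by rw [hS]; push_cast; ring
  have hSle : (S : ℝ) + 1 ≤ b * (1 / √ε) := by
    have h := (Nat.ceil_lt_add_one (show 0 ≤ 2 * √B / √ε by positivity)).le
    rw [hSc, hb, add_mul, mul_one_div]
    linarith
  have hS0 : (0 : ℝ) < S := by exact_mod_cast hS1
  set Λ := Real.log (2 + σ + 1 / ε) with hΛ
  have hε' : 1 ≤ 1 / ε := by rw [le_div_iff₀ hε, one_mul]; exact hε1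
  have hΛ1 : 1 ≤ Λ := one_le_log_of_three_le (by linarith)
  have hlogε : Real.log (1 / ε) ≤ Λ := Real.log_le_log (by positivity) (by linarith)
  set tol : ℕ → ℝ := fun s : ℕ => 2 * Δ / (9 * ((s : ℝ) + 1) ^ (4 + γ)) with htol
  have htol0 : ∀ s, 0 < tol s := fun s => by simp only [htol]; positivity
  have htolS : ∀ s ≤ S, tol S ≤ tol s := by
    intro s hs
    simp only [htol]
    have hs' : (s : ℝ) ≤ S := by exact_mod_cast hs
    gcongr
  set X := 1638 * B / tol S with hX
  have hX0 : 0 < X := div_pos (by positivity) (htol0 S)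
  have hXeq : X = 7371 * B / Δ * ((S : ℝ) + 1) ^ (4 + γ) := by
    simp only [hX, htol]
    field_simp
    norm_num
  have hX1 : 1 ≤ X := by
    rw [hXeq]
    exact one_le_mul_of_one_le_of_one_le hBΔ' (Real.one_le_rpow (by linarith) (by linarith))
  have hlogX : Real.log X ≤ c + 3 * Λ := by
    calc Real.log X ≤ Real.log (7371 * B / Δ * b ^ 5 * (1 / ε) ^ 3) := by
          refine Real.log_le_log hX0 ?_
          rw [hXeq, mul_assoc]
          gcongr
          calc ((S : ℝ) + 1) ^ (4 + γ) ≤ ((S : ℝ) + 1) ^ (5 : ℝ) :=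
                Real.rpow_le_rpow_of_exponent_le (by linarith) (by linarith)
            _ = ((S : ℝ) + 1) ^ 5 := by rw [← Real.rpow_natCast]; norm_num
            _ ≤ (b * (1 / √ε)) ^ 5 := by gcongr
            _ = b ^ 5 * (1 / √ε) ^ 5 := by ring
            -- Rounding the exponent up to an even number gives a whole power of `1/ε`, at no cost
            -- beyond the constant in front of the logarithm.
            _ ≤ b ^ 5 * (1 / √ε) ^ 6 :=
              mul_le_mul_of_nonneg_left (pow_le_pow_right₀ hsε' (by norm_num)) (by positivity)
            _ = b ^ 5 * (1 / ε) ^ 3 := by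
              rw [show (1 / √ε) ^ 6 = 1 / (√ε ^ 2) ^ 3 by ring, Real.sq_sqrt hε.le, one_div_pow]
      _ = c + 3 * Real.log (1 / ε) := by
          rw [Real.log_mul (by positivity) (by positivity), Real.log_pow]; push_cast; ring
      _ ≤ c + 3 * Λ := by linarith
  set T := roundsFor X with hT
  have hTle : (T : ℝ) ≤ (24 * c + 74) * Λ := by
    have h := roundsFor_le hX1
    nlinarith
  have hT0 : (0 : ℝ) ≤ T := Nat.cast_nonneg _
  have hLΔ := mul_pos hL hΔ
  refine ⟨S, X, hS1, hX0, fun s hs => ?_, ?_, ?_, ?_⟩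
  · calc 1638 * B = X * tol S := by rw [hX, div_mul_cancel₀ _ (htol0 S).ne']
      _ ≤ X * tol (s + 1) := by
        gcongr
        exact htolS (s + 1) hs
  · have h := Nat.le_ceil (2 * √B / √ε)
    have h1 : 2 * √B / √ε ≤ S := by rw [hSc]; linarith
    rw [div_le_iff₀ hsε] at h1
    have h2 := pow_le_pow_left₀ (by positivity) h1 2
    rw [mul_pow, mul_pow, Real.sq_sqrt hB0.le, Real.sq_sqrt hε.le] at h2
    linarith
  · rw [totalComm_catalystParams, ← hT]
    calc (S : ℝ) * (1 + T) ≤ (b * (1 / √ε)) * (Λ + (24 * c + 74) * Λ) := by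
          gcongr; linarith
      _ = b * (24 * c + 75) * (1 / √ε) * Λ := by ring
      _ ≤ _ := by
        gcongr
        have h1 : 0 ≤ (24 * c + 74) * (27 / (2 * L * Δ)) * b ^ (5 + γ) := by positivity
        nlinarith
  · refine (totalSamples_catalystParams_le hL σ _ htol0 S).trans ?_
    rw [← hT]
    have h1 : (S : ℝ) * (1 + 2 * T) ≤ b * (48 * c + 149) * (1 / √ε) * Λ := by
      calc (S : ℝ) * (1 + 2 * T) ≤ (b * (1 / √ε)) * (Λ + 2 * ((24 * c + 74) * Λ)) := by
            gcongr; linarith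
        _ = _ := by ring
    have hsum : ∑ s ∈ Finset.Icc 1 S, 1 / tol s
        ≤ 9 / (2 * Δ) * b ^ (5 + γ) * (1 / ε ^ (2.5 + γ / 2 : ℝ)) := by
      calc ∑ s ∈ Finset.Icc 1 S, 1 / tol s ≤ ∑ _s ∈ Finset.Icc 1 S, 1 / tol S := by
            refine Finset.sum_le_sum fun s hs => ?_
            exact one_div_le_one_div_of_le (htol0 S) (htolS s (Finset.mem_Icc.1 hs).2)
        _ = S * (9 / (2 * Δ) * ((S : ℝ) + 1) ^ (4 + γ)) := by
            rw [Finset.sum_const, Nat.card_Icc, nsmul_eq_mul, Nat.add_sub_cancel]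
            simp only [htol]
            field_simp
        _ ≤ ((S : ℝ) + 1) * (9 / (2 * Δ) * ((S : ℝ) + 1) ^ (4 + γ)) := by gcongr; linarith
        _ = 9 / (2 * Δ) * ((S : ℝ) + 1) ^ (5 + γ) := by
            rw [show 5 + γ = 1 + (4 + γ) by ring, Real.rpow_add (by linarith) 1, Real.rpow_one]
            ring
        _ ≤ 9 / (2 * Δ) * (b * (1 / √ε)) ^ (5 + γ) := by gcongr
        _ = _ := by
            rw [Real.mul_rpow hb0.le (by positivity), Real.div_rpow zero_le_one hsε.le,
              Real.one_rpow, Real.sqrt_eq_rpow, ← Real.rpow_mul hε.le,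
              show 1 / 2 * (5 + γ) = 2.5 + γ / 2 by ring, mul_assoc]
    have h2 : T * (3 * σ ^ 2 / (L * M)) * ∑ s ∈ Finset.Icc 1 S, 1 / tol s
        ≤ (24 * c + 74) * (27 / (2 * L * Δ)) * b ^ (5 + γ)
          * (σ ^ 2 / (M * ε ^ (2.5 + γ / 2 : ℝ))) * Λ := by
      calc _ ≤ ((24 * c + 74) * Λ) * (3 * σ ^ 2 / (L * M))
            * (9 / (2 * Δ) * b ^ (5 + γ) * (1 / ε ^ (2.5 + γ / 2 : ℝ))) := by gcongr
        _ = _ := by field_simp; ring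
    have h3 : 0 ≤ (24 * c + 74) * (27 / (2 * L * Δ)) * b ^ (5 + γ) * (1 / √ε) * Λ := by positivity
    have h4 : 0 ≤ b * (48 * c + 149) * (σ ^ 2 / (M * ε ^ (2.5 + γ / 2 : ℝ))) * Λ := by positivity
    linarith

/-! ### The strongly convex case -/

section StronglyConvex

/-- The value `√q` is a fixed point of the recursion, so all parameters are constant in the strongly
convex case. -/
theorem catalystAlpha_sqrt {q : ℝ} (hq : 0 < q) (s : ℕ) : catalystAlpha q (√q) s = √q := by
  induction s with
  | zero => rfl
  | succ s ih =>
    rw [catalystAlpha, ih, Real.sq_sqrt hq.le, sub_self, zero_add, zero_pow two_ne_zero, zero_add,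
      Real.sqrt_mul (by norm_num), show (4 : ℝ) = 2 ^ 2 by norm_num, Real.sqrt_sq (by norm_num)]
    ring

theorem catalystBeta_sqrt {q : ℝ} (hq : 0 < q) (s : ℕ) :
    catalystBeta q (√q) s = (1 - √q) / (1 + √q) := by
  have h : 0 < √q := Real.sqrt_pos.2 hq
  rw [catalystBeta, catalystAlpha_sqrt hq, catalystAlpha_sqrt hq]
  field_simp
  ring

variable {V : Type*} [NormedAddCommGroup V] [InnerProductSpace ℝ V] [CompleteSpace V] {L μ : ℝ}

/-- The proximal displacement `x' - y` is a multiple of `(v' - r) - w`, where `w` averages `v - r`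
and `x' - r` with weights `1 - a` and `a`. Convexity of the squared norm gives the contraction `1 -
a` of the distance term, and its extra `a μ/2 ‖x' - r‖²` cancels against the strong convexity term
of `accelerated_step`. -/
theorem stronglyConvex_step {f : V → ℝ} {a : ℝ} {x x' v v' y r : V} (hL : 0 < L) (hμ : 0 < μ)
    (ha0 : 0 < a) (ha1 : a ≤ 1) (haL : 2 * L * a ^ 2 = μ * (1 - a ^ 2)) (hf : IsLSmooth L f)
    (hc : ∀ x z, f x + inner ℝ (gradient f x) (z - x) + μ / 2 * ‖z - x‖ ^ 2 ≤ f z)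
    (hy : y = (1 / (1 + a)) • (x + a • v)) (hx' : x' = (1 - a) • x + a • v') :
    f x' - f r + (1 - a / 20) * (μ / 2 * ‖v' - r‖ ^ 2)
      ≤ (1 - a) * (f x - f r + μ / 2 * ‖v - r‖ ^ 2)
        + 90 * a * L ^ 2 / μ * ‖x' - proxPoint f L y‖ ^ 2 := by
  have h1 := accelerated_step (r := r) ha0.le ha1 hμ.le hc hx'
  set e := gradient f x' + (2 * L) • (x' - y) with he
  set w := (1 - a) • (v - r) + a • (x' - r) with hw
  have ha2 : 1 + a ≠ 0 := by positivity
  -- Here `2 L a² = μ (1 - a²)` is used, that is, `a² = μ / (μ + 2L)`.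
  have h2 : (2 * L * a) • (x' - y) = μ • ((v' - r) - w) := by
    have hLe : 2 * L * a = μ * (1 - a ^ 2) / a := by
      rw [eq_div_iff ha0.ne']
      linarith
    rw [hLe, hw, hy, hx']
    match_scalars <;> field_simp <;> ring
  have h3 : a * inner ℝ (gradient f x') (v' - r) = a * inner ℝ e (v' - r)
      + μ * (inner ℝ w (v' - r) - ‖v' - r‖ ^ 2) := by
    have h4 : a • gradient f x' = a • e - μ • ((v' - r) - w) := by
      rw [← h2, he]
      module
    rw [← real_inner_smul_left, h4, inner_sub_left, real_inner_smul_left, real_inner_smul_left,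
      inner_sub_left, real_inner_self_eq_norm_sq]
    ring
  have h5 : 2 * inner ℝ w (v' - r) ≤ ‖w‖ ^ 2 + ‖v' - r‖ ^ 2 := by
    have := norm_sub_sq_real w (v' - r)
    linarith [sq_nonneg ‖w - (v' - r)‖]
  have h6 := norm_convex_combination_sq_le ha0.le ha1 (v - r) (x' - r)
  rw [← hw] at h6
  -- The Young constant is chosen so that the pairing with `e` costs a fraction `a/20` of the
  -- distance term of the Lyapunov function.
  have h7 := mul_inner_le_young (a := a) (show 0 < μ / (40 * a) by positivity) e (v' - r)
  have h8 : ‖e‖ ^ 2 ≤ 9 * L ^ 2 * ‖x' - proxPoint f L y‖ ^ 2 :=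
    hf.norm_prox_gradient_sq_le hL y x'
  have h9 : ‖e‖ ^ 2 / (4 * (μ / (40 * a)))
      ≤ 90 * a * L ^ 2 / μ * ‖x' - proxPoint f L y‖ ^ 2 := by
    calc ‖e‖ ^ 2 / (4 * (μ / (40 * a)))
        ≤ 9 * L ^ 2 * ‖x' - proxPoint f L y‖ ^ 2 / (4 * (μ / (40 * a))) := by gcongr
      _ = _ := by field_simp; ring
  have h10 : μ / (40 * a) * a ^ 2 * ‖v' - r‖ ^ 2 = a / 20 * (μ / 2 * ‖v' - r‖ ^ 2) := by
    field_simp; ring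
  have h11 : μ / 2 * (2 * inner ℝ w (v' - r)) ≤ μ / 2 * (‖w‖ ^ 2 + ‖v' - r‖ ^ 2) := by gcongr
  have h12 : μ / 2 * ‖w‖ ^ 2 ≤ μ / 2 * ((1 - a) * ‖v - r‖ ^ 2 + a * ‖x' - r‖ ^ 2) := by gcongr
  rw [norm_sub_rev r x'] at h1
  linarith

theorem nextCenter_stronglyConvex {q : ℝ} (hq : 0 < q) (x : ℕ → V) (s : ℕ) :
    x (s + 1) + catalystBeta q (√q) (s + 1) • (x (s + 1) - x s)
      = (1 / (1 + √q)) • (x (s + 1) + √q • catalystEstimate (fun _ => √q) x (s + 1)) := by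
  have h : 0 < √q := Real.sqrt_pos.2 hq
  rw [catalystBeta_sqrt hq, catalystEstimate]
  match_scalars <;> field_simp <;> ring

end StronglyConvex

/-! ### Convergence in the strongly convex case -/

section StronglyConvexConvergence

variable {Ω Ξ V : Type*} [MeasurableSpace Ω] [MeasurableSpace Ξ] {M : ℕ}
  {P : Fin M → Measure Ξ} {Pr : Measure Ω} {ξ : ℕ → ℕ → Fin M → Ω → Ξ}
  [NormedAddCommGroup V] [InnerProductSpace ℝ V] [CompleteSpace V]
  [SecondCountableTopology V] [MeasurableSpace V] [BorelSpace V] [IsProbabilityMeasure Pr]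
  {F : Fin M → V → ℝ} {g : Fin M → V → Ξ → V} {L μ σ Δ : ℝ} {x₀ r : V} {S : ℕ}

theorem stronglyConvex_convergence (hL : 0 < L) (hM : 1 ≤ M) (hμ : 0 < μ)
    (hΔ : 0 < Δ) (hF : ∀ m, IsLSmooth L (F m)) (hc : ∀ m, StrongConvexOn Set.univ μ (F m))
    (hr : IsMinOn (globalObjective F) Set.univ r)
    (hx₀ : globalObjective F x₀ - globalObjective F r ≤ Δ)
    (hg : IsStochasticOracle F P g σ) (hξ : AreFreshSamples P Pr ξ)
    {q X : ℝ} {tol : ℕ → ℝ} (hq : q = μ / (μ + 2 * L))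
    (htol : tol = fun s : ℕ => 2 * (1 - 0.9 * √q) ^ s * Δ / 9)
    (hX0 : 0 < X) (hX : ∀ s < S, 491400 * L * Δ / (μ * q) ≤ X * tol (s + 1))
    {run : ℕ → Ω → CatalystState V} (hrun : run = catalystScaffold L g ξ
      (catalystParams L M σ X tol) (2 * L / (2 * L + μ)) (catalystBeta q (√q)) x₀) :
    MeetsTolerances Pr (globalObjective F) L S run tol ∧
    (∀ s, Integrable (fun ω => globalObjective F (run s ω).iterate) Pr) ∧
    ∀ s ≤ S, ∫ ω, globalObjective F (run s ω).iterate ∂Pr - globalObjective F r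
      ≤ 150 * (1 - 0.9 * √q) ^ s * Δ / q := by
  have hf := isLSmooth_globalObjective hM hF
  have hcf := strongConvexOn_gradient_le_globalObjective hM hF hc
  have hr0 := hr.gradient_eq_zero
  have hmin : ∀ x, globalObjective F r ≤ globalObjective F x := fun x => hr (Set.mem_univ x)
  have hq0 : 0 < q := by rw [hq]; positivity
  have hq1 : q ≤ 1 := by rw [hq, div_le_one (by positivity)]; linarith
  set f := globalObjective F with hfd
  set a := √q with ha
  have haq : a ^ 2 = q := Real.sq_sqrt hq0.le
  have ha0 : 0 < a := Real.sqrt_pos.2 hq0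
  have ha1 : a ≤ 1 := Real.sqrt_le_one.2 hq1
  have haL : 2 * L * a ^ 2 = μ * (1 - a ^ 2) := by
    rw [haq, hq]
    field_simp
    ring
  have hρ : (0 : ℝ) < 1 - 0.9 * a := by norm_num; linarith
  have htol0 : ∀ s, 0 < tol s := fun s => by rw [htol]; positivity
  have hβ : ∀ s, 0 ≤ catalystBeta q a (s + 1) ∧ catalystBeta q a (s + 1) ≤ 1 := fun s => by
    rw [catalystBeta_sqrt hq0]
    exact ⟨div_nonneg (by linarith) (by positivity), by rw [div_le_one (by positivity)]; linarith⟩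
  have had := fun s => hrun ▸ catalystAdapted_catalystParams (θ := 2 * L / (2 * L + μ))
    (β := catalystBeta q a) (x₀ := x₀) (L := L) hg hF hξ X tol s
  have hx := fun s => (had s).memLp_iterate
  set vv : ℕ → Ω → V := fun s ω => catalystEstimate (fun _ => a) (fun s => (run s ω).iterate) s
    with hvv
  have hv : ∀ s, MemLp (vv s) 2 Pr := memLp_catalystEstimate hx
  have hfi := fun s => hf.integrable_comp (hx s)
  have hiW : ∀ s, Integrable (fun ω => ‖vv s ω - r‖ ^ 2) Pr :=
    fun s => ((hv s).sub (memLp_const r)).integrable_norm_sq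
  set A : ℕ → ℝ := fun s => ∫ ω, (f (run s ω).iterate - f r) ∂Pr with hA
  set W : ℕ → ℝ := fun s => ∫ ω, ‖vv s ω - r‖ ^ 2 ∂Pr with hW
  have hiA : ∀ s, Integrable (fun ω => f (run s ω).iterate - f r) Pr :=
    fun s => (hfi s).sub (integrable_const _)
  have hA0 : ∀ s, 0 ≤ A s := fun s => integral_nonneg fun ω => sub_nonneg.2 (hmin _)
  have hW0 : ∀ s, 0 ≤ W s := fun s => integral_nonneg fun ω => sq_nonneg _
  have hnext : ∀ s ω, (run s ω).nextCenter
      = (1 / (1 + a)) • ((run s ω).iterate + a • vv s ω) := by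
    intro s ω
    cases s with
    | zero =>
      have h1 : vv 0 ω = (run 0 ω).iterate := rfl
      have h2 : (run 0 ω).iterate + a • (run 0 ω).iterate = (1 + a) • (run 0 ω).iterate := by
        module
      rw [h1, h2, smul_smul, one_div_mul_cancel (by positivity), one_smul, hrun]
      rfl
    | succ s =>
      have h1 := nextCenter_stronglyConvex hq0 (fun s => (run s ω).iterate) s
      simp only [hvv]
      rw [← h1, hrun]
      rfl
  have hcenter : ∀ s ω, (run (s + 1) ω).center = (run s ω).nextCenter :=
    fun s ω => by rw [hrun]; rfl
  have hsucc : ∀ s ω, (run (s + 1) ω).iterate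
      = (1 - a) • (run s ω).iterate + a • vv (s + 1) ω := fun s ω =>
    catalystEstimate_succ (α := fun _ => a) (s := s) ha0.ne' fun s => (run s ω).iterate
  set Ψ : ℕ → ℝ := fun s => A s + μ / 2 * W s with hΨ
  have hstep : ∀ s, ∫ ω, ‖(run (s + 1) ω).iterate - proxPoint f L (run (s + 1) ω).center‖ ^ 2 ∂Pr
      ≤ 2 * tol (s + 1) / (3 * L) → (1 - a / 20) * Ψ (s + 1) ≤ (1 - a) * Ψ s
        + 30 * tol (s + 1) / a := by
    intro s hs
    have hp : Integrable (fun ω => ‖(run (s + 1) ω).iterate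
        - proxPoint f L (run (s + 1) ω).center‖ ^ 2) Pr := ((hx (s + 1)).sub
      (hf.memLp_proxPoint_comp hL (had (s + 1)).memLp_center)).integrable_norm_sq
    have h1 := integral_mono ((hiA (s + 1)).add
        (((hiW (s + 1)).const_mul (μ / 2)).const_mul (1 - a / 20)))
      ((((hiA s).add ((hiW s).const_mul (μ / 2))).const_mul (1 - a)).add
        (hp.const_mul (90 * a * L ^ 2 / μ))) fun ω =>
      stronglyConvex_step (r := r) hL hμ ha0 ha1 haL hf hcf ((hcenter s ω).trans (hnext s ω))
        (hsucc s ω)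
    rw [integral_add' (hiA (s + 1)) (((hiW (s + 1)).const_mul (μ / 2)).const_mul (1 - a / 20)),
      integral_add' (((hiA s).add ((hiW s).const_mul (μ / 2))).const_mul (1 - a))
        (hp.const_mul (90 * a * L ^ 2 / μ))] at h1
    simp only [integral_const_mul] at h1
    rw [integral_add' (hiA s) ((hiW s).const_mul (μ / 2))] at h1
    simp only [integral_const_mul] at h1
    have h2 : 90 * a * L ^ 2 / μ * ∫ ω, ‖(run (s + 1) ω).iterate
        - proxPoint f L (run (s + 1) ω).center‖ ^ 2 ∂Pr ≤ 30 * tol (s + 1) / a := by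
      have ht := htol0 (s + 1)
      calc _ ≤ 90 * a * L ^ 2 / μ * (2 * tol (s + 1) / (3 * L)) := by gcongr
        _ = 30 * tol (s + 1) / a * ((2 * L * a ^ 2) / μ) := by field_simp; norm_num
        _ ≤ 30 * tol (s + 1) / a * 1 := by
          gcongr
          rw [div_le_one hμ, haL]
          nlinarith [sq_nonneg a]
        _ = _ := mul_one _
    have h3 : 0 ≤ a / 20 * A (s + 1) := mul_nonneg (by positivity) (hA0 _)
    change A (s + 1) + (1 - a / 20) * (μ / 2 * W (s + 1))
      ≤ (1 - a) * (A s + μ / 2 * W s) + _ at h1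
    simp only [hΨ]
    linarith
  -- By `1 - a ≤ (1 - 0.9 a)(1 - a/20)²`, the rate `1 - 0.9 a` holds with a factor `1 - a/20` to
  -- spare. Times `150` this slack is `15/2 a (1 - a/20)`, which pays for the tolerance term `20/3
  -- a`.
  have hrec : ∀ s, Ψ s ≤ 150 * (1 - 0.9 * a) ^ s * Δ / q →
      (1 - a / 20) * Ψ (s + 1) ≤ (1 - a) * Ψ s + 30 * tol (s + 1) / a →
      Ψ (s + 1) ≤ 150 * (1 - 0.9 * a) ^ (s + 1) * Δ / q := by
    intro s h1 h2
    have ha20 : 0 < 1 - a / 20 := by linarith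
    refine le_of_mul_le_mul_left (h2.trans ?_) ha20
    set ρ := 1 - 0.9 * a with hρd
    have ht : 30 * tol (s + 1) / a = 20 / 3 * a * (ρ * (ρ ^ s * Δ / a ^ 2)) := by
      rw [htol]
      simp only [pow_succ]
      field_simp
      norm_num
    set Y := ρ ^ s * Δ / a ^ 2 with hY
    have hY0 : 0 < Y := by positivity
    have h3 : Ψ s ≤ 150 * Y := by
      rw [← haq] at h1
      refine h1.trans (le_of_eq ?_)
      rw [hY]
      ring
    have h4 : 150 * ρ ^ (s + 1) * Δ / q = 150 * (ρ * Y) := by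
      rw [hY, ← haq, pow_succ]
      ring
    rw [ht, h4]
    have h5 : (1 - a) * Ψ s ≤ (1 - a) * (150 * Y) :=
      mul_le_mul_of_nonneg_left h3 (by linarith)
    have h6 : (1 - a) ≤ ρ * (1 - a / 20) ^ 2 := by
      have e1 : ρ = 1 - 9 / 10 * a := by rw [hρd]; norm_num
      rw [e1]
      nlinarith [pow_pos ha0 2, pow_pos ha0 3]
    have h7 : (1 - a) * (150 * Y) ≤ ρ * (1 - a / 20) ^ 2 * (150 * Y) := by gcongr
    have h8 : 0 ≤ ρ * Y * (a * (1 - a)) := by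
      have := sub_nonneg.2 ha1
      positivity
    have h9 : 0 ≤ ρ * Y * a := by positivity
    have h10 : (1 - a / 20) * (150 * (ρ * Y)) - ρ * (1 - a / 20) ^ 2 * (150 * Y)
        - 20 / 3 * a * (ρ * Y) = ρ * Y * a * (5 / 6 - 3 / 8 * a) := by ring
    have h11 : 0 ≤ ρ * Y * a * (5 / 6 - 3 / 8 * a) := mul_nonneg h9 (by linarith)
    linarith
  have h00 : ∀ ω, (run 0 ω).iterate = x₀ := fun ω => by rw [hrun]; rfl
  have hv0 : ∀ ω, vv 0 ω = x₀ := h00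
  have hquad : ∀ x, μ / 2 * ‖x - r‖ ^ 2 ≤ f x - f r := by
    intro x
    have := hcf r x
    rw [hr0, inner_zero_left] at this
    linarith
  -- The geometric decay is discarded, since only a uniform bound on the iterates is needed. The
  -- later constant is `273 · 300 · 6 = 491400`.
  have hXle : ∀ s, Ψ s ≤ 150 * (1 - 0.9 * a) ^ s * Δ / q →
      ∫ ω, ‖(run s ω).iterate - r‖ ^ 2 ∂Pr ≤ 300 * Δ / (μ * q) := by
    intro s h
    have h1 := integral_mono (((hx s).sub (memLp_const r)).integrable_norm_sq.const_mul (μ / 2))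
      (hiA s) fun ω => hquad (run s ω).iterate
    rw [integral_const_mul] at h1
    have h2 : A s ≤ 150 * (1 - 0.9 * a) ^ s * Δ / q := by
      have := mul_nonneg (show 0 ≤ μ / 2 by positivity) (hW0 s)
      simp only [hΨ] at h
      linarith
    have h3 : 150 * (1 - 0.9 * a) ^ s * Δ / q ≤ 150 * 1 * Δ / q := by
      gcongr
      exact pow_le_one₀ hρ.le (by norm_num; linarith)
    have h4 : μ / 2 * ∫ ω, ‖(run s ω).iterate - r‖ ^ 2 ∂Pr ≤ 150 * 1 * Δ / q :=
      h1.trans (h2.trans h3)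
    calc ∫ ω, ‖(run s ω).iterate - r‖ ^ 2 ∂Pr
        = 2 / μ * (μ / 2 * ∫ ω, ‖(run s ω).iterate - r‖ ^ 2 ∂Pr) := by field_simp
      _ ≤ 2 / μ * (150 * 1 * Δ / q) := by gcongr
      _ = _ := by field_simp; norm_num
  have htolstep : ∀ s < S, (∀ u ≤ s, Ψ u ≤ 150 * (1 - 0.9 * a) ^ u * Δ / q) →
      ∫ ω, ‖(run (s + 1) ω).iterate - proxPoint f L (run (s + 1) ω).center‖ ^ 2 ∂Pr
        ≤ 2 * tol (s + 1) / (3 * L) := by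
    intro s hs h
    have h1 := integral_norm_start_sub_proxPoint_sq_le hL hM hg hF hξ hr0 (by positivity)
      (by rw [div_le_one (by positivity)]; linarith) (fun s => (hβ s).1) (fun s => (hβ s).2) hrun
      fun u hu => hXle u (h u hu)
    have h2 : 273 * (300 * Δ / (μ * q)) ≤ X * tol (s + 1) / (6 * L) := by
      rw [le_div_iff₀ (by positivity)]
      calc 273 * (300 * Δ / (μ * q)) * (6 * L) = 491400 * L * Δ / (μ * q) := by ring
        _ ≤ _ := hX s hs
    rw [hrun] at h1 ⊢
    exact catalystParams_accuracy hL hM hg hF hξ hX0 htol0 (h1.trans h2)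
  have hmain : ∀ s ≤ S, ∀ u ≤ s, Ψ u ≤ 150 * (1 - 0.9 * a) ^ u * Δ / q := by
    intro s
    induction s with
    | zero =>
      intro _ u hu
      have h1 := hquad x₀
      have h2 : Ψ 0 = f x₀ - f r + μ / 2 * ‖x₀ - r‖ ^ 2 := by simp [hΨ, hA, hW, hv0, h00]
      rw [Nat.le_zero.1 hu, h2, pow_zero, le_div_iff₀ hq0]
      nlinarith
    | succ s ih =>
      intro hs u hu
      have i := ih (by omega)
      rcases Nat.lt_or_ge u (s + 1) with h | h
      · exact i u (by omega)
      · obtain rfl : u = s + 1 := le_antisymm hu h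
        exact hrec s (i s le_rfl) (hstep s (htolstep s (by omega) i))
  have htolS := fun s (hs : s < S) => htolstep s hs (hmain s hs.le)
  refine ⟨?_, hfi, fun s hs => ?_⟩
  · rw [hrun] at htolS ⊢
    exact meetsTolerances_catalystParams hL hM hg hF hξ htolS
  · have h1 := hmain s hs s le_rfl
    have h3 : A s = ∫ ω, f (run s ω).iterate ∂Pr - f r := by
      simp only [hA]
      rw [integral_sub (hfi _) (integrable_const _), integral_const, probReal_univ, one_smul]
    rw [← h3]
    have := mul_nonneg (show 0 ≤ μ / 2 by positivity) (hW0 s)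
    simp only [hΨ] at h1
    linarith

end StronglyConvexConvergence

theorem sum_Icc_one_div_pow_le {r : ℝ} (hr0 : 0 < r) (hr1 : r < 1) (S : ℕ) :
    ∑ s ∈ Finset.Icc 1 S, 1 / r ^ s ≤ 1 / r ^ S / (1 - r) := by
  have h1 : 0 < 1 - r := by linarith
  induction S with
  | zero => simp [h1.le]
  | succ S ih =>
    rw [Finset.sum_Icc_succ_top (Nat.le_add_left 1 S)]
    calc _ ≤ 1 / r ^ S / (1 - r) + 1 / r ^ (S + 1) := by gcongr
      _ = 1 / r ^ (S + 1) / (1 - r) := by rw [pow_succ]; field_simp; ring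

-- Take the least `S` with `150 r ^ S Δ ≤ q ε`, where `r = 1 - 0.9 √q`. As `1/√q ≤ 2 √κ`, it is of
-- order `√κ Λ`. Minimality also bounds `1 / r ^ S` by a multiple of `Δ / (q ε)`. Hence `X` is
-- polynomial in `κ` and `Δ/ε`, and the geometric sum of `1 / tol s` is of order `κ √κ / ε`; times
-- `σ²/(L M)` this is the claimed noise term. One logarithm comes from `S` and one from the rounds.
set_option maxHeartbeats 400000 in
theorem stronglyConvex_cost : ∃ C : ℝ, ∀ (M : ℕ) (L μ σ Δ ε q : ℝ) (tol : ℕ → ℝ),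
    1 ≤ M → 0 < μ → μ ≤ L → 0 < Δ → 0 < ε → q = μ / (μ + 2 * L) →
    (tol = fun s : ℕ => 2 * (1 - 0.9 * √q) ^ s * Δ / 9) →
      ∃ (S : ℕ) (X : ℝ), 0 < X ∧
        (∀ s < S, 491400 * L * Δ / (μ * q) ≤ X * tol (s + 1)) ∧
        150 * (1 - 0.9 * √q) ^ S * Δ / q ≤ ε ∧
        (totalComm S (catalystParams L M σ X tol) : ℝ)
            ≤ C * √(L / μ) * Real.log (2 + L / μ + Δ / ε + σ ^ 2 / (L * ε)) ^ 2 ∧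
        (totalSamples S (catalystParams L M σ X tol) : ℝ)
            ≤ C * (√(L / μ) + √(L / μ) * σ ^ 2 / (μ * M * ε))
              * Real.log (2 + L / μ + Δ / ε + σ ^ 2 / (L * ε)) ^ 2 := by
  set c₁ := Real.log 450 with hc₁
  -- The factor `4.5` inverts the `2/9` in the tolerance, `600` comes from the minimality of `S`,
  -- and `9` from `1/q ≤ 3κ` used twice.
  obtain ⟨d, hd⟩ : ∃ d : ℝ, d = 491400 * 4.5 * 600 * 9 := ⟨_, rfl⟩
  have hd1 : 1 ≤ d := by rw [hd]; norm_num
  set c₂ := Real.log d with hc₂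
  have hc₁0 : 0 ≤ c₁ := Real.log_nonneg (by norm_num)
  have hc₂0 : 0 ≤ c₂ := Real.log_nonneg hd1
  refine ⟨(3 * c₁ + 7) * (48 * c₂ + 197) + 54000 * (24 * c₂ + 98), ?_⟩
  intro M L μ σ Δ ε q tol hM hμ hμL hΔ hε hq htol
  have hL : 0 < L := hμ.trans_le hμL
  have hM0 : (0 : ℝ) < M := by exact_mod_cast hM
  have hq0 : 0 < q := by rw [hq]; positivity
  have hq3 : q ≤ 1 / 3 := by rw [hq, div_le_div_iff₀ (by positivity) (by norm_num)]; linarith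
  set κ := L / μ with hκ
  have hκ1 : 1 ≤ κ := (one_le_div hμ).2 hμL
  have hqκ : 1 / q ≤ 3 * κ := by
    rw [hq, one_div_div, hκ, ← mul_div_assoc]
    gcongr
    linarith
  set a := √q with ha
  have haq : a ^ 2 = q := Real.sq_sqrt hq0.le
  have ha0 : 0 < a := Real.sqrt_pos.2 hq0
  have ha6 : a ≤ 0.6 := by nlinarith
  have hκ0 : 0 < √κ := Real.sqrt_pos.2 (by linarith)
  have hκ1' : 1 ≤ √κ := Real.one_le_sqrt.2 hκ1
  have haκ : 1 / a ≤ 2 * √κ := by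
    rw [← sq_le_sq₀ (by positivity) (by positivity), one_div_pow, haq, mul_pow,
      Real.sq_sqrt (by linarith)]
    linarith
  set r := 1 - 0.9 * a with hr
  have hr0 : 1 / 4 ≤ r := by rw [hr]; norm_num at ha6 ⊢; linarith
  have hr0' : 0 < r := by linarith
  have hr1 : r < 1 := by rw [hr]; norm_num; exact ha0
  have hex : ∃ S : ℕ, 150 * r ^ S * Δ ≤ q * ε := by
    obtain ⟨S, hS⟩ := exists_pow_lt_of_lt_one (show 0 < q * ε / (150 * Δ) by positivity) hr1
    rw [lt_div_iff₀ (by positivity)] at hS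
    exact ⟨S, by linarith⟩
  classical
  set S := Nat.find hex with hS
  have hSle : 150 * r ^ S * Δ ≤ q * ε := Nat.find_spec hex
  set Λ := Real.log (2 + κ + Δ / ε + σ ^ 2 / (L * ε)) with hΛ
  have hΔε : 0 < Δ / ε := by positivity
  have hσ0 : 0 ≤ σ ^ 2 / (L * ε) := by positivity
  have hΛ1 : 1 ≤ Λ := one_le_log_of_three_le (by linarith)
  have hlogκ : Real.log κ ≤ Λ := Real.log_le_log (by linarith) (by linarith)
  have hlogΔ : Real.log (Δ / ε) ≤ Λ := Real.log_le_log (by linarith) (by linarith)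
  have htol0 : ∀ s, 0 < tol s := fun s => by rw [htol]; positivity
  set X := 491400 * 4.5 * (L / (μ * q)) / r ^ S with hX
  have hX0 : 0 < X := by positivity
  have hXtol : ∀ s < S, 491400 * L * Δ / (μ * q) ≤ X * tol (s + 1) := by
    intro s hs
    calc 491400 * L * Δ / (μ * q) = X * (2 * r ^ S * Δ / 9) := by
          rw [hX]; field_simp; norm_num
      _ ≤ X * tol (s + 1) := by
          rw [htol]
          beta_reduce
          have := pow_le_pow_of_le_one hr0'.le hr1.le (show s + 1 ≤ S from hs)
          gcongr
  refine ⟨S, X, hX0, hXtol, ?_, ?_⟩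
  · rw [div_le_iff₀ hq0]; linarith
  -- If the target already holds at `x₀`, both costs are empty sums, and there is no `S - 1` to
  -- which minimality could apply.
  obtain hS0 | hS1 := Nat.eq_zero_or_pos S
  · rw [hS0]
    simp only [totalComm, totalSamples, Finset.Icc_eq_empty_of_lt Nat.zero_lt_one,
      Finset.sum_empty, Nat.cast_zero]
    exact ⟨by positivity, by positivity⟩
  have hlt : q * ε < 150 * r ^ (S - 1) * Δ := not_le.1 (Nat.find_min hex (Nat.sub_lt hS1 one_pos))
  have hSc : ((S - 1 : ℕ) : ℝ) = S - 1 := by rw [Nat.cast_sub hS1, Nat.cast_one]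
  have hrS : 1 / r ^ S ≤ 600 * Δ / (q * ε) := by
    rw [div_le_div_iff₀ (by positivity) (by positivity), one_mul]
    have h1 : r ^ S = r ^ (S - 1) * r := by rw [← pow_succ, Nat.sub_add_cancel hS1]
    have h2 : r ^ (S - 1) * (1 / 4) ≤ r ^ (S - 1) * r := by gcongr
    rw [h1]
    nlinarith only [h2, hlt, hΔ]
  have hSΛ : (S : ℝ) ≤ (3 * c₁ + 7) * (√κ * Λ) := by
    have h1 : 0.9 * a * ((S : ℝ) - 1) ≤ c₁ + 2 * Λ + Real.log 1 := by
      have h2 : r ^ (S - 1) ≤ Real.exp (-(0.9 * a * ((S : ℝ) - 1))) := by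
        calc r ^ (S - 1) ≤ Real.exp (-(0.9 * a)) ^ (S - 1) := by
              gcongr
              exact Real.one_sub_le_exp_neg _
          _ = _ := by rw [← Real.exp_nat_mul, hSc]; congr 1; ring
      have h3 : Real.exp (0.9 * a * ((S : ℝ) - 1)) ≤ 450 * (κ * (Δ / ε)) := by
        rw [Real.exp_neg, ← one_div, le_div_iff₀ (Real.exp_pos _)] at h2
        have h4 : 0 < r ^ (S - 1) := by positivity
        have h5 : Real.exp (0.9 * a * ((S : ℝ) - 1)) ≤ 1 / r ^ (S - 1) := by
          rw [le_div_iff₀ h4]; linarith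
        have h6 : 1 / r ^ (S - 1) ≤ 150 * (1 / q) * (Δ / ε) := by
          rw [show 150 * (1 / q) * (Δ / ε) = 150 * Δ / (q * ε) by field_simp,
            div_le_div_iff₀ h4 (by positivity)]
          linarith
        calc _ ≤ 150 * (1 / q) * (Δ / ε) := h5.trans h6
          _ ≤ 150 * (3 * κ) * (Δ / ε) := by gcongr
          _ = _ := by ring
      have h4 := Real.log_le_log (Real.exp_pos _) h3
      rw [Real.log_exp, Real.log_mul (by norm_num) (by positivity),
        Real.log_mul (by positivity) (by positivity)] at h4
      rw [Real.log_one]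
      linarith
    rw [Real.log_one, add_zero] at h1
    have h2 : (S : ℝ) - 1 ≤ (c₁ + 2 * Λ) * (10 / 9) * (1 / a) := by
      rw [mul_one_div, le_div_iff₀ ha0]
      norm_num at h1
      linarith
    have h3 : (c₁ + 2 * Λ) * (10 / 9) * (1 / a) ≤ (c₁ * Λ + 2 * Λ) * (10 / 9) * (2 * √κ) := by
      gcongr
      exact le_mul_of_one_le_right hc₁0 hΛ1
    have h4 : 1 ≤ √κ * Λ := one_le_mul_of_one_le_of_one_le hκ1' hΛ1
    have h5 : 0 ≤ c₁ * (√κ * Λ) := by positivity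
    linarith only [h2, h3, h4, h5]
  have hXle : X ≤ d * (κ ^ 3 * (Δ / ε)) := by
    calc X = 491400 * 4.5 * (κ * (1 / q)) * (1 / r ^ S) := by rw [hX, hκ]; field_simp
      _ ≤ 491400 * 4.5 * (κ * (1 / q)) * (600 * (1 / q) * (Δ / ε)) := by
          gcongr
          exact hrS.trans_eq (by field_simp)
      _ ≤ 491400 * 4.5 * (κ * (3 * κ)) * (600 * (3 * κ) * (Δ / ε)) := by gcongr
      _ = _ := by rw [hd]; ring
  have hX1 : 1 ≤ X := by
    have h1 : 1 ≤ κ * (1 / q) := one_le_mul_of_one_le_of_one_le hκ1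
      (by rw [le_div_iff₀ hq0]; linarith)
    have h2 : 1 ≤ 1 / r ^ S := by
      rw [le_div_iff₀ (by positivity), one_mul]
      exact pow_le_one₀ hr0'.le hr1.le
    calc (1 : ℝ) ≤ 491400 * 4.5 * ((κ * (1 / q)) * (1 / r ^ S)) := by
          exact one_le_mul_of_one_le_of_one_le (by norm_num)
            (one_le_mul_of_one_le_of_one_le h1 h2)
      _ = X := by rw [hX, hκ]; field_simp
  set T := roundsFor X with hT
  have hTle : (T : ℝ) ≤ (24 * c₂ + 98) * Λ := by
    have h := roundsFor_le hX1
    have h1 : Real.log X ≤ c₂ + 4 * Λ := by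
      refine (Real.log_le_log hX0 hXle).trans ?_
      rw [Real.log_mul (by positivity : d ≠ 0) (by positivity),
        Real.log_mul (by positivity) (by positivity), Real.log_pow]
      push_cast
      linarith
    nlinarith only [h, h1, hΛ1, hc₂0]
  have hT0 : (0 : ℝ) ≤ T := Nat.cast_nonneg _
  have hST : (S : ℝ) * (1 + 2 * T) ≤ (3 * c₁ + 7) * (48 * c₂ + 197) * √κ * Λ ^ 2 := by
    calc (S : ℝ) * (1 + 2 * T)
        ≤ ((3 * c₁ + 7) * (√κ * Λ)) * (Λ + 2 * ((24 * c₂ + 98) * Λ)) := by gcongr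
      _ = _ := by ring
  have hC0 : 0 ≤ 54000 * (24 * c₂ + 98) * √κ * Λ ^ 2 := by positivity
  constructor
  · rw [totalComm_catalystParams, ← hT]
    have h1 : (S : ℝ) * (1 + T) ≤ S * (1 + 2 * T) := by gcongr; linarith
    linarith
  · refine (totalSamples_catalystParams_le hL σ _ htol0 S).trans ?_
    rw [← hT]
    have hsum : ∑ s ∈ Finset.Icc 1 S, 1 / tol s ≤ 18000 * κ * √κ / ε := by
      calc ∑ s ∈ Finset.Icc 1 S, 1 / tol s
          = 9 / (2 * Δ) * ∑ s ∈ Finset.Icc 1 S, 1 / r ^ s := by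
            rw [Finset.mul_sum]
            refine Finset.sum_congr rfl fun s _ => ?_
            rw [htol]
            field_simp
        _ ≤ 9 / (2 * Δ) * (600 * Δ / (q * ε) / (1 - r)) := by
            have h1 : 0 < 1 - r := by linarith
            gcongr
            exact (sum_Icc_one_div_pow_le hr0' hr1 S).trans (by gcongr)
        _ = 3000 * (1 / q) * (1 / a) / ε := by
            rw [show 1 - r = 0.9 * a by rw [hr]; ring]
            field_simp
            norm_num
        _ ≤ 3000 * (3 * κ) * (2 * √κ) / ε := by gcongr
        _ = _ := by ring
    have h2 : T * (3 * σ ^ 2 / (L * M)) * ∑ s ∈ Finset.Icc 1 S, 1 / tol s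
        ≤ 54000 * (24 * c₂ + 98) * (√κ * σ ^ 2 / (μ * M * ε)) * Λ ^ 2 := by
      calc _ ≤ ((24 * c₂ + 98) * Λ ^ 2) * (3 * σ ^ 2 / (L * M)) * (18000 * κ * √κ / ε) := by
            have h3 : Λ ≤ Λ ^ 2 := le_self_pow₀ hΛ1 two_ne_zero
            have h4 : (T : ℝ) ≤ (24 * c₂ + 98) * Λ ^ 2 := hTle.trans (by gcongr)
            have h5 : 0 ≤ ∑ s ∈ Finset.Icc 1 S, 1 / tol s :=
              Finset.sum_nonneg fun s _ => (one_div_pos.2 (htol0 s)).le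
            gcongr
        _ = 54000 * (24 * c₂ + 98) * (√κ * σ ^ 2 / (μ * M * ε)) * Λ ^ 2 * (κ * μ / L) := by
            field_simp; ring
        _ = _ := by rw [hκ, div_mul_cancel₀ _ hμ.ne', div_self hL.ne', mul_one]
    have h4 : 0 ≤ (3 * c₁ + 7) * (48 * c₂ + 197) * (√κ * σ ^ 2 / (μ * M * ε)) * Λ ^ 2 := by
      positivity
    linarith

end
-- Assembly of the three cases
theorem mainTheorem9 :
    -- strongly convex
    (∃ C : ℝ, ∃ p : ℕ, ∀ (M : ℕ) (L μ σ Δ ε : ℝ), 1 ≤ M → 0 < μ → μ ≤ L → 0 ≤ σ → 0 < Δ → 0 < ε →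
      ∃ (S : ℕ) (prm : ℕ → ScaffoldParams), (∀ s, (prm s).Admissible) ∧
        (totalComm S prm : ℝ) ≤
          C * √(L / μ) * Real.log (2 + L / μ + Δ / ε + σ ^ 2 / (L * ε)) ^ p ∧
        (totalSamples S prm : ℝ) ≤
          C * (√(L / μ) + √(L / μ) * σ ^ 2 / (μ * M * ε))
            * Real.log (2 + L / μ + Δ / ε + σ ^ 2 / (L * ε)) ^ p ∧
        ∀ (n : ℕ) (F : Fin M → EuclideanSpace ℝ (Fin n) → ℝ)
          (x₀ xstar : EuclideanSpace ℝ (Fin n)),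
          (∀ m, IsLSmooth L (F m)) →
          (∀ m, StrongConvexOn Set.univ μ (F m)) →
          IsMinOn (globalObjective F) Set.univ xstar →
          globalObjective F x₀ - globalObjective F xstar ≤ Δ →
          ∀ (Ω : Type u) [MeasurableSpace Ω] (Pr : Measure Ω) [IsProbabilityMeasure Pr]
            (Ξ : Type v) [MeasurableSpace Ξ] (P : Fin M → Measure Ξ)
            (g : Fin M → EuclideanSpace ℝ (Fin n) → Ξ → EuclideanSpace ℝ (Fin n))
            (ξ : ℕ → ℕ → Fin M → Ω → Ξ),
            IsStochasticOracle F P g σ → AreFreshSamples P Pr ξ →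
            let q := μ / (μ + 2 * L)
            let run := catalystScaffold L g ξ prm (2 * L / (2 * L + μ)) (catalystBeta q (√q)) x₀
            MeetsTolerances Pr (globalObjective F) L S run
              (fun s => 2 * (1 - 0.9 * √q) ^ s * Δ / 9) ∧
            Integrable (fun ω => globalObjective F (run S ω).iterate) Pr ∧
            ∫ ω, globalObjective F (run S ω).iterate ∂Pr - globalObjective F xstar ≤ ε) ∧
    -- convex
    (∃ p : ℕ, ∀ (L Δ D γ : ℝ), 0 < L → 0 < Δ → 0 < D → 0 < γ → γ ≤ 1 →
      ∃ C : ℝ, ∀ (M : ℕ) (σ ε : ℝ), 1 ≤ M → 0 ≤ σ → 0 < ε → ε ≤ 1 →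
      ∃ (S : ℕ) (prm : ℕ → ScaffoldParams), (∀ s, (prm s).Admissible) ∧
        (totalComm S prm : ℝ) ≤ C * (1 / √ε) * Real.log (2 + σ + 1 / ε) ^ p ∧
        (totalSamples S prm : ℝ) ≤
          C * (1 / √ε + σ ^ 2 / (M * ε ^ (2.5 + γ / 2 : ℝ)))
            * Real.log (2 + σ + 1 / ε) ^ p ∧
        ∀ (n : ℕ) (F : Fin M → EuclideanSpace ℝ (Fin n) → ℝ)
          (x₀ xstar : EuclideanSpace ℝ (Fin n)),
          (∀ m, IsLSmooth L (F m)) →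
          (∀ m, ConvexOn ℝ Set.univ (F m)) →
          IsMinOn (globalObjective F) Set.univ xstar →
          globalObjective F x₀ - globalObjective F xstar ≤ Δ →
          ‖x₀ - xstar‖ ≤ D →
          ∀ (Ω : Type u) [MeasurableSpace Ω] (Pr : Measure Ω) [IsProbabilityMeasure Pr]
            (Ξ : Type v) [MeasurableSpace Ξ] (P : Fin M → Measure Ξ)
            (g : Fin M → EuclideanSpace ℝ (Fin n) → Ξ → EuclideanSpace ℝ (Fin n))
            (ξ : ℕ → ℕ → Fin M → Ω → Ξ),
            IsStochasticOracle F P g σ → AreFreshSamples P Pr ξ →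
            let run := catalystScaffold L g ξ prm 1 (catalystBeta 0 1) x₀
            MeetsTolerances Pr (globalObjective F) L S run
              (fun s => 2 * Δ / (9 * ((s : ℝ) + 1) ^ (4 + γ))) ∧
            Integrable (fun ω => globalObjective F (run S ω).iterate) Pr ∧
            ∫ ω, globalObjective F (run S ω).iterate ∂Pr - globalObjective F xstar ≤ ε) ∧
    -- nonconvex
    (∃ p : ℕ, ∀ (L Δ : ℝ), 0 < L → 0 < Δ →
      ∃ C : ℝ, ∀ (M : ℕ) (σ ε : ℝ), 1 ≤ M → 0 ≤ σ → 0 < ε → ε ≤ 1 →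
      ∃ (S : ℕ) (prm : ℕ → ScaffoldParams), 1 ≤ S ∧ (∀ s, (prm s).Admissible) ∧
        (totalComm S prm : ℝ) ≤ C * (1 / ε ^ 2) * Real.log (2 + σ + 1 / ε) ^ p ∧
        (totalSamples S prm : ℝ) ≤
          C * (1 / ε ^ 2 + σ ^ 2 / (M * ε ^ 4)) * Real.log (2 + σ + 1 / ε) ^ p ∧
        ∀ (n : ℕ) (F : Fin M → EuclideanSpace ℝ (Fin n) → ℝ) (x₀ : EuclideanSpace ℝ (Fin n)),
          (∀ m, IsLSmooth L (F m)) →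
          (∀ x, globalObjective F x₀ - globalObjective F x ≤ Δ) →
          ∀ (Ω : Type u) [MeasurableSpace Ω] (Pr : Measure Ω) [IsProbabilityMeasure Pr]
            (Ξ : Type v) [MeasurableSpace Ξ] (P : Fin M → Measure Ξ)
            (g : Fin M → EuclideanSpace ℝ (Fin n) → Ξ → EuclideanSpace ℝ (Fin n))
            (ξ : ℕ → ℕ → Fin M → Ω → Ξ),
            IsStochasticOracle F P g σ → AreFreshSamples P Pr ξ →
            let run := catalystScaffold L g ξ prm 0 (fun _ => 0) x₀
            MeetsTolerances Pr (globalObjective F) L S run (fun _ => Δ / S) ∧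
            (∀ s ∈ Finset.Icc 1 S,
              Integrable (fun ω => ‖gradient (globalObjective F) (run s ω).iterate‖ ^ 2) Pr) ∧
            (1 / (S : ℝ)) * ∑ s ∈ Finset.Icc 1 S,
              ∫ ω, ‖gradient (globalObjective F) (run s ω).iterate‖ ^ 2 ∂Pr ≤ ε ^ 2) := by
  refine ⟨?_, ⟨1, ?_⟩, ⟨1, ?_⟩⟩
  · obtain ⟨C, hC⟩ := stronglyConvex_cost
    refine ⟨C, 2, fun M L μ σ Δ ε hM hμ hμL hσ hΔ hε => ?_⟩
    have hL := hμ.trans_le hμL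
    obtain ⟨S, X, hX0, hX, hSε, hcomm, hsamples⟩ := hC M L μ σ Δ ε _ _ hM hμ hμL hΔ hε rfl rfl
    refine ⟨S, _, catalystParams_admissible hL hM σ X _, hcomm, hsamples, ?_⟩
    intro n F x₀ xstar hF hc hr hx₀ Ω _ Pr _ Ξ _ P g ξ hg hξ q run
    obtain ⟨h1, h2, h3⟩ := stronglyConvex_convergence hL hM hμ hΔ hF hc hr hx₀ hg hξ
      (q := q) (run := run) rfl rfl hX0 hX rfl
    exact ⟨h1, h2 S, (h3 S le_rfl).trans hSε⟩
  · intro L Δ D γ hL hΔ hD hγ hγ1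
    obtain ⟨C, hC⟩ := convex_cost (D := D) hL hΔ hγ hγ1
    refine ⟨C, fun M σ ε hM hσ hε hε1 => ?_⟩
    obtain ⟨S, X, hS, hX0, hX, hSε, hcomm, hsamples⟩ := hC M σ ε hM hσ hε hε1
    rw [← pow_one (Real.log (2 + σ + 1 / ε))] at hcomm hsamples
    refine ⟨S, _, catalystParams_admissible hL hM σ X _, hcomm, hsamples, ?_⟩
    intro n F x₀ xstar hF hc hr hx₀ hxD Ω _ Pr _ Ξ _ P g ξ hg hξ run
    obtain ⟨h1, h2, h3⟩ := convex_convergence hL hM hΔ hγ hF hc hr hxD hg hξ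
      (run := run) rfl hX0 hX rfl
    refine ⟨h1, h2 S, ?_⟩
    -- The gap of the iterate `s + 1` is bounded through `αₛ ≤ 2 / (s + 2)`, which gives at most `4B
    -- / (s + 1)² ≤ ε`.
    obtain ⟨s, rfl⟩ := Nat.exists_eq_succ_of_ne_zero (Nat.one_le_iff_ne_zero.1 hS)
    refine (h3 s s.lt_succ_self).trans ?_
    have hα := (catalystAlpha_convex_inv_bounds s).1
    have hα0 := catalystAlpha_convex_pos s
    have hB : 0 ≤ convexBound L Δ D γ := by
      have := le_convexBound (D := D) hL hΔ hγ
      have : 0 ≤ L * D ^ 2 := by positivity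
      linarith
    have h4 : (s + 1 : ℝ) * catalystAlpha 0 1 s ≤ 2 := by
      rw [le_div_iff₀ hα0] at hα
      nlinarith
    have h5 : ((s + 1 : ℝ) * catalystAlpha 0 1 s) ^ 2 ≤ 2 ^ 2 :=
      pow_le_pow_left₀ (by positivity) h4 2
    have h6 : ((s.succ : ℕ) : ℝ) = s + 1 := Nat.cast_succ s
    rw [h6] at hSε
    have h7 : (0 : ℝ) < (s + 1) ^ 2 := by positivity
    refine le_of_mul_le_mul_right ?_ h7
    nlinarith
  · intro L Δ hL hΔ
    obtain ⟨C, hC⟩ := nonconvex_cost hL hΔ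
    refine ⟨C, fun M σ ε hM hσ hε hε1 => ?_⟩
    obtain ⟨S, hS, hSε, hcomm, hsamples⟩ := hC M σ ε hM hσ hε hε1
    rw [← pow_one (Real.log (2 + σ + 1 / ε))] at hcomm hsamples
    refine ⟨S, _, hS, catalystParams_admissible hL hM σ _ _, hcomm, hsamples, ?_⟩
    intro n F x₀ hF hx₀ Ω _ Pr _ Ξ _ P g ξ hg hξ run
    obtain ⟨h1, h2, h3⟩ := nonconvex_convergence hL hM hΔ hS hF hx₀ hg hξ (run := run) rfl
    refine ⟨h1, fun s _ => h2 s, ?_⟩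
    have hS0 : (0 : ℝ) < S := by exact_mod_cast hS
    rw [one_div, inv_mul_le_iff₀ hS0]
    exact h3.trans hSε
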